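/- Let $K$ be any field. Conventions. All modules are left modules; $pq$ means "first $q$, then $p$" for paths $p,q$ of a quiver. Algebras $\Lambda=KQ/I$ are given by a finite quiver $Q$ with vertex set $E=Q_0$ (identified with the primitive idempotents $e\in\Lambda$) and an admissible ideal $I$ of the path algebra $KQ$; $J$ is the Jacobson radical. $\Lambda$ is *monomial* if $I$ can be generated by paths. For $n\ge 1$, $\operatorname{fin\,dim}_n\Lambda$ is the supremum of the finite projective dimensions attained on $\Lambda$-modules $M$ such that every simple module has multiplicity at most $n$ in $M/JM$ (equivalently, $M$ can be generated by at most $n$ elements). *Stacks.* A *stacking partition* of $\Lambda=KQ/I$ is a disjoint partition $E=E'\cup E''$ such that (a) every arrow that starts in $E'$ also ends in $E'$, and (b) if $\alpha$ is an arrow that starts in $E''$ and ends in $E'$, and $\beta$ is an arrow with $\alpha\beta\notin I$, then $\beta$ starts in a source of $Q$. If $E'$ and $E''$ are both non-empty and $\mathbf e'=\sum_{e\in E'}e$, $\mathbf e''=\sum_{e\in E''}e$, then $\Lambda$ is called a *2-stack*, obtained by stacking $\Lambda''=\mathbf e''\Lambda\mathbf e''$ on top of $\Lambda'=\mathbf e'\Lambda\mathbf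 e'$; here $\Lambda'$ and $\Lambda''$ are presented by the full subquivers of $Q$ on $E'$ and $E''$. For $c\ge 0$, $\Lambda$ is a *$(c+1)$-stack* of $\Delta_0,\dots,\Delta_c$ if there are algebras $\Lambda_0=\Delta_0,\Lambda_1,\dots,\Lambda_c=\Lambda$ such that $\Lambda_i$ is a 2-stack obtained by stacking $\Delta_i$ on top of $\Lambda_{i-1}$ for $1\le i\le c$. *Tree graphs.* A $\Lambda$-module $M$ has a *tree graph* if $M$ has a finite $K$-basis $(x_i)$ with the following properties: each $x_i$ satisfies $x_i=e_ix_i$ for a vertex $e_i$ and is assigned a layer $\ell(i)\ge 0$; for all $n\ge 0$, $J^nM$ is the span of the $x_i$ with $\ell(i)\ge n$; for every $i$ and every arrow $\alpha$ starting in $e_i$, $\alpha x_i$ is either $0$ or a nonzero scalar multiple of some $x_j$; and the graph with the $x_i$ as vertices and with one edge between $x_i$ and $x_j$ for every arrow $\alpha$ such that $\alpha x_i$ is a nonzero multiple of $x_j$ is a tree (connected, without cycles or multiple edges). **Theorem.** Let $f:\mathbb N=\{1,2,\dots\}\to\mathbb N_{\ge 2}$ be a (weakly) increasing function that takes only finitely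 many values, and put $d=\max f-\min f$. Then there is a finite dimensional connected algebra $\Lambda=KQ/I$ as above with $J^3=0$ such that 1. $\operatorname{fin\,dim}_n\Lambda=f(n)$ for all $n\in\mathbb N$; 2. $\Lambda$ is a $(\lceil d/2\rceil+1)$-stack of monomial algebras; 3. for each $n\in\mathbb N$, $\operatorname{fin\,dim}_n\Lambda$ is attained on a module that can be generated by at most $n$ elements, has Loewy length at most $2$ (that is, $J^2M=0$), and has a tree graph. -/

import Mathlib

universe u

noncomputable section

namespace Stacks

/-! ## Path algebras -/

/-- All paths of a quiver, as triples (starting vertex, end vertex, path); the trivial paths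
`Quiver.Path.nil` at the vertices are included. -/
abbrev Paths (V : Type) [Quiver.{0} V] : Type := Σ a b : V, Quiver.Path a b

/-- The length of a path. -/
def Paths.length {V : Type} [Quiver.{0} V] (p : Paths V) : ℕ := p.2.2.length

/-- The underlying space of the path algebra `KQ`: the `K`-vector space on the set of all paths. -/
def PathAlgebra (K : Type u) [Field K] (V : Type) [Quiver.{0} V] : Type u := Paths V →₀ K

namespace PathAlgebra

variable (K : Type u) [Field K] {V : Type} [Quiver.{0} V]

instance : AddCommGroup (PathAlgebra K V) := inferInstanceAs (AddCommGroup (Paths V →₀ K))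
instance : Module K (PathAlgebra K V) := inferInstanceAs (Module K (Paths V →₀ K))

/-- A path as an element of the path algebra. -/
def ofPath (p : Paths V) : PathAlgebra K V := (Finsupp.single p (1 : K) : Paths V →₀ K)

open Classical in
/-- The product `pq` of two paths is `q` followed by `p` if `q` ends where `p` starts, and `0`
otherwise. -/
def mulPath (p q : Paths V) : PathAlgebra K V :=
  if h : q.2.1 = p.1 then ofPath K ⟨q.1, p.2.1, q.2.2.comp (p.2.2.cast h.symm rfl)⟩ else 0

/-- The linear extension of a map on paths. -/
def extend {N : Type u} [AddCommGroup N] [Module K N] (g : Paths V → N) :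
    PathAlgebra K V →ₗ[K] N :=
  (Finsupp.linearCombination K g : (Paths V →₀ K) →ₗ[K] N)

lemma extend_ofPath {N : Type u} [AddCommGroup N] [Module K N] (g : Paths V → N) (p : Paths V) :
    extend K g (ofPath K p) = g p := by
  have h : Finsupp.linearCombination K g (Finsupp.single p (1 : K)) = g p := by simp
  exact h

/-- The product of the path algebra: the bilinear extension of the product of paths. -/
def mulLin : PathAlgebra K V →ₗ[K] PathAlgebra K V →ₗ[K] PathAlgebra K V :=
  extend K fun p => extend K fun q => mulPath K p q

instance : Mul (PathAlgebra K V) := ⟨fun x y => mulLin K x y⟩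

variable {K}

lemma mul_def (x y : PathAlgebra K V) : x * y = mulLin K x y := rfl

lemma ofPath_mul (p q : Paths V) : ofPath K p * ofPath K q = mulPath K p q := by
  rw [mul_def, mulLin, extend_ofPath, extend_ofPath]

lemma ofPath_mul_of_eq {a b c : V} (p : Quiver.Path b c) (q : Quiver.Path a b) :
    ofPath K (⟨b, c, p⟩ : Paths V) * ofPath K ⟨a, b, q⟩ = ofPath K ⟨a, c, q.comp p⟩ := by
  rw [ofPath_mul, mulPath, dif_pos rfl]; rfl

lemma ofPath_mul_of_ne {p q : Paths V} (h : q.2.1 ≠ p.1) :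
    ofPath K p * ofPath K q = 0 := by
  rw [ofPath_mul, mulPath, dif_neg h]

lemma ind {C : PathAlgebra K V → Prop} (x : PathAlgebra K V) (h0 : C 0)
    (ha : ∀ x y, C x → C y → C (x + y)) (hs : ∀ (k : K) p, C (k • ofPath K p)) : C x := by
  refine Finsupp.induction_linear (motive := C) x h0 ha fun p k => ?_
  have h := hs k p
  have e : k • (Finsupp.single p (1 : K) : Paths V →₀ K) = Finsupp.single p k := by simp
  exact e ▸ h

lemma add_mul' (x y z : PathAlgebra K V) : (x + y) * z = x * z + y * z := by
  simp only [mul_def, map_add, LinearMap.add_apply]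
lemma mul_add' (x y z : PathAlgebra K V) : x * (y + z) = x * y + x * z := by
  simp only [mul_def, map_add]
lemma smul_mul' (k : K) (x y : PathAlgebra K V) : (k • x) * y = k • (x * y) := by
  simp only [mul_def, map_smul, LinearMap.smul_apply]
lemma mul_smul' (k : K) (x y : PathAlgebra K V) : x * (k • y) = k • (x * y) := by
  simp only [mul_def, map_smul]
lemma zero_mul' (x : PathAlgebra K V) : 0 * x = 0 := by
  simp only [mul_def, map_zero, LinearMap.zero_apply]
lemma mul_zero' (x : PathAlgebra K V) : x * 0 = 0 := by
  simp only [mul_def, map_zero]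

lemma ofPath_mul_assoc (p q r : Paths V) :
    ofPath K p * ofPath K q * ofPath K r = ofPath K p * (ofPath K q * ofPath K r) := by
  obtain ⟨a, b, p⟩ := p
  obtain ⟨c, d, q⟩ := q
  obtain ⟨e, f, r⟩ := r
  by_cases h₁ : d = a
  · subst h₁
    by_cases h₂ : f = c
    · subst h₂
      simp only [ofPath_mul_of_eq, Quiver.Path.comp_assoc]
    · have h₂' : (⟨e, f, r⟩ : Paths V).2.1 ≠ (⟨c, d, q⟩ : Paths V).1 := h₂
      rw [ofPath_mul_of_eq, ofPath_mul_of_ne h₂', mul_zero', ofPath_mul_of_ne]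
      exact h₂
  · have h₁' : (⟨c, d, q⟩ : Paths V).2.1 ≠ (⟨a, b, p⟩ : Paths V).1 := h₁
    rw [ofPath_mul_of_ne h₁', zero_mul']
    by_cases h₂ : f = c
    · subst h₂
      rw [ofPath_mul_of_eq, ofPath_mul_of_ne]
      exact h₁
    · have h₂' : (⟨e, f, r⟩ : Paths V).2.1 ≠ (⟨c, d, q⟩ : Paths V).1 := h₂
      rw [ofPath_mul_of_ne h₂', mul_zero']

lemma mul_assoc' (x y z : PathAlgebra K V) : x * y * z = x * (y * z) := by
  refine ind (C := fun x => x * y * z = x * (y * z)) x (by simp only [zero_mul'])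
    (fun x₁ x₂ h₁ h₂ => by simp only [add_mul', h₁, h₂]) fun k p => ?_
  refine ind (C := fun y => k • ofPath K p * y * z = k • ofPath K p * (y * z)) y
    (by simp only [zero_mul', mul_zero'])
    (fun y₁ y₂ h₁ h₂ => by simp only [mul_add', add_mul', h₁, h₂]) fun l q => ?_
  refine ind (C := fun z => k • ofPath K p * l • ofPath K q * z =
      k • ofPath K p * (l • ofPath K q * z)) z
    (by simp only [mul_zero']) (fun z₁ z₂ h₁ h₂ => by simp only [mul_add', h₁, h₂]) fun m r => ?_
  simp only [smul_mul', mul_smul', ofPath_mul_assoc]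

variable (K)

/-- The trivial path at a vertex, as an element of the path algebra. -/
def vertex (v : V) : PathAlgebra K V := ofPath K ⟨v, v, Quiver.Path.nil⟩

/-- An arrow, as an element of the path algebra. -/
def arrow {a b : V} (α : a ⟶ b) : PathAlgebra K V := ofPath K ⟨a, b, α.toPath⟩

variable {K}
variable [Fintype V]

instance : One (PathAlgebra K V) := ⟨∑ v : V, vertex K v⟩

lemma one_def : (1 : PathAlgebra K V) = ∑ v : V, vertex K v := rfl

lemma one_mul' (x : PathAlgebra K V) : 1 * x = x := by
  refine ind (C := fun x => 1 * x = x) x (mul_zero' 1) (fun x₁ x₂ h₁ h₂ => by rw [mul_add', h₁, h₂]) fun k p => ?_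
  obtain ⟨a, b, p⟩ := p
  rw [mul_smul', one_def, mul_def, map_sum, LinearMap.sum_apply]
  simp only [← mul_def]
  rw [Finset.sum_eq_single b]
  · rw [vertex, ofPath_mul_of_eq, Quiver.Path.comp_nil]
  · intro v _ hv
    exact ofPath_mul_of_ne hv.symm
  · simp

lemma mul_one' (x : PathAlgebra K V) : x * 1 = x := by
  refine ind (C := fun x => x * 1 = x) x (zero_mul' 1) (fun x₁ x₂ h₁ h₂ => by rw [add_mul', h₁, h₂]) fun k p => ?_
  obtain ⟨a, b, p⟩ := p
  rw [smul_mul', one_def, mul_def, map_sum]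
  simp only [← mul_def]
  rw [Finset.sum_eq_single a]
  · rw [vertex, ofPath_mul_of_eq, Quiver.Path.nil_comp]
  · intro v _ hv
    exact ofPath_mul_of_ne hv
  · simp

/-- The path algebra of a quiver with finitely many vertices is a ring with unit the sum of the
trivial paths. -/
instance : Ring (PathAlgebra K V) :=
  { (inferInstance : AddCommGroup (PathAlgebra K V)) with
    mul := (· * ·)
    one := 1
    left_distrib := mul_add'
    right_distrib := add_mul'
    zero_mul := zero_mul'
    mul_zero := mul_zero'
    mul_assoc := mul_assoc'
    one_mul := one_mul'
    mul_one := mul_one' }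

instance : Algebra K (PathAlgebra K V) := Algebra.ofModule smul_mul' mul_smul'

end PathAlgebra

/-! ## Path algebras modulo admissible ideals -/

/-- A finite quiver `Q` (vertex set `V`) with an admissible ideal `I` of its path algebra. -/
structure BoundQuiver (K : Type u) [Field K] where
  /-- the vertices -/
  V : Type
  [fintypeV : Fintype V]
  [quiver : Quiver.{0} V]
  [finiteHom : ∀ a b : V, Finite (a ⟶ b)]
  /-- the ideal of relations -/
  I : Ideal (PathAlgebra K V)
  [isTwoSided : I.IsTwoSided]
  /-- `I` lies in the square of the ideal generated by the arrows. -/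
  two_le_length : ∀ x ∈ I, ∀ p : Paths V, (show Paths V →₀ K from x) p ≠ 0 → 2 ≤ p.length
  /-- `I` contains a power of the ideal generated by the arrows. -/
  exists_length_mem : ∃ N : ℕ, ∀ p : Paths V, N ≤ p.length → PathAlgebra.ofPath K p ∈ I

namespace BoundQuiver

attribute [instance] BoundQuiver.fintypeV BoundQuiver.quiver BoundQuiver.finiteHom
  BoundQuiver.isTwoSided

variable {K : Type u} [Field K]

/-- The algebra `Λ = KQ/I`. -/
abbrev Alg (B : BoundQuiver K) : Type u := PathAlgebra K B.V ⧸ B.I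

/-- The primitive idempotent of `Λ` given by a vertex. -/
def e (B : BoundQuiver K) (v : B.V) : B.Alg := Ideal.Quotient.mk B.I (PathAlgebra.vertex K v)

/-- The residue class in `Λ` of an arrow. -/
def arr (B : BoundQuiver K) {a b : B.V} (α : a ⟶ b) : B.Alg :=
  Ideal.Quotient.mk B.I (PathAlgebra.arrow K α)

/-- `Λ = KQ/I` is a monomial algebra: the two-sided ideal `I` is generated by paths. -/
def IsMonomial (B : BoundQuiver K) : Prop :=
  ∃ S : Set (Paths B.V), B.I = (TwoSidedIdeal.span (PathAlgebra.ofPath K '' S)).asIdeal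

/-! ## Stacks -/

/-- A source: a vertex in which no arrow ends. -/
def IsSource (B : BoundQuiver K) (v : B.V) : Prop := ∀ w : B.V, IsEmpty (w ⟶ v)

/-- `(E', E'ᶜ)` is a stacking partition. -/
structure IsStackingPartition (B : BoundQuiver K) (E' : Set B.V) : Prop where
  /-- every arrow that starts in `E'` also ends in `E'` -/
  closed : ∀ ⦃a b : B.V⦄, (a ⟶ b) → a ∈ E' → b ∈ E'
  /-- if `α` starts in `E'' = E'ᶜ` and ends in `E'`, and `αβ ∉ I` (first `β`, then `α`), then
  `β` starts in a source -/
  source : ∀ ⦃a b c d : B.V⦄ (α : a ⟶ b) (β : c ⟶ d), a ∉ E' → b ∈ E' →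
    PathAlgebra.arrow K α * PathAlgebra.arrow K β ∉ B.I → B.IsSource c

open Classical in
/-- The sum of the idempotents in a set of vertices. -/
def eSum (B : BoundQuiver K) (E : Set B.V) : B.Alg := ∑ v : B.V with v ∈ E, B.e v

/-- `C` presents the algebra `𝐞Λ𝐞`, where `𝐞` is the sum of the idempotents in `E`, by the full
subquiver on the vertex set `E`: there is an isomorphism of the quiver of `C` with this full
subquiver that induces an isomorphism of `K`-algebras from the algebra of `C` onto `𝐞Λ𝐞`. -/
def IsCorner (B : BoundQuiver K) (E : Set B.V) (C : BoundQuiver K) : Prop :=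
  ∃ (ι : C.V ↪ B.V) (η : ∀ a b : C.V, (a ⟶ b) ≃ (ι a ⟶ ι b)) (φ : C.Alg →ₙₐ[K] B.Alg),
    Set.range ι = E ∧
    Function.Injective φ ∧
    Set.range φ = {x | ∃ y : B.Alg, x = B.eSum E * y * B.eSum E} ∧
    (∀ v, φ (C.e v) = B.e (ι v)) ∧
    ∀ (a b : C.V) (α : a ⟶ b), φ (C.arr α) = B.arr (η a b α)

/-- `Λ` (given by `B`) is a 2-stack, obtained by stacking `Λ''` (given by `B''`) on top of `Λ'`
(given by `B'`). -/
def IsTwoStack (B B'' B' : BoundQuiver K) : Prop :=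
  ∃ E' : Set B.V, B.IsStackingPartition E' ∧ E'.Nonempty ∧ E'ᶜ.Nonempty ∧
    B.IsCorner E' B' ∧ B.IsCorner E'ᶜ B''

/-- `Λ` (given by `B`) is a `(d+1)`-stack of `Δ 0, …, Δ d`. -/
def IsStack (B : BoundQuiver K) (d : ℕ) (Δ : Fin (d + 1) → BoundQuiver K) : Prop :=
  ∃ L : Fin (d + 1) → BoundQuiver K, L 0 = Δ 0 ∧ L (Fin.last d) = B ∧
    ∀ i : Fin d, (L i.succ).IsTwoStack (Δ i.succ) (L i.castSucc)

/-! ## Layered graphs of modules -/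

section Graph

variable (B : BoundQuiver K) (M : Type u) [AddCommGroup M] [Module B.Alg M]

/-- A layered graph of a left `Λ`-module `M`, with finitely many vertices. The vertices are the
elements `x i` of a `K`-basis of `M`, where `x i` has the type `type i ∈ Q₀` and lies in the layer
`layer i`. The elements in the layers `≥ n` span `JⁿM`; so those in layer `n` give a basis of
`JⁿM/Jⁿ⁺¹M`, and those in layer `0` are top elements that form a basis of `M` modulo `JM`. An arrow
`α` takes each `x i` either to `0` or to a nonzero scalar multiple of some `x j`; the edges
labelled `α` are the pairs `i, j` of the latter kind. (The scalar `k` acts on `M` as the element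
`k · 1` of `Λ`.) -/
structure LayeredGraph where
  /-- the vertices of the graph -/
  ι : Type
  [finite : Finite ι]
  /-- the basis elements -/
  x : ι → M
  /-- the type of a basis element -/
  type : ι → B.V
  /-- the layer of a basis element -/
  layer : ι → ℕ
  e_smul : ∀ i, B.e (type i) • x i = x i
  independent : ∀ c : ι →₀ K, (c.sum fun i k => algebraMap K B.Alg k • x i) = 0 → c = 0
  layer_span : ∀ (n : ℕ) (y : M), y ∈ (Ring.jacobson B.Alg ^ n) • (⊤ : Submodule B.Alg M) ↔
    ∃ c : ι →₀ K, (∀ i ∈ c.support, n ≤ layer i) ∧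
      y = c.sum fun i k => algebraMap K B.Alg k • x i
  arrow_smul : ∀ (i : ι) (b : B.V) (α : type i ⟶ b), B.arr α • x i = 0 ∨
    ∃ (j : ι) (k : K), k ≠ 0 ∧ B.arr α • x i = algebraMap K B.Alg k • x j

variable {B M}

/-- There is an edge labelled `α` from the vertex `i` down to the vertex `j`. -/
def LayeredGraph.Edge (G : B.LayeredGraph M) {i : G.ι} {b : B.V} (α : G.type i ⟶ b) (j : G.ι) :
    Prop :=
  ∃ k : K, k ≠ 0 ∧ B.arr α • G.x i = algebraMap K B.Alg k • G.x j

/-- The underlying unlayered graph, up to multiplicities of edges. -/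
def LayeredGraph.toSimpleGraph (G : B.LayeredGraph M) : SimpleGraph G.ι :=
  SimpleGraph.fromRel fun i j => ∃ (b : B.V) (α : G.type i ⟶ b), G.Edge α j

/-- The underlying unlayered graph is a tree: it is connected and has neither cycles nor
multiple edges. -/
def LayeredGraph.IsTree (G : B.LayeredGraph M) : Prop :=
  G.toSimpleGraph.IsTree ∧
    ∀ (i j : G.ι) (b b' : B.V) (α : G.type i ⟶ b) (β : G.type i ⟶ b'),
      G.Edge α j → G.Edge β j → (⟨b, α⟩ : Σ b : B.V, (G.type i ⟶ b)) = ⟨b', β⟩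

end Graph

end BoundQuiver

/-! ## Finitistic dimensions -/

section FinDim

variable (A : Type u) [Ring A]

/-- The module `M/JM`, where `J` is the Jacobson radical. -/
abbrev TopQuotient (M : Type u) [AddCommGroup M] [Module A M] : Type u :=
  M ⧸ (Ring.jacobson A • (⊤ : Submodule A M))

/-- The multiplicities of the simple summands of `M/JM` are at most `n`. -/
def TopMultiplicitiesLE (M : Type u) [AddCommGroup M] [Module A M] (n : ℕ) : Prop :=
  ∀ (S : Type u) [AddCommGroup S] [Module A S] [IsSimpleModule A S] (k : ℕ)
    (φ : (Fin k → S) →ₗ[A] TopQuotient A M), Function.Injective φ → k ≤ n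

/-- The `n`-generated finitistic dimension: the supremum of the finite projective dimensions
attained on left modules with top multiplicities at most `n`. (The zero module has projective
dimension `⊥`.) -/
def finDim (n : ℕ) : WithBot ℕ∞ :=
  sSup {p | p ≠ ⊤ ∧ ∃ M : ModuleCat.{u} A, TopMultiplicitiesLE A M n ∧
    CategoryTheory.projectiveDimension M = p}

/-- `M` can be generated by at most `n` elements. -/
def IsNGenerated (M : Type u) [AddCommGroup M] [Module A M] (n : ℕ) : Prop :=
  ∃ g : Fin n → M, Submodule.span A (Set.range g) = ⊤

/-- `A` is connected: it is not zero, and not a direct product of two nonzero rings, that is, it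
has no central idempotents other than `0` and `1`. -/
def IsConnectedRing : Prop :=
  Nontrivial A ∧ ∀ c : A, IsIdempotentElem c → (∀ x : A, c * x = x * c) → c = 0 ∨ c = 1

end FinDim

end Stacks

end

/-!
The function `f` is encoded in a `Profile`: the extreme values `bot` and `top` of `f` and, for
`bot < L ≤ top`, the least number `N L` with `L ≤ f (N L)`. The algebra has a vertex `z` with a loop
`lam` and vertices in the levels `0, …, top`: in level `L` the vertex `a L` and vertices `x L j`.
Apart from the loop, arrows lead to `z` or from level `L + 1` to level `L`. Paths of length three
vanish, and the paths of length two are governed by a table (`Profile.Rel`) in which each of the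
two factors is determined by the other one and by a basis element of degree two. For such algebras
everything can be computed from the coefficient functionals at vertices, at arrows, and in degree
two.

*Modules of large projective dimension.* In level `L` consider the direct sum of `Λ a L` and of `n`
modules `Λ x L (cl L i)`, `i < n`, where all indices `i < N L` share the vertex `x L 0`. The table
is made such that the maps `Profile.diff` from level `l` (with `n = N (l + 1)`) to level `l + 1`
form an exact sequence that starts with a monomorphism in level `0` (`Profile.ker_diff`,
`Profile.ker_diff_zero`). The cokernel in level `L`, with `n = N L`, therefore has projective
dimension `L`. It has one generator `η` of type `a L` and `N L` generators `y i` of type `x L 0`, so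
that `N L` elements generate it, and its relations are `rhoA η = 0` and `rho i η = sig j (y i)` with
`j = cl (L - 1) i`. These relations join the stars at the generators to a tree.

*The upper bound.* The loop annihilates the radical, so no syzygy of a module of finite projective
dimension has a top element of type `z` (`Cover.mem_rad_ker`). It follows that the elements of a
syzygy that are annihilated by an arrow `φ` to `z` are combinations of products with arrows `α`
such that `φ α = 0` (`Profile.exists_eq_sum_of_phi`), and that a relation between products with
arrows to `z` involves elements of the radical only (`mem_rad_of_sum_eq_zero`). Let `u` be an element
of type `a (l + 1)` of the first syzygy of `M` for which `rhoA u` is a combination of products with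
other arrows. If `u` has a nonzero coefficient `η` at `rhoA (l + 1)`, then the relations force
elements `Y i`, `i < N (l + 2)`, in the syzygy, whose coefficients at the arrows `rho (l + 1) i'` form
the scalar matrix `η`; and since a relation between products with the arrows `zeta` involves
only elements of the radical, the coefficients of the `Y i` at the arrows `sig` are linearly
independent vectors. So `M` has at least
`N (l + 2)` top elements of type `x (l + 2) 0` (`Profile.cf_rhoA_eq_zero`). Conversely, if `M` has at
most `n` top elements of each type, and `f n = F`, then the top elements of the second syzygy lie in
levels below `F - 1` (`Profile.mem_rad_ker_ker`). Since passing to a syzygy lowers the levels, the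
projective dimension of `M` is at most `F`.

*Stacks.* The relations that are not monomial involve a level above `bot` and, in addition, two
further levels or the vertex `z`. So the full subquiver on `z` and the levels up to `bot` gives a
monomial algebra, as do those on one or two consecutive levels, without `z`; adding two levels at a
time gives the stack.
-/

noncomputable section

namespace Stacks

/-! ### Algebras with vanishing radical cube, given by a table for the paths of length two -/

/-- A quiver, possibly infinite, together with a table for its paths of length two. The type `D`
is a basis of the space of residue classes of paths of length two, and `Rel β α q` says that the
path `βα` (first `α`, then `β`) has coefficient `1` at `q`; all other coefficients are `0`. Each of
the arrows `α`, `β` is determined by the other one and by `q`. -/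
structure QuadraticTable where
  /-- the vertices -/
  V : Type
  /-- the arrows -/
  Arr : Type
  /-- the basis of the part of degree two -/
  D : Type
  /-- the vertex in which an arrow starts -/
  src : Arr → V
  /-- the vertex in which an arrow ends -/
  tgt : Arr → V
  /-- the vertex in which the paths with a nonzero coefficient at a given basis element start -/
  start : D → V
  /-- the vertex in which the paths with a nonzero coefficient at a given basis element end -/
  finish : D → V
  /-- the pairs of arrows whose composition has coefficient `1` at a given basis element -/
  Rel : Arr → Arr → D → Prop
  rel_comp : ∀ {β α q}, Rel β α q → tgt α = src β
  rel_start : ∀ {β α q}, Rel β α q → src α = start q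
  rel_finish : ∀ {β α q}, Rel β α q → tgt β = finish q
  left_unique : ∀ {β α α' q}, Rel β α q → Rel β α' q → α = α'
  right_unique : ∀ {β β' α q}, Rel β α q → Rel β' α q → β = β'
  finite : ∀ a b, Finite {α // src α = a ∧ tgt α = b}

namespace QuadraticTable

variable (Q : QuadraticTable) (S : Finset Q.V)

/-- The vertices of the full subquiver on a finite set of vertices. -/
@[ext]
structure Vert where
  /-- the underlying vertex -/
  val : Q.V
  mem : val ∈ S

instance : Fintype (Q.Vert S) :=
  Fintype.ofEquiv {v // v ∈ S} ⟨fun v => ⟨v.1, v.2⟩, fun v => ⟨v.1, v.2⟩,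
    fun _ => rfl, fun _ => rfl⟩

instance : Quiver.{0} (Q.Vert S) where
  Hom a b := {α : Q.Arr // Q.src α = a.1 ∧ Q.tgt α = b.1}

variable {Q S}

/-- The list of the arrows of a path, the last arrow of the path first. -/
def word {a : Q.Vert S} : ∀ {b : Q.Vert S}, Quiver.Path a b → List Q.Arr
  | _, .nil => []
  | _, .cons p α => α.1 :: word p

@[simp] lemma word_nil (a : Q.Vert S) : word (Quiver.Path.nil : Quiver.Path a a) = [] := rfl

@[simp] lemma word_cons {a b c : Q.Vert S} (p : Quiver.Path a b) (α : b ⟶ c) :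
    word (p.cons α) = α.1 :: word p := rfl

@[simp] lemma word_comp {a b : Q.Vert S} (p : Quiver.Path a b) {c : Q.Vert S}
    (q : Quiver.Path b c) : word (p.comp q) = word q ++ word p := by
  induction q with
  | nil => rfl
  | cons q α ih => simp [ih]

lemma length_word {a b : Q.Vert S} (p : Quiver.Path a b) : (word p).length = p.length := by
  induction p with
  | nil => rfl
  | cons q α ih => simp [ih]

lemma eq_of_word_nil {a b : Q.Vert S} (p : Quiver.Path a b) (h : word p = []) : a.1 = b.1 := by
  cases p with
  | nil => rfl
  | cons q α => simp at h

lemma tgt_of_word_cons {a b : Q.Vert S} (p : Quiver.Path a b) {α : Q.Arr} {l : List Q.Arr}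
    (h : word p = α :: l) : Q.tgt α = b.1 := by
  cases p with
  | nil => simp at h
  | cons q β => simp only [word_cons, List.cons.injEq] at h; rw [← h.1]; exact β.2.2

lemma src_of_word_append {a b : Q.Vert S} (p : Quiver.Path a b) {α : Q.Arr} {l : List Q.Arr}
    (h : word p = l ++ [α]) : Q.src α = a.1 := by
  induction p generalizing l with
  | nil => simp at h
  | cons q β ih =>
    cases l with
    | nil =>
      simp only [word_cons, List.nil_append, List.cons.injEq] at h
      rw [← h.1, eq_of_word_nil q h.2]; exact β.2.1
    | cons γ l => simp only [word_cons, List.cons_append, List.cons.injEq] at h; exact ih h.2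

section Functionals

variable (K : Type u) [Field K]

open Classical in
/-- The coefficient at the trivial path at `v`. -/
def epsPath (v : Q.V) (p : Paths (Q.Vert S)) : K := if word p.2.2 = [] ∧ p.1.1 = v then 1 else 0

open Classical in
/-- The coefficient at the arrow `α`. -/
def arrPath (α : Q.Arr) (p : Paths (Q.Vert S)) : K := if word p.2.2 = [α] then 1 else 0

open Classical in
/-- The coefficient at the basis element `q` in degree two. -/
def degPath (q : Q.D) (p : Paths (Q.Vert S)) : K :=
  if ∃ β α, word p.2.2 = [β, α] ∧ Q.Rel β α q then 1 else 0

/-- The coefficient functional at the trivial path at `v`, on the path algebra. -/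
def epsLin (v : Q.V) : PathAlgebra K (Q.Vert S) →ₗ[K] K := PathAlgebra.extend K (epsPath K v)

/-- The coefficient functional at the arrow `α`, on the path algebra. -/
def arrLin (α : Q.Arr) : PathAlgebra K (Q.Vert S) →ₗ[K] K := PathAlgebra.extend K (arrPath K α)

/-- The coefficient functional at the basis element `q` in degree two, on the path algebra. -/
def degLin (q : Q.D) : PathAlgebra K (Q.Vert S) →ₗ[K] K := PathAlgebra.extend K (degPath K q)

variable {K}

open PathAlgebra

/-- Two linear maps on the path algebra that agree on paths are equal. -/
lemma lin_ext {N : Type*} [AddCommGroup N] [Module K N] {f g : PathAlgebra K (Q.Vert S) →ₗ[K] N}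
    (h : ∀ p, f (ofPath K p) = g (ofPath K p)) : f = g := by
  ext x
  refine PathAlgebra.ind (C := fun x => f x = g x) x (by simp) (fun x y hx hy => by simp [hx, hy])
    (fun k p => by simp [h])

@[simp] lemma epsLin_ofPath (v : Q.V) (p : Paths (Q.Vert S)) :
    epsLin K v (ofPath K p) = epsPath K v p := extend_ofPath _ _ _
@[simp] lemma arrLin_ofPath (v : Q.Arr) (p : Paths (Q.Vert S)) :
    arrLin K v (ofPath K p) = arrPath K v p := extend_ofPath _ _ _
@[simp] lemma degLin_ofPath (v : Q.D) (p : Paths (Q.Vert S)) :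
    degLin K v (ofPath K p) = degPath K v p := extend_ofPath _ _ _

/-- Left multiplication on the path algebra. -/
abbrev lmul (x : PathAlgebra K (Q.Vert S)) :
    PathAlgebra K (Q.Vert S) →ₗ[K] PathAlgebra K (Q.Vert S) :=
  LinearMap.mulLeft K x

/-- Right multiplication on the path algebra. -/
abbrev rmul (x : PathAlgebra K (Q.Vert S)) :
    PathAlgebra K (Q.Vert S) →ₗ[K] PathAlgebra K (Q.Vert S) :=
  LinearMap.mulRight K x

section Mul

variable {a b : Q.Vert S} (α : a ⟶ b) (x : PathAlgebra K (Q.Vert S))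

open Classical in
lemma epsLin_vertex_mul (v : Q.V) (w : Q.Vert S) :
    epsLin K v (vertex K w * x) = if w.1 = v then epsLin K v x else 0 := by
  have h : epsLin K v ∘ₗ lmul (vertex K w) = (if w.1 = v then (1 : K) else 0) • epsLin K v := by
    refine lin_ext fun ⟨c, d, p⟩ => ?_
    by_cases hd : d = w
    · subst hd
      simp only [LinearMap.comp_apply, LinearMap.mulLeft_apply, vertex, ofPath_mul_of_eq,
        LinearMap.smul_apply, epsLin_ofPath, epsPath, word_comp, word_nil, List.nil_append,
        smul_eq_mul]
      by_cases hp : word p = []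
      · rw [eq_of_word_nil p hp]
        by_cases hv : d.1 = v <;> simp [hv]
      · simp [hp]
    · rw [LinearMap.comp_apply, LinearMap.mulLeft_apply, vertex, ofPath_mul_of_ne (by exact hd)]
      simp only [map_zero, LinearMap.smul_apply, epsLin_ofPath, epsPath, smul_eq_mul]
      by_cases hp : word p = []
      · rw [eq_of_word_nil p hp]
        have hd' : d.1 ≠ w.1 := fun h => hd (Vert.ext h)
        by_cases hv : w.1 = v
        · subst hv; simp [hd']
        · simp [hv]
      · simp [hp]
  have h2 := LinearMap.congr_fun h x
  simp only [LinearMap.comp_apply, LinearMap.mulLeft_apply, LinearMap.smul_apply, smul_eq_mul] at h2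
  rw [h2]; split_ifs <;> simp

open Classical in
lemma epsLin_mul_vertex (v : Q.V) (w : Q.Vert S) :
    epsLin K v (x * vertex K w) = if w.1 = v then epsLin K v x else 0 := by
  have h : epsLin K v ∘ₗ rmul (vertex K w) = (if w.1 = v then (1 : K) else 0) • epsLin K v := by
    refine lin_ext fun ⟨c, d, p⟩ => ?_
    by_cases hd : w = c
    · subst hd
      simp only [LinearMap.comp_apply, LinearMap.mulRight_apply, vertex, ofPath_mul_of_eq,
        LinearMap.smul_apply, epsLin_ofPath, epsPath, word_comp, word_nil, List.append_nil,
        smul_eq_mul]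
      by_cases hp : word p = [] <;> simp [hp]
    · rw [LinearMap.comp_apply, LinearMap.mulRight_apply, vertex, ofPath_mul_of_ne (by exact hd)]
      simp only [map_zero, LinearMap.smul_apply, epsLin_ofPath, epsPath, smul_eq_mul]
      have hd' : w.1 ≠ c.1 := fun h => hd (Vert.ext h)
      by_cases hv : w.1 = v
      · subst hv; simp [hd'.symm]
      · simp [hv]
  have h2 := LinearMap.congr_fun h x
  simp only [LinearMap.comp_apply, LinearMap.mulRight_apply, LinearMap.smul_apply,
    smul_eq_mul] at h2
  rw [h2]; split_ifs <;> simp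

open Classical in
lemma arrLin_vertex_mul (β : Q.Arr) (w : Q.Vert S) :
    arrLin K β (vertex K w * x) = if w.1 = Q.tgt β then arrLin K β x else 0 := by
  have h : arrLin K β ∘ₗ lmul (vertex K w) =
      (if w.1 = Q.tgt β then (1 : K) else 0) • arrLin K β := by
    refine lin_ext fun ⟨c, d, p⟩ => ?_
    simp only [LinearMap.comp_apply, LinearMap.mulLeft_apply, vertex, LinearMap.smul_apply,
      arrLin_ofPath, arrPath, smul_eq_mul]
    by_cases hp : word p = [β]
    · have ht := tgt_of_word_cons p hp
      by_cases hd : d = w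
      · subst hd; rw [ofPath_mul_of_eq]; simp [arrPath, ht, hp]
      · rw [ofPath_mul_of_ne (by exact hd)]
        have hd' : w.1 ≠ d.1 := fun h => hd (Vert.ext h.symm)
        simp [ht, hd']
    · by_cases hd : d = w
      · subst hd; rw [ofPath_mul_of_eq]; simp [arrPath, hp]
      · rw [ofPath_mul_of_ne (by exact hd)]; simp [hp]
  have h2 := LinearMap.congr_fun h x
  simp only [LinearMap.comp_apply, LinearMap.mulLeft_apply, LinearMap.smul_apply, smul_eq_mul] at h2
  rw [h2]; split_ifs <;> simp

open Classical in
lemma arrLin_mul_vertex (β : Q.Arr) (w : Q.Vert S) :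
    arrLin K β (x * vertex K w) = if w.1 = Q.src β then arrLin K β x else 0 := by
  have h : arrLin K β ∘ₗ rmul (vertex K w) =
      (if w.1 = Q.src β then (1 : K) else 0) • arrLin K β := by
    refine lin_ext fun ⟨c, d, p⟩ => ?_
    simp only [LinearMap.comp_apply, LinearMap.mulRight_apply, vertex, LinearMap.smul_apply,
      arrLin_ofPath, arrPath, smul_eq_mul]
    by_cases hp : word p = [β]
    · have ht := src_of_word_append (l := []) p hp
      by_cases hd : w = c
      · subst hd; rw [ofPath_mul_of_eq]; simp [arrPath, ht, hp]
      · rw [ofPath_mul_of_ne (by exact hd)]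
        have hd' : w.1 ≠ c.1 := fun h => hd (Vert.ext h)
        simp [ht, hd']
    · by_cases hd : w = c
      · subst hd; rw [ofPath_mul_of_eq]; simp [arrPath, hp]
      · rw [ofPath_mul_of_ne (by exact hd)]; simp [hp]
  have h2 := LinearMap.congr_fun h x
  simp only [LinearMap.comp_apply, LinearMap.mulRight_apply, LinearMap.smul_apply,
    smul_eq_mul] at h2
  rw [h2]; split_ifs <;> simp

open Classical in
lemma degLin_vertex_mul (q : Q.D) (w : Q.Vert S) :
    degLin K q (vertex K w * x) = if w.1 = Q.finish q then degLin K q x else 0 := by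
  have h : degLin K q ∘ₗ lmul (vertex K w) =
      (if w.1 = Q.finish q then (1 : K) else 0) • degLin K q := by
    refine lin_ext fun ⟨c, d, p⟩ => ?_
    simp only [LinearMap.comp_apply, LinearMap.mulLeft_apply, vertex, LinearMap.smul_apply,
      degLin_ofPath, degPath, smul_eq_mul]
    by_cases hp : ∃ β α, word p = [β, α] ∧ Q.Rel β α q
    · obtain ⟨β, α, hp, hr⟩ := hp
      have ht := tgt_of_word_cons p hp
      rw [Q.rel_finish hr] at ht
      have hp' : ∃ β α, word p = [β, α] ∧ Q.Rel β α q := ⟨β, α, hp, hr⟩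
      by_cases hd : d = w
      · subst hd; rw [ofPath_mul_of_eq, degLin_ofPath, degPath]
        simp only [word_comp, word_nil, List.nil_append]; rw [if_pos hp', ht]; simp
      · rw [ofPath_mul_of_ne (by exact hd)]
        have hd' : w.1 ≠ d.1 := fun h => hd (Vert.ext h.symm)
        simp [ht, hd']
    · by_cases hd : d = w
      · subst hd; rw [ofPath_mul_of_eq, degLin_ofPath, degPath]
        simp only [word_comp, word_nil, List.nil_append]; rw [if_neg hp]; simp
      · rw [ofPath_mul_of_ne (by exact hd), if_neg hp]; simp
  have h2 := LinearMap.congr_fun h x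
  simp only [LinearMap.comp_apply, LinearMap.mulLeft_apply, LinearMap.smul_apply, smul_eq_mul] at h2
  rw [h2]; split_ifs <;> simp

open Classical in
lemma degLin_mul_vertex (q : Q.D) (w : Q.Vert S) :
    degLin K q (x * vertex K w) = if w.1 = Q.start q then degLin K q x else 0 := by
  have h : degLin K q ∘ₗ rmul (vertex K w) =
      (if w.1 = Q.start q then (1 : K) else 0) • degLin K q := by
    refine lin_ext fun ⟨c, d, p⟩ => ?_
    simp only [LinearMap.comp_apply, LinearMap.mulRight_apply, vertex, LinearMap.smul_apply,
      degLin_ofPath, degPath, smul_eq_mul]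
    by_cases hp : ∃ β α, word p = [β, α] ∧ Q.Rel β α q
    · obtain ⟨β, α, hp, hr⟩ := hp
      have ht := src_of_word_append (l := [β]) p hp
      rw [Q.rel_start hr] at ht
      have hp' : ∃ β α, word p = [β, α] ∧ Q.Rel β α q := ⟨β, α, hp, hr⟩
      by_cases hd : w = c
      · subst hd; rw [ofPath_mul_of_eq, degLin_ofPath, degPath]
        simp only [word_comp, word_nil, List.append_nil]; rw [if_pos hp', ht]; simp
      · rw [ofPath_mul_of_ne (by exact hd)]
        have hd' : w.1 ≠ c.1 := fun h => hd (Vert.ext h)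
        simp [ht, hd']
    · by_cases hd : w = c
      · subst hd; rw [ofPath_mul_of_eq, degLin_ofPath, degPath]
        simp only [word_comp, word_nil, List.append_nil]; rw [if_neg hp]; simp
      · rw [ofPath_mul_of_ne (by exact hd), if_neg hp]; simp
  have h2 := LinearMap.congr_fun h x
  simp only [LinearMap.comp_apply, LinearMap.mulRight_apply, LinearMap.smul_apply,
    smul_eq_mul] at h2
  rw [h2]; split_ifs <;> simp

lemma word_toPath : word (Quiver.Hom.toPath α) = [α.1] := rfl

lemma epsLin_arrow_mul (v : Q.V) : epsLin K v (arrow K α * x) = 0 := by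
  have h : epsLin K v ∘ₗ lmul (arrow K α) = 0 := by
    refine lin_ext fun ⟨c, d, p⟩ => ?_
    rw [LinearMap.comp_apply, LinearMap.mulLeft_apply, arrow]
    by_cases hd : d = a
    · subst hd; rw [ofPath_mul_of_eq]; simp [epsPath]
    · rw [ofPath_mul_of_ne (by exact hd)]; simp
  exact LinearMap.congr_fun h x

lemma epsLin_mul_arrow (v : Q.V) : epsLin K v (x * arrow K α) = 0 := by
  have h : epsLin K v ∘ₗ rmul (arrow K α) = 0 := by
    refine lin_ext fun ⟨c, d, p⟩ => ?_
    rw [LinearMap.comp_apply, LinearMap.mulRight_apply, arrow]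
    by_cases hd : b = c
    · subst hd; rw [ofPath_mul_of_eq]; simp [epsPath, word_toPath]
    · rw [ofPath_mul_of_ne (by exact hd)]; simp
  exact LinearMap.congr_fun h x

open Classical in
lemma arrLin_arrow_mul (β : Q.Arr) :
    arrLin K β (arrow K α * x) = if β = α.1 then epsLin K a.1 x else 0 := by
  have h : arrLin K β ∘ₗ lmul (arrow K α) = (if β = α.1 then (1 : K) else 0) • epsLin K a.1 := by
    refine lin_ext fun ⟨c, d, p⟩ => ?_
    rw [LinearMap.comp_apply, LinearMap.mulLeft_apply, arrow, LinearMap.smul_apply, epsLin_ofPath,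
      epsPath]
    by_cases hd : d = a
    · subst hd; rw [ofPath_mul_of_eq, arrLin_ofPath, arrPath]
      simp only [word_comp, word_toPath, List.singleton_append, List.cons.injEq]
      by_cases hp : word p = []
      · have := eq_of_word_nil p hp
        simp [hp, this, eq_comm]
      · simp [hp]
    · rw [ofPath_mul_of_ne (by exact hd)]
      have : ¬ (word p = [] ∧ c.1 = a.1) := fun h =>
          hd (Vert.ext ((eq_of_word_nil p h.1).symm.trans h.2))
      simp [this]
  have h2 := LinearMap.congr_fun h x
  simp only [LinearMap.comp_apply, LinearMap.mulLeft_apply, LinearMap.smul_apply, smul_eq_mul] at h2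
  rw [h2]; split_ifs <;> simp

open Classical in
lemma arrLin_mul_arrow (β : Q.Arr) :
    arrLin K β (x * arrow K α) = if β = α.1 then epsLin K b.1 x else 0 := by
  have h : arrLin K β ∘ₗ rmul (arrow K α) = (if β = α.1 then (1 : K) else 0) • epsLin K b.1 := by
    refine lin_ext fun ⟨c, d, p⟩ => ?_
    rw [LinearMap.comp_apply, LinearMap.mulRight_apply, arrow, LinearMap.smul_apply, epsLin_ofPath,
      epsPath]
    by_cases hd : b = c
    · subst hd; rw [ofPath_mul_of_eq, arrLin_ofPath, arrPath]
      simp only [word_comp, word_toPath]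
      by_cases hp : word p = []
      · simp [hp, eq_comm]
      · have : word p ++ [α.1] ≠ [β] := by
          intro h
          have := congrArg List.length h
          simp at this
          exact hp this
        simp [hp, this]
    · rw [ofPath_mul_of_ne (by exact hd)]
      have : ¬ (word p = [] ∧ c.1 = b.1) := fun h => hd (Vert.ext (h.2).symm)
      simp [this]
  have h2 := LinearMap.congr_fun h x
  simp only [LinearMap.comp_apply, LinearMap.mulRight_apply, LinearMap.smul_apply,
    smul_eq_mul] at h2
  rw [h2]; split_ifs <;> simp

open Classical in
lemma degLin_arrow_mul {q : Q.D} {β : Q.Arr} (hr : Q.Rel α.1 β q) :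
    degLin K q (arrow K α * x) = arrLin K β x := by
  have h : degLin K q ∘ₗ lmul (arrow K α) = arrLin K β := by
    refine lin_ext fun ⟨c, d, p⟩ => ?_
    rw [LinearMap.comp_apply, LinearMap.mulLeft_apply, arrow, arrLin_ofPath, arrPath]
    by_cases hd : d = a
    · subst hd; rw [ofPath_mul_of_eq, degLin_ofPath, degPath]
      change (if ∃ γ δ, word (p.comp α.toPath) = [γ, δ] ∧ Q.Rel γ δ q then (1 : K) else 0) = _
      rw [word_comp]
      simp only [word_toPath, List.singleton_append, List.cons.injEq]
      congr 1
      refine propext ⟨?_, fun h => ⟨α.1, β, ⟨rfl, h⟩, hr⟩⟩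
      rintro ⟨γ, δ, ⟨rfl, h⟩, hr'⟩
      rw [h, Q.left_unique hr hr']
    · rw [ofPath_mul_of_ne (by exact hd), map_zero, if_neg]
      intro h
      have h1 := tgt_of_word_cons p h
      rw [Q.rel_comp hr, α.2.1] at h1
      exact hd (Vert.ext h1.symm)
  exact LinearMap.congr_fun h x

open Classical in
lemma degLin_arrow_mul_of_not {q : Q.D} (hr : ∀ β, ¬ Q.Rel α.1 β q) :
    degLin K q (arrow K α * x) = 0 := by
  have h : degLin K q ∘ₗ lmul (arrow K α) = 0 := by
    refine lin_ext fun ⟨c, d, p⟩ => ?_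
    rw [LinearMap.comp_apply, LinearMap.mulLeft_apply, arrow]
    by_cases hd : d = a
    · subst hd; rw [ofPath_mul_of_eq, degLin_ofPath, degPath]
      change (if ∃ γ δ, word (p.comp α.toPath) = [γ, δ] ∧ Q.Rel γ δ q then (1 : K) else 0) = _
      rw [word_comp]
      simp only [word_toPath, List.singleton_append, List.cons.injEq]
      rw [if_neg]; · rfl
      rintro ⟨γ, δ, ⟨rfl, h⟩, hr'⟩
      exact hr _ hr'
    · rw [ofPath_mul_of_ne (by exact hd), map_zero]; rfl
  exact LinearMap.congr_fun h x

open Classical in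
lemma degLin_mul_arrow {q : Q.D} {β : Q.Arr} (hr : Q.Rel β α.1 q) :
    degLin K q (x * arrow K α) = arrLin K β x := by
  have h : degLin K q ∘ₗ rmul (arrow K α) = arrLin K β := by
    refine lin_ext fun ⟨c, d, p⟩ => ?_
    rw [LinearMap.comp_apply, LinearMap.mulRight_apply, arrow, arrLin_ofPath, arrPath]
    by_cases hd : b = c
    · subst hd; rw [ofPath_mul_of_eq, degLin_ofPath, degPath]
      change (if ∃ γ δ, word (Quiver.Path.comp α.toPath p) = [γ, δ] ∧ Q.Rel γ δ q
          then (1 : K) else 0) = _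
      rw [word_comp, word_toPath]
      congr 1
      refine propext ⟨?_, fun h => ⟨β, α.1, by rw [h]; rfl, hr⟩⟩
      rintro ⟨γ, δ, h, hr'⟩
      have h' : word p ++ [α.1] = [γ] ++ [δ] := h
      obtain ⟨h1, h2⟩ := List.append_inj' h' rfl
      simp only [List.cons.injEq, and_true] at h2
      subst h2
      rw [h1, Q.right_unique hr hr']
    · rw [ofPath_mul_of_ne (by exact hd), map_zero, if_neg]
      intro h
      have h1 := src_of_word_append (l := []) p h
      rw [← Q.rel_comp hr, α.2.2] at h1
      exact hd (Vert.ext h1)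
  exact LinearMap.congr_fun h x

open Classical in
lemma degLin_mul_arrow_of_not {q : Q.D} (hr : ∀ β, ¬ Q.Rel β α.1 q) :
    degLin K q (x * arrow K α) = 0 := by
  have h : degLin K q ∘ₗ rmul (arrow K α) = 0 := by
    refine lin_ext fun ⟨c, d, p⟩ => ?_
    rw [LinearMap.comp_apply, LinearMap.mulRight_apply, arrow]
    by_cases hd : b = c
    · subst hd; rw [ofPath_mul_of_eq, degLin_ofPath, degPath]
      change (if ∃ γ δ, word (Quiver.Path.comp α.toPath p) = [γ, δ] ∧ Q.Rel γ δ q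
          then (1 : K) else 0) = _
      rw [word_comp, word_toPath]
      rw [if_neg]; · rfl
      rintro ⟨γ, δ, h, hr'⟩
      have h' : word p ++ [α.1] = [γ] ++ [δ] := h
      obtain ⟨h1, h2⟩ := List.append_inj' h' rfl
      simp only [List.cons.injEq, and_true] at h2
      subst h2
      exact hr _ hr'
    · rw [ofPath_mul_of_ne (by exact hd), map_zero]; rfl
  exact LinearMap.congr_fun h x

end Mul

/-- All coefficients of `x` vanish. -/
def Null (x : PathAlgebra K (Q.Vert S)) : Prop :=
  (∀ v, epsLin K v x = 0) ∧ (∀ α, arrLin K α x = 0) ∧ ∀ q, degLin K q x = 0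

lemma Null.vertex_mul {x : PathAlgebra K (Q.Vert S)} (h : Null x) (w : Q.Vert S) :
    Null (vertex K w * x) := by
  refine ⟨fun v => ?_, fun α => ?_, fun q => ?_⟩
  · rw [epsLin_vertex_mul, h.1]; simp
  · rw [arrLin_vertex_mul, h.2.1]; simp
  · rw [degLin_vertex_mul, h.2.2]; simp

lemma Null.mul_vertex {x : PathAlgebra K (Q.Vert S)} (h : Null x) (w : Q.Vert S) :
    Null (x * vertex K w) := by
  refine ⟨fun v => ?_, fun α => ?_, fun q => ?_⟩
  · rw [epsLin_mul_vertex, h.1]; simp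
  · rw [arrLin_mul_vertex, h.2.1]; simp
  · rw [degLin_mul_vertex, h.2.2]; simp

lemma Null.arrow_mul {x : PathAlgebra K (Q.Vert S)} (h : Null x) {a b : Q.Vert S} (γ : a ⟶ b) :
    Null (arrow K γ * x) := by
  refine ⟨fun v => epsLin_arrow_mul _ _ _, fun α => ?_, fun q => ?_⟩
  · rw [arrLin_arrow_mul, h.1]; simp
  · by_cases hr : ∃ β, Q.Rel γ.1 β q
    · obtain ⟨β, hr⟩ := hr
      rw [degLin_arrow_mul _ _ hr, h.2.1]
    · exact degLin_arrow_mul_of_not _ _ (by simpa using hr)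

lemma Null.mul_arrow {x : PathAlgebra K (Q.Vert S)} (h : Null x) {a b : Q.Vert S} (γ : a ⟶ b) :
    Null (x * arrow K γ) := by
  refine ⟨fun v => epsLin_mul_arrow _ _ _, fun α => ?_, fun q => ?_⟩
  · rw [arrLin_mul_arrow, h.1]; simp
  · by_cases hr : ∃ β, Q.Rel β γ.1 q
    · obtain ⟨β, hr⟩ := hr
      rw [degLin_mul_arrow _ _ hr, h.2.1]
    · exact degLin_mul_arrow_of_not _ _ (by simpa using hr)

lemma Null.add {x y : PathAlgebra K (Q.Vert S)} (hx : Null x) (hy : Null y) : Null (x + y) := by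
  refine ⟨fun v => ?_, fun α => ?_, fun q => ?_⟩
  · rw [map_add, hx.1, hy.1, add_zero]
  · rw [map_add, hx.2.1, hy.2.1, add_zero]
  · rw [map_add, hx.2.2, hy.2.2, add_zero]

lemma Null.smul {x : PathAlgebra K (Q.Vert S)} (hx : Null x) (k : K) : Null (k • x) := by
  refine ⟨fun v => ?_, fun α => ?_, fun q => ?_⟩
  · rw [map_smul, hx.1, smul_zero]
  · rw [map_smul, hx.2.1, smul_zero]
  · rw [map_smul, hx.2.2, smul_zero]

lemma Null.zero : Null (0 : PathAlgebra K (Q.Vert S)) :=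
  ⟨fun _ => map_zero _, fun _ => map_zero _, fun _ => map_zero _⟩

lemma ofPath_cons {a b c : Q.Vert S} (p : Quiver.Path a b) (γ : b ⟶ c) :
    ofPath K (⟨a, c, p.cons γ⟩ : Paths (Q.Vert S)) = arrow K γ * ofPath K ⟨a, b, p⟩ := by
  rw [arrow, ofPath_mul_of_eq]; rfl

lemma Null.mul_left {x : PathAlgebra K (Q.Vert S)} (h : Null x) (y : PathAlgebra K (Q.Vert S)) :
    Null (y * x) := by
  refine PathAlgebra.ind (C := fun y => Null (y * x)) y (by rw [zero_mul]; exact Null.zero)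
    (fun y z hy hz => by rw [add_mul]; exact hy.add hz) ?_
  rintro k ⟨a, b, p⟩
  rw [smul_mul_assoc]
  refine Null.smul ?_ k
  induction p with
  | nil => exact h.vertex_mul a
  | cons p γ ih => rw [ofPath_cons, mul_assoc]; exact ih.arrow_mul γ

lemma Null.mul_right {x : PathAlgebra K (Q.Vert S)} (h : Null x) (y : PathAlgebra K (Q.Vert S)) :
    Null (x * y) := by
  refine PathAlgebra.ind (C := fun y => Null (x * y)) y (by rw [mul_zero]; exact Null.zero)
    (fun y z hy hz => by rw [mul_add]; exact hy.add hz) ?_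
  rintro k ⟨a, b, p⟩
  rw [mul_smul_comm]
  refine Null.smul ?_ k
  induction p generalizing x with
  | nil => exact h.mul_vertex a
  | cons p γ ih => rw [ofPath_cons, ← mul_assoc]; exact ih (h.mul_arrow γ)

variable (K Q S) in
/-- The ideal of all elements without nonzero coefficients. -/
def ideal : Ideal (PathAlgebra K (Q.Vert S)) where
  carrier := {x | Null x}
  add_mem' hx hy := hx.add hy
  zero_mem' := Null.zero
  smul_mem' y _ hx := hx.mul_left y

instance : (ideal Q S K).IsTwoSided := ⟨fun y hx => Null.mul_right hx y⟩

lemma ofPath_mem_ideal (p : Paths (Q.Vert S)) (hp : 3 ≤ p.length) : ofPath K p ∈ ideal Q S K := by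
  rw [Paths.length, ← length_word] at hp
  refine ⟨fun v => ?_, fun α => ?_, fun q => ?_⟩
  · rw [epsLin_ofPath, epsPath, if_neg]; rintro ⟨h, -⟩; simp [h] at hp
  · rw [arrLin_ofPath, arrPath, if_neg]; intro h; simp [h] at hp
  · rw [degLin_ofPath, degPath, if_neg]; rintro ⟨β, α, h, -⟩; simp [h] at hp

lemma word_injective : ∀ {a b c : Q.Vert S} (p : Quiver.Path a b) (q : Quiver.Path a c),
    word p = word q → (⟨b, p⟩ : Σ b, Quiver.Path a b) = ⟨c, q⟩ := by
  intro a b c p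
  induction p generalizing c with
  | nil =>
    intro q h
    cases q with
    | nil => rfl
    | cons q β => simp at h
  | cons p α ih =>
    intro q h
    cases q with
    | nil => simp at h
    | cons q β =>
      simp only [word_cons, List.cons.injEq] at h
      have h1 := ih q h.2
      cases h1
      have h2 := α.2.2
      rw [h.1, β.2.2] at h2
      have h3 := Vert.ext h2
      subst h3
      have h4 : α = β := Subtype.ext h.1
      rw [h4]

lemma extend_apply (g : Paths (Q.Vert S) → K) (x : PathAlgebra K (Q.Vert S)) :
    PathAlgebra.extend K g x = Finsupp.sum (show Paths (Q.Vert S) →₀ K from x) fun p k => k * g p :=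
  Finsupp.linearCombination_apply _ _

lemma coeff_eq_zero_of_length {x : PathAlgebra K (Q.Vert S)} (hx : Null x)
    (p : Paths (Q.Vert S)) (hp : p.length < 2) : (show Paths (Q.Vert S) →₀ K from x) p = 0 := by
  classical
  have key : ∀ g : Paths (Q.Vert S) → K, (∀ r, g r = if r = p then 1 else 0) →
      PathAlgebra.extend K g x = (show Paths (Q.Vert S) →₀ K from x) p := by
    intro g hg
    rw [extend_apply]
    have : (fun (r : Paths (Q.Vert S)) (k : K) => k * g r) = fun r k => if r = p then k else 0 := by
      funext r k; rw [hg]; split_ifs <;> simp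
    rw [this, Finsupp.sum_ite_eq']
    split_ifs with h
    · rfl
    · exact (Finsupp.notMem_support_iff.mp h).symm
  obtain ⟨a, b, p⟩ := p
  cases p with
  | nil =>
    rw [← key (epsPath K a.1)]
    · exact hx.1 _
    rintro ⟨c, d, r⟩
    simp only [epsPath]
    congr 1
    refine propext ⟨?_, ?_⟩
    · rintro ⟨h1, h2⟩
      have h3 : c = a := Vert.ext h2
      subst h3
      have := word_injective r (Quiver.Path.nil : Quiver.Path c c) h1
      cases this; rfl
    · intro h; cases h; exact ⟨rfl, rfl⟩
  | cons p α =>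
    cases p with
    | cons p β =>
      simp only [Paths.length, Quiver.Path.length_cons] at hp
      omega
    | nil =>
      rw [← key (arrPath K α.1)]
      · exact hx.2.1 _
      rintro ⟨c, d, r⟩
      simp only [arrPath]
      congr 1
      refine propext ⟨?_, ?_⟩
      · intro h1
        have h2 := src_of_word_append (l := []) r h1
        rw [α.2.1] at h2
        have h3 := Vert.ext h2
        subst h3
        have := word_injective r ((Quiver.Path.nil : Quiver.Path a a).cons α) h1
        cases this; rfl
      · intro h; cases h; rfl

end Functionals

variable (Q S)

/-- The bound quiver on the full subquiver of a finite set of vertices, in which all paths of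
length three vanish and paths of length two multiply according to the table. -/
abbrev bound (K : Type u) [Field K] : BoundQuiver K where
  V := Q.Vert S
  finiteHom a b := Q.finite a.1 b.1
  I := ideal Q S K
  isTwoSided := inferInstance
  two_le_length x hx p hp := by
    by_contra h
    exact hp (coeff_eq_zero_of_length hx p (by omega))
  exists_length_mem := ⟨3, fun p hp => ofPath_mem_ideal p hp⟩

end QuadraticTable

namespace QuadraticTable

/-! ### Coordinates on the algebra -/

variable (Q : QuadraticTable) (S : Finset Q.V) (K : Type u) [Field K]

/-- The algebra of the bound quiver `Q.bound S K`. -/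
def Alg : Type u := (Q.bound S K).Alg

instance : Ring (Q.Alg S K) := inferInstanceAs (Ring (Q.bound S K).Alg)
instance : Algebra K (Q.Alg S K) := inferInstanceAs (Algebra K (Q.bound S K).Alg)

/-- The set of arrows of the full subquiver on `S`. -/
def arrowSet : Set Q.Arr := {α | Q.src α ∈ S ∧ Q.tgt α ∈ S}

lemma arrowSet_finite : (Q.arrowSet S).Finite := by
  have h : Q.arrowSet S ⊆ ⋃ a ∈ S, ⋃ b ∈ S, {α | Q.src α = a ∧ Q.tgt α = b} := by
    rintro α ⟨h1, h2⟩
    simp only [Set.mem_iUnion, Set.mem_ofPred_eq]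
    exact ⟨_, h1, _, h2, rfl, rfl⟩
  refine Set.Finite.subset ?_ h
  exact S.finite_toSet.biUnion fun a _ => S.finite_toSet.biUnion fun b _ => Q.finite a b

/-- The finite set of arrows of the full subquiver on `S`. -/
def arrows : Finset Q.Arr := (Q.arrowSet_finite S).toFinset

variable {Q S}

lemma mem_arrows {α : Q.Arr} : α ∈ Q.arrows S ↔ Q.src α ∈ S ∧ Q.tgt α ∈ S := by
  simp [arrows, arrowSet]

/-- An arrow with both ends in `S`, as an arrow of the full subquiver. -/
def arrowOf {α : Q.Arr} (h : α ∈ Q.arrows S) :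
    (⟨Q.src α, (mem_arrows.mp h).1⟩ : Q.Vert S) ⟶ ⟨Q.tgt α, (mem_arrows.mp h).2⟩ := ⟨α, rfl, rfl⟩

variable (S)

open Classical in
/-- The idempotent at the vertex `v`, which is `0` if `v` is not in `S`. -/
def ev (v : Q.V) : Q.Alg S K := if h : v ∈ S then (Q.bound S K).e ⟨v, h⟩ else 0

open Classical in
/-- The residue class of an arrow, which is `0` for an arrow outside the subquiver on `S`. -/
def ar (α : Q.Arr) : Q.Alg S K := if h : α ∈ Q.arrows S then (Q.bound S K).arr (arrowOf h) else 0

variable {S}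

lemma ev_of_mem {v : Q.V} (h : v ∈ S) : ev S K v = (Q.bound S K).e ⟨v, h⟩ := dif_pos h
lemma ev_of_notMem {v : Q.V} (h : v ∉ S) : ev S K v = 0 := dif_neg h
lemma ar_of_mem {α : Q.Arr} (h : α ∈ Q.arrows S) : ar S K α = (Q.bound S K).arr (arrowOf h) :=
  dif_pos h
lemma ar_of_notMem {α : Q.Arr} (h : α ∉ Q.arrows S) : ar S K α = 0 := dif_neg h

lemma e_eq_ev (v : Q.Vert S) : (Q.bound S K).e v = ev S K v.1 := (ev_of_mem K v.2).symm

lemma arr_eq_ar {a b : Q.Vert S} (α : a ⟶ b) :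
    (Q.bound S K).arr (a := a) (b := b) α = ar S K α.1 := by
  obtain ⟨α, h1, h2⟩ := α
  obtain ⟨a, ha⟩ := a
  obtain ⟨b, hb⟩ := b
  dsimp only at h1 h2
  subst h1 h2
  exact (ar_of_mem K (mem_arrows.mpr ⟨ha, hb⟩)).symm

variable {K}

/-- The residue class of an element of the path algebra. -/
abbrev cls (x : PathAlgebra K (Q.Vert S)) : Q.Alg S K := Ideal.Quotient.mk (ideal Q S K) x

/-- A functional that vanishes on the ideal, as a functional on the algebra. -/
def descend (f : PathAlgebra K (Q.Vert S) →ₗ[K] K) (hf : ∀ x ∈ ideal Q S K, f x = 0) :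
    Q.Alg S K →ₗ[K] K :=
  ((ideal Q S K).restrictScalars K).liftQ f hf

/-- The coefficient at the vertex `v`. -/
def eps (v : Q.V) : Q.Alg S K →ₗ[K] K := descend (epsLin K v) fun _ hx => hx.1 v

/-- The coefficient at the arrow `α`. -/
def co (α : Q.Arr) : Q.Alg S K →ₗ[K] K := descend (arrLin K α) fun _ hx => hx.2.1 α

/-- The coefficient at the basis element `q` in degree two. -/
def de (q : Q.D) : Q.Alg S K →ₗ[K] K := descend (degLin K q) fun _ hx => hx.2.2 q

lemma eps_cls (v : Q.V) (x : PathAlgebra K (Q.Vert S)) : eps v (cls x) = epsLin K v x := rfl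
lemma co_cls (v : Q.Arr) (x : PathAlgebra K (Q.Vert S)) : co v (cls x) = arrLin K v x := rfl
lemma de_cls (v : Q.D) (x : PathAlgebra K (Q.Vert S)) : de v (cls x) = degLin K v x := rfl

lemma cls_mul (x y : PathAlgebra K (Q.Vert S)) : cls x * cls y = cls (x * y) := rfl

lemma cls_surjective (x : Q.Alg S K) : ∃ y, cls y = x := Ideal.Quotient.mk_surjective x

lemma ev_eq_cls {v : Q.V} (h : v ∈ S) : ev S K v = cls (PathAlgebra.vertex K ⟨v, h⟩) :=
  ev_of_mem K h

lemma ar_eq_cls {α : Q.Arr} (h : α ∈ Q.arrows S) :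
    ar S K α = cls (PathAlgebra.arrow K (arrowOf h)) := ar_of_mem K h

/-- An element of the algebra is determined by its coefficients. -/
lemma ext_coeff {x y : Q.Alg S K} (h1 : ∀ v, eps v x = eps v y) (h2 : ∀ α, co α x = co α y)
    (h3 : ∀ q, de q x = de q y) : x = y := by
  obtain ⟨x, rfl⟩ := cls_surjective x
  obtain ⟨y, rfl⟩ := cls_surjective y
  refine Ideal.Quotient.eq.mpr ⟨fun v => ?_, fun v => ?_, fun v => ?_⟩
  · rw [map_sub, sub_eq_zero]; exact h1 v
  · rw [map_sub, sub_eq_zero]; exact h2 v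
  · rw [map_sub, sub_eq_zero]; exact h3 v

lemma eps_of_notMem {v : Q.V} (h : v ∉ S) (x : Q.Alg S K) : eps v x = 0 := by
  obtain ⟨x, rfl⟩ := cls_surjective x
  have : epsLin (S := S) K v = 0 := by
    refine lin_ext fun p => ?_
    rw [epsLin_ofPath, epsPath, if_neg]; · rfl
    rintro ⟨-, h2⟩
    exact h (h2 ▸ p.1.2)
  rw [eps_cls, this]; rfl

lemma co_of_notMem {α : Q.Arr} (h : α ∉ Q.arrows S) (x : Q.Alg S K) : co α x = 0 := by
  obtain ⟨x, rfl⟩ := cls_surjective x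
  have : arrLin (S := S) K α = 0 := by
    refine lin_ext fun p => ?_
    rw [arrLin_ofPath, arrPath, if_neg]; · rfl
    intro h2
    refine h (mem_arrows.mpr ⟨?_, ?_⟩)
    · rw [src_of_word_append (l := []) _ h2]; exact p.1.2
    · rw [tgt_of_word_cons _ h2]; exact p.2.1.2
  rw [co_cls, this]; rfl

lemma de_of_notMem {q : Q.D} (h : ¬ (Q.start q ∈ S ∧ Q.finish q ∈ S)) (x : Q.Alg S K) :
    de q x = 0 := by
  obtain ⟨x, rfl⟩ := cls_surjective x
  have : degLin (S := S) K q = 0 := by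
    refine lin_ext fun p => ?_
    rw [degLin_ofPath, degPath, if_neg]; · rfl
    rintro ⟨β, α, h2, hr⟩
    refine h ⟨?_, ?_⟩
    · rw [← Q.rel_start hr, src_of_word_append (l := [β]) _ h2]; exact p.1.2
    · rw [← Q.rel_finish hr, tgt_of_word_cons _ h2]; exact p.2.1.2
  rw [de_cls, this]; rfl

section

variable (x : Q.Alg S K) (v w : Q.V) (α β : Q.Arr) (q : Q.D)

open Classical in
@[simp] lemma eps_ev_mul : eps v (ev S K w * x) = if w = v then eps v x else 0 := by
  by_cases hw : w ∈ S
  · obtain ⟨x, rfl⟩ := cls_surjective x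
    rw [ev_eq_cls hw, cls_mul, eps_cls, epsLin_vertex_mul]; rfl
  · rw [ev_of_notMem K hw]
    split_ifs with h
    · rw [eps_of_notMem (h ▸ hw), eps_of_notMem (h ▸ hw)]
    · simp

open Classical in
@[simp] lemma eps_mul_ev : eps v (x * ev S K w) = if w = v then eps v x else 0 := by
  by_cases hw : w ∈ S
  · obtain ⟨x, rfl⟩ := cls_surjective x
    rw [ev_eq_cls hw, cls_mul, eps_cls, epsLin_mul_vertex]; rfl
  · rw [ev_of_notMem K hw]
    split_ifs with h
    · rw [eps_of_notMem (h ▸ hw), eps_of_notMem (h ▸ hw)]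
    · simp

open Classical in
@[simp] lemma co_ev_mul : co α (ev S K w * x) = if w = Q.tgt α then co α x else 0 := by
  by_cases hw : w ∈ S
  · obtain ⟨x, rfl⟩ := cls_surjective x
    rw [ev_eq_cls hw, cls_mul, co_cls, arrLin_vertex_mul]; rfl
  · rw [ev_of_notMem K hw]
    split_ifs with h
    · have : α ∉ Q.arrows S := fun h' => hw (h ▸ (mem_arrows.mp h').2)
      rw [co_of_notMem this, co_of_notMem this]
    · simp

open Classical in
@[simp] lemma co_mul_ev : co α (x * ev S K w) = if w = Q.src α then co α x else 0 := by
  by_cases hw : w ∈ S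
  · obtain ⟨x, rfl⟩ := cls_surjective x
    rw [ev_eq_cls hw, cls_mul, co_cls, arrLin_mul_vertex]; rfl
  · rw [ev_of_notMem K hw]
    split_ifs with h
    · have : α ∉ Q.arrows S := fun h' => hw (h ▸ (mem_arrows.mp h').1)
      rw [co_of_notMem this, co_of_notMem this]
    · simp

open Classical in
@[simp] lemma de_ev_mul : de q (ev S K w * x) = if w = Q.finish q then de q x else 0 := by
  by_cases hw : w ∈ S
  · obtain ⟨x, rfl⟩ := cls_surjective x
    rw [ev_eq_cls hw, cls_mul, de_cls, degLin_vertex_mul]; rfl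
  · rw [ev_of_notMem K hw]
    split_ifs with h
    · have : ¬ (Q.start q ∈ S ∧ Q.finish q ∈ S) := fun h' => hw (h ▸ h'.2)
      rw [de_of_notMem this, de_of_notMem this]
    · simp

open Classical in
@[simp] lemma de_mul_ev : de q (x * ev S K w) = if w = Q.start q then de q x else 0 := by
  by_cases hw : w ∈ S
  · obtain ⟨x, rfl⟩ := cls_surjective x
    rw [ev_eq_cls hw, cls_mul, de_cls, degLin_mul_vertex]; rfl
  · rw [ev_of_notMem K hw]
    split_ifs with h
    · have : ¬ (Q.start q ∈ S ∧ Q.finish q ∈ S) := fun h' => hw (h ▸ h'.1)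
      rw [de_of_notMem this, de_of_notMem this]
    · simp

@[simp] lemma eps_ar_mul : eps v (ar S K α * x) = 0 := by
  by_cases hα : α ∈ Q.arrows S
  · obtain ⟨x, rfl⟩ := cls_surjective x
    rw [ar_eq_cls hα, cls_mul, eps_cls, epsLin_arrow_mul]
  · rw [ar_of_notMem K hα]; simp

@[simp] lemma eps_mul_ar : eps v (x * ar S K α) = 0 := by
  by_cases hα : α ∈ Q.arrows S
  · obtain ⟨x, rfl⟩ := cls_surjective x
    rw [ar_eq_cls hα, cls_mul, eps_cls, epsLin_mul_arrow]
  · rw [ar_of_notMem K hα]; simp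

variable {α β q}

open Classical in
lemma co_ar_mul (hα : α ∈ Q.arrows S) :
    co β (ar S K α * x) = if β = α then eps (Q.src α) x else 0 := by
  obtain ⟨x, rfl⟩ := cls_surjective x
  rw [ar_eq_cls hα, cls_mul, co_cls, arrLin_arrow_mul]; rfl

open Classical in
lemma co_mul_ar (hα : α ∈ Q.arrows S) :
    co β (x * ar S K α) = if β = α then eps (Q.tgt α) x else 0 := by
  obtain ⟨x, rfl⟩ := cls_surjective x
  rw [ar_eq_cls hα, cls_mul, co_cls, arrLin_mul_arrow]; rfl

lemma co_ar_mul_of_ne (h : β ≠ α) : co β (ar S K α * x) = 0 := by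
  by_cases hα : α ∈ Q.arrows S
  · rw [co_ar_mul x hα, if_neg h]
  · rw [ar_of_notMem K hα]; simp

lemma co_mul_ar_of_ne (h : β ≠ α) : co β (x * ar S K α) = 0 := by
  by_cases hα : α ∈ Q.arrows S
  · rw [co_mul_ar x hα, if_neg h]
  · rw [ar_of_notMem K hα]; simp

lemma de_ar_mul (hα : α ∈ Q.arrows S) (hr : Q.Rel α β q) : de q (ar S K α * x) = co β x := by
  obtain ⟨x, rfl⟩ := cls_surjective x
  rw [ar_eq_cls hα, cls_mul, de_cls, degLin_arrow_mul _ _ hr]; rfl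

lemma de_ar_mul_of_not (hr : ∀ β, ¬ Q.Rel α β q) : de q (ar S K α * x) = 0 := by
  by_cases hα : α ∈ Q.arrows S
  · obtain ⟨x, rfl⟩ := cls_surjective x
    rw [ar_eq_cls hα, cls_mul, de_cls]
    exact degLin_arrow_mul_of_not _ _ hr
  · rw [ar_of_notMem K hα]; simp

lemma de_mul_ar (hα : α ∈ Q.arrows S) (hr : Q.Rel β α q) : de q (x * ar S K α) = co β x := by
  obtain ⟨x, rfl⟩ := cls_surjective x
  rw [ar_eq_cls hα, cls_mul, de_cls, degLin_mul_arrow _ _ hr]; rfl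

lemma de_mul_ar_of_not (hr : ∀ β, ¬ Q.Rel β α q) : de q (x * ar S K α) = 0 := by
  by_cases hα : α ∈ Q.arrows S
  · obtain ⟨x, rfl⟩ := cls_surjective x
    rw [ar_eq_cls hα, cls_mul, de_cls]
    exact degLin_mul_arrow_of_not _ _ hr
  · rw [ar_of_notMem K hα]; simp

end

/-! Products of idempotents and arrows -/

open PathAlgebra

lemma one_eq_sum : (1 : Q.Alg S K) = ∑ v ∈ S, ev S K v := by
  have h1 : (1 : PathAlgebra K (Q.Vert S)) = ∑ v : Q.Vert S, vertex K v := one_def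
  have h2 : (1 : Q.Alg S K) = ∑ v : Q.Vert S, ev S K v.1 := by
    have h3 := congrArg (Ideal.Quotient.mk (ideal Q S K)) h1
    rw [map_sum, map_one] at h3
    exact h3.trans (Finset.sum_congr rfl fun v _ => (ev_eq_cls v.2).symm)
  rw [h2]
  refine Finset.sum_bij (fun v _ => v.1) (fun v _ => v.2) (fun a _ b _ h => Vert.ext h)
    (fun b hb => ⟨⟨b, hb⟩, Finset.mem_univ _, rfl⟩) fun _ _ => rfl

@[simp] lemma eps_ev (v w : Q.V) [Decidable (w = v)] (hw : w ∈ S) :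
    eps v (ev S K w) = if w = v then 1 else 0 := by
  rw [ev_eq_cls hw, eps_cls, vertex, epsLin_ofPath, epsPath]
  simp

@[simp] lemma co_ev (α : Q.Arr) (w : Q.V) : co α (ev S K w) = 0 := by
  by_cases hw : w ∈ S
  · rw [ev_eq_cls hw, co_cls, vertex, arrLin_ofPath, arrPath]; simp
  · rw [ev_of_notMem K hw, map_zero]

@[simp] lemma de_ev (q : Q.D) (w : Q.V) : de q (ev S K w) = 0 := by
  by_cases hw : w ∈ S
  · rw [ev_eq_cls hw, de_cls, vertex, degLin_ofPath, degPath, if_neg]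
    rintro ⟨_, _, h, -⟩; simp at h
  · rw [ev_of_notMem K hw, map_zero]

@[simp] lemma eps_ar (α : Q.Arr) (w : Q.V) : eps w (ar S K α) = 0 := by
  rw [← mul_one (ar S K α), eps_ar_mul]

lemma eps_one {v : Q.V} (hv : v ∈ S) : eps v (1 : Q.Alg S K) = 1 := by
  classical
  rw [one_eq_sum, map_sum, Finset.sum_eq_single v]
  · rw [eps_ev _ _ hv, if_pos rfl]
  · intro w hw h; rw [eps_ev _ _ hw, if_neg h]
  · exact fun h => absurd hv h

lemma co_one (α : Q.Arr) : co α (1 : Q.Alg S K) = 0 := by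
  rw [one_eq_sum, map_sum]; simp

open Classical in
lemma co_ar {α : Q.Arr} (hα : α ∈ Q.arrows S) (β : Q.Arr) :
    co β (ar S K α) = if β = α then 1 else 0 := by
  rw [← mul_one (ar S K α), co_ar_mul _ hα, eps_one (mem_arrows.mp hα).1]

@[simp] lemma de_ar (α : Q.Arr) (q : Q.D) : de q (ar S K α) = 0 := by
  rw [← mul_one (ar S K α)]
  by_cases hα : α ∈ Q.arrows S
  · by_cases h : ∃ β, Q.Rel α β q
    · obtain ⟨β, h⟩ := h
      rw [de_ar_mul _ hα h, co_one]
    · exact de_ar_mul_of_not _ (by simpa using h)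
  · rw [ar_of_notMem K hα]; simp

lemma ev_mul_ev_self (v : Q.V) : ev S K v * ev S K v = ev S K v := by
  classical
  refine ext_coeff (fun w => ?_) (fun α => ?_) (fun q => ?_)
  · rw [eps_ev_mul]; split_ifs with h
    · rfl
    · by_cases hv : v ∈ S
      · rw [eps_ev _ _ hv, if_neg h]
      · rw [ev_of_notMem K hv, map_zero]
  · simp
  · simp

lemma ev_mul_ev_of_ne {v w : Q.V} (h : v ≠ w) : ev S K v * ev S K w = 0 := by
  classical
  refine ext_coeff (fun z => ?_) (fun α => ?_) (fun q => ?_)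
  · rw [eps_ev_mul, map_zero]; split_ifs with h1
    · by_cases hw : w ∈ S
      · rw [eps_ev _ _ hw, if_neg]; rintro rfl; exact h h1
      · rw [ev_of_notMem K hw, map_zero]
    · rfl
  · simp
  · simp

lemma ev_tgt_mul_ar (α : Q.Arr) : ev S K (Q.tgt α) * ar S K α = ar S K α := by
  classical
  by_cases hα : α ∈ Q.arrows S
  · refine ext_coeff (fun w => by simp) (fun β => ?_) (fun q => by simp)
    rw [co_ev_mul, co_ar hα]
    by_cases h : β = α
    · rw [h]; simp
    · simp [h]
  · rw [ar_of_notMem K hα, mul_zero]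

lemma ar_mul_ev_src (α : Q.Arr) : ar S K α * ev S K (Q.src α) = ar S K α := by
  classical
  by_cases hα : α ∈ Q.arrows S
  · refine ext_coeff (fun w => by simp) (fun β => ?_) (fun q => by simp)
    rw [co_mul_ev, co_ar hα]
    by_cases h : β = α
    · rw [h]; simp
    · simp [h]
  · rw [ar_of_notMem K hα, zero_mul]

lemma ev_mul_ar_of_ne {α : Q.Arr} {v : Q.V} (h : v ≠ Q.tgt α) : ev S K v * ar S K α = 0 := by
  rw [← ev_tgt_mul_ar, ← mul_assoc, ev_mul_ev_of_ne h, zero_mul]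

lemma ar_mul_ev_of_ne {α : Q.Arr} {v : Q.V} (h : Q.src α ≠ v) : ar S K α * ev S K v = 0 := by
  rw [← ar_mul_ev_src, mul_assoc, ev_mul_ev_of_ne h, mul_zero]

/-- Paths of length three vanish. -/
lemma ar_mul_ar_mul_ar (α β γ : Q.Arr) : ar S K α * (ar S K β * ar S K γ) = 0 := by
  classical
  refine ext_coeff (fun w => by simp) (fun δ => ?_) (fun q => ?_)
  · rw [map_zero]
    by_cases hα : α ∈ Q.arrows S
    · rw [co_ar_mul _ hα, eps_ar_mul]; simp
    · rw [ar_of_notMem K hα]; simp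
  · rw [map_zero]
    by_cases hα : α ∈ Q.arrows S
    · by_cases h : ∃ δ, Q.Rel α δ q
      · obtain ⟨δ, h⟩ := h
        rw [de_ar_mul _ hα h]
        by_cases hβ : β ∈ Q.arrows S
        · rw [co_ar_mul _ hβ]; simp
        · rw [ar_of_notMem K hβ]; simp
      · exact de_ar_mul_of_not _ (by simpa using h)
    · rw [ar_of_notMem K hα]; simp

/-- A product of two arrows vanishes if it has no nonzero coefficient. -/
lemma ar_mul_ar_eq_zero {α β : Q.Arr} (h : ∀ q, ¬ Q.Rel α β q) : ar S K α * ar S K β = 0 := by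
  classical
  refine ext_coeff (fun w => by simp) (fun δ => ?_) (fun q => ?_)
  · rw [map_zero]
    by_cases hα : α ∈ Q.arrows S
    · rw [co_ar_mul _ hα, eps_ar]; simp
    · rw [ar_of_notMem K hα]; simp
  · rw [map_zero]
    by_cases hα : α ∈ Q.arrows S
    · by_cases h' : ∃ δ, Q.Rel α δ q
      · obtain ⟨δ, h'⟩ := h'
        rw [de_ar_mul _ hα h']
        by_cases hβ : β ∈ Q.arrows S
        · rw [co_ar hβ, if_neg]
          rintro rfl
          exact h q h'
        · rw [ar_of_notMem K hβ]; simp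
      · exact de_ar_mul_of_not _ (by simpa using h')
    · rw [ar_of_notMem K hα]; simp

/-- Every element is a combination of idempotents up to an element of the ideal generated by
the arrows. -/
lemma exists_decomp (x : Q.Alg S K) : ∃ y : Q.Arr → Q.Alg S K,
    x = ∑ v ∈ S, eps v x • ev S K v + ∑ α ∈ Q.arrows S, ar S K α * y α := by
  classical
  obtain ⟨x, rfl⟩ := cls_surjective x
  refine PathAlgebra.ind (C := fun x => ∃ y : Q.Arr → Q.Alg S K, cls x =
    ∑ v ∈ S, eps v (cls x) • ev S K v + ∑ α ∈ Q.arrows S, ar S K α * y α) x ?_ ?_ ?_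
  · have h0 : cls (0 : PathAlgebra K (Q.Vert S)) = 0 := rfl
    exact ⟨0, by simp [h0]⟩
  · rintro x y ⟨f, hf⟩ ⟨g, hg⟩
    refine ⟨f + g, ?_⟩
    have : cls (x + y) = cls x + cls y := rfl
    rw [this]
    conv_lhs => rw [hf, hg]
    simp only [map_add, add_smul, Finset.sum_add_distrib, Pi.add_apply, mul_add]
    abel
  · rintro k ⟨a, b, p⟩
    have hs : ∀ z : PathAlgebra K (Q.Vert S), cls (k • z) = k • cls z := fun _ => rfl
    rw [hs]
    cases p with
    | nil =>
      refine ⟨0, ?_⟩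
      have h1 : cls (ofPath K (⟨a, a, .nil⟩ : Paths (Q.Vert S))) = ev S K a.1 :=
        (ev_eq_cls a.2).symm
      rw [h1]
      simp only [Pi.zero_apply, mul_zero, Finset.sum_const_zero, add_zero, map_smul]
      rw [Finset.sum_eq_single a.1]
      · rw [eps_ev _ _ a.2]; simp
      · intro v _ hv; rw [eps_ev _ _ a.2, if_neg (Ne.symm hv)]; simp
      · exact fun h => absurd a.2 h
    | cons p γ =>
      have hγ : γ.1 ∈ Q.arrows S :=
        mem_arrows.mpr ⟨by rw [γ.2.1]; exact Vert.mem _, by rw [γ.2.2]; exact Vert.mem _⟩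
      have h1 : cls (ofPath K (⟨a, b, p.cons γ⟩ : Paths (Q.Vert S))) =
          ar S K γ.1 * cls (ofPath K ⟨_, _, p⟩) := by
        rw [ofPath_cons, ← cls_mul]; congr 1
        exact arr_eq_ar K γ
      refine ⟨Pi.single γ.1 (k • cls (ofPath K ⟨_, _, p⟩)), ?_⟩
      rw [h1, Finset.sum_eq_zero, zero_add, Finset.sum_eq_single γ.1]
      · simp
      · intro α _ h; rw [Pi.single_eq_of_ne h, mul_zero]
      · exact fun h => absurd hγ h
      · intro v _; simp

/-- The version of `exists_decomp` for elements of the ideal generated by the arrows. -/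
lemma exists_decomp_of_eps (x : Q.Alg S K) (hx : ∀ v, eps v x = 0) : ∃ y : Q.Arr → Q.Alg S K,
    x = ∑ α ∈ Q.arrows S, ar S K α * y α := by
  obtain ⟨y, hy⟩ := exists_decomp x
  exact ⟨y, by simpa [hx] using hy⟩

lemma ar_mul_eq (α : Q.Arr) (x : Q.Alg S K) :
    ∃ y : Q.Arr → Q.Alg S K, ar S K α * x = eps (Q.src α) x • ar S K α +
      ∑ β ∈ Q.arrows S, ar S K α * (ar S K β * y β) := by
  classical
  obtain ⟨y, hy⟩ := exists_decomp x
  refine ⟨y, ?_⟩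
  conv_lhs => rw [hy]
  rw [mul_add, Finset.mul_sum, Finset.mul_sum]
  congr 1
  by_cases hs : Q.src α ∈ S
  · rw [Finset.sum_eq_single (Q.src α)]
    · rw [mul_smul_comm, ar_mul_ev_src]
    · intro v _ hv; rw [mul_smul_comm, ar_mul_ev_of_ne (Ne.symm hv), smul_zero]
    · exact fun h => absurd hs h
  · have : ar S K α = 0 := ar_of_notMem K fun h => hs (mem_arrows.mp h).1
    simp [this]

end QuadraticTable

namespace QuadraticTable

variable {Q : QuadraticTable} {S : Finset Q.V} {K : Type u} [Field K]

/-! ### The radical, finite dimension and connectedness -/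

/-- The coefficients at the vertices are multiplicative. -/
lemma eps_mul (v : Q.V) (x y : Q.Alg S K) : eps v (x * y) = eps v x * eps v y := by
  classical
  obtain ⟨f, hf⟩ := exists_decomp x
  conv_lhs => rw [hf]
  simp only [add_mul, Finset.sum_mul, map_add, map_sum, mul_assoc, eps_ar_mul, smul_mul_assoc,
    map_smul, eps_ev_mul, smul_eq_mul, mul_ite, mul_zero, Finset.sum_const_zero, add_zero]
  rw [Finset.sum_ite_eq']
  split_ifs with h
  · rfl
  · rw [eps_of_notMem h, zero_mul]

/-- The ideal generated by the arrows. -/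
def arrowIdeal (Q : QuadraticTable) (S : Finset Q.V) (K : Type u) [Field K] :
    Ideal (Q.Alg S K) where
  carrier := {x | ∀ v, eps v x = 0}
  add_mem' hx hy v := by rw [map_add, hx v, hy v, add_zero]
  zero_mem' v := map_zero _
  smul_mem' c x hx v := by rw [smul_eq_mul, eps_mul, hx v, mul_zero]

lemma ar_mem_arrowIdeal (α : Q.Arr) : ar S K α ∈ arrowIdeal Q S K := fun _ => eps_ar _ _

/-- Elements all of whose coefficients in degrees zero and one vanish. -/
def degTwo (Q : QuadraticTable) (S : Finset Q.V) (K : Type u) [Field K] :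
    Set (Q.Alg S K) := {x | (∀ v, eps v x = 0) ∧ ∀ α, co α x = 0}

lemma mul_mem_degTwo (x : Q.Alg S K) {w : Q.Alg S K} (hw : w ∈ degTwo Q S K) :
    x * w ∈ degTwo Q S K := by
  classical
  refine ⟨fun v => by rw [eps_mul, hw.1, mul_zero], fun β => ?_⟩
  obtain ⟨f, hf⟩ := exists_decomp x
  rw [hf]
  simp only [add_mul, Finset.sum_mul, map_add, map_sum, mul_assoc, smul_mul_assoc, map_smul,
    co_ev_mul, hw.2, ite_self, smul_zero, Finset.sum_const_zero, zero_add]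
  refine Finset.sum_eq_zero fun α hα => ?_
  rw [co_ar_mul _ hα, eps_mul, hw.1, mul_zero, ite_self]

lemma mul_mem_degTwo_of_mem {x y : Q.Alg S K} (hx : x ∈ arrowIdeal Q S K)
    (hy : y ∈ arrowIdeal Q S K) : x * y ∈ degTwo Q S K := by
  classical
  refine ⟨fun v => by rw [eps_mul, hy, mul_zero], fun β => ?_⟩
  obtain ⟨f, hf⟩ := exists_decomp_of_eps x hx
  rw [hf]
  simp only [Finset.sum_mul, map_sum, mul_assoc]
  refine Finset.sum_eq_zero fun α hα => ?_
  rw [co_ar_mul _ hα, eps_mul, hy, mul_zero, ite_self]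

lemma mul_degTwo_eq_zero {x w : Q.Alg S K} (hx : x ∈ arrowIdeal Q S K)
    (hw : w ∈ degTwo Q S K) : x * w = 0 := by
  classical
  obtain ⟨f, hf⟩ := exists_decomp_of_eps x hx
  rw [hf, Finset.sum_mul]
  refine Finset.sum_eq_zero fun α hα => ?_
  rw [mul_assoc]
  have h := mul_mem_degTwo (f α) hw
  refine ext_coeff (fun v => by simp) (fun β => ?_) fun q => ?_
  · rw [co_ar_mul _ hα, h.1, ite_self, map_zero]
  · rw [map_zero]
    by_cases hr : ∃ β, Q.Rel α β q
    · obtain ⟨β, hr⟩ := hr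
      rw [de_ar_mul _ hα hr, h.2]
    · exact de_ar_mul_of_not _ (by simpa using hr)

lemma arrowIdeal_mul_mul {x y z : Q.Alg S K} (hx : x ∈ arrowIdeal Q S K)
    (hy : y ∈ arrowIdeal Q S K) (hz : z ∈ arrowIdeal Q S K) : x * (y * z) = 0 :=
  mul_degTwo_eq_zero hx (mul_mem_degTwo_of_mem hy hz)

/-- The ideal of the elements whose coefficient at the vertex `v` vanishes. -/
def kerEps (Q : QuadraticTable) (S : Finset Q.V) (K : Type u) [Field K] (v : Q.V) :
    Ideal (Q.Alg S K) where
  carrier := {x | eps v x = 0}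
  add_mem' {x y} (hx : eps v x = 0) (hy : eps v y = 0) := by
    change eps v (x + y) = 0; rw [map_add, hx, hy, add_zero]
  zero_mem' := map_zero _
  smul_mem' c x (hx : eps v x = 0) := by
    change eps v (c * x) = 0; rw [eps_mul, hx, mul_zero]

lemma mem_kerEps {v : Q.V} {x : Q.Alg S K} : x ∈ kerEps Q S K v ↔ eps v x = 0 := Iff.rfl

lemma isMaximal_kerEps {v : Q.V} (hv : v ∈ S) : (kerEps Q S K v).IsMaximal := by
  refine ⟨⟨fun h => ?_, fun J hJ => ?_⟩⟩
  · have h1 : (1 : Q.Alg S K) ∈ kerEps Q S K v := by rw [h]; trivial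
    rw [mem_kerEps, eps_one hv] at h1
    exact one_ne_zero h1
  · obtain ⟨y, hyJ, hym⟩ := Set.exists_of_ssubset hJ
    have hy0 : eps v y ≠ 0 := hym
    rw [Ideal.eq_top_iff_one]
    have h1 : (1 : Q.Alg S K) - ((eps v y)⁻¹ • 1) * y ∈ kerEps Q S K v := by
      rw [mem_kerEps, map_sub, eps_mul, map_smul, eps_one hv, smul_eq_mul, mul_one,
        inv_mul_cancel₀ hy0, sub_self]
    have h2 := J.add_mem (hJ.le h1) (J.mul_mem_left ((eps v y)⁻¹ • 1) hyJ)
    simpa using h2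

/-- The Jacobson radical is the ideal generated by the arrows. -/
lemma jacobson_eq : Ring.jacobson (Q.Alg S K) = arrowIdeal Q S K := by
  rw [Ring.jacobson_eq_sInf_isMaximal]
  refine le_antisymm ?_ (le_sInf ?_)
  · intro x hx v
    by_cases hv : v ∈ S
    · exact (Submodule.mem_sInf.mp hx) _ (isMaximal_kerEps hv)
    · exact eps_of_notMem hv x
  · intro m hm
    by_contra h
    have h1 : m ⊔ arrowIdeal Q S K = ⊤ := by
      refine hm.1.2 _ (lt_of_le_of_ne le_sup_left fun h' => h ?_)
      rw [h']; exact le_sup_right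
    have h2 : (1 : Q.Alg S K) ∈ m ⊔ arrowIdeal Q S K := by rw [h1]; trivial
    obtain ⟨a, ha, b, hb, hab⟩ := Submodule.mem_sup.mp h2
    refine hm.ne_top ((Ideal.eq_top_iff_one _).mpr ?_)
    have h3 : (1 + b + b * b) * a = 1 := by
      have : a = 1 - b := by rw [← hab]; abel
      rw [this]
      have h4 : b * (b * b) = 0 := arrowIdeal_mul_mul hb hb hb
      have : (1 + b + b * b) * (1 - b) = 1 - b * (b * b) := by noncomm_ring
      rw [this, h4, sub_zero]
    rw [← h3]
    exact m.mul_mem_left _ ha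

lemma jacobson_pow_three : Ring.jacobson (Q.Alg S K) ^ 3 = ⊥ := by
  rw [jacobson_eq, eq_bot_iff, Submodule.pow_succ, Submodule.pow_succ]
  refine Ideal.mul_le.mpr fun x hx z hz => ?_
  refine Submodule.smul_induction_on (p := fun x => x * z ∈ (⊥ : Ideal (Q.Alg S K))) hx ?_ ?_
  · intro x hx y hy
    rw [Submodule.pow_one] at hx
    rw [smul_eq_mul, mul_assoc]
    exact arrowIdeal_mul_mul hx hy hz
  · intro x y hx hy
    rw [add_mul]; exact add_mem hx hy

/-- The algebra is finite dimensional. -/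
lemma finiteDimensional : FiniteDimensional K (Q.Alg S K) := by
  classical
  let T : Finset (Q.Alg S K) := (S.image (ev S K) ∪ (Q.arrows S).image (ar S K)) ∪
    (Q.arrows S ×ˢ Q.arrows S).image fun p => ar S K p.1 * ar S K p.2
  refine ⟨⟨T, eq_top_iff.mpr fun x _ => ?_⟩⟩
  have hv : ∀ v ∈ S, ev S K v ∈ Submodule.span K (T : Set (Q.Alg S K)) := fun v hv =>
    Submodule.subset_span (Finset.mem_coe.mpr (Finset.mem_union_left _ (Finset.mem_union_left _
      (Finset.mem_image_of_mem _ hv))))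
  have ha : ∀ α ∈ Q.arrows S, ar S K α ∈ Submodule.span K (T : Set (Q.Alg S K)) := fun v hv =>
    Submodule.subset_span (Finset.mem_coe.mpr (Finset.mem_union_left _ (Finset.mem_union_right _
      (Finset.mem_image_of_mem _ hv))))
  have hp : ∀ α ∈ Q.arrows S, ∀ β ∈ Q.arrows S,
      ar S K α * ar S K β ∈ Submodule.span K (T : Set (Q.Alg S K)) := fun α hα β hβ =>
    Submodule.subset_span (Finset.mem_coe.mpr (Finset.mem_union_right _
      (Finset.mem_image.mpr ⟨(α, β), Finset.mem_product.mpr ⟨hα, hβ⟩, rfl⟩)))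
  obtain ⟨y, hy⟩ := exists_decomp x
  rw [hy]
  refine add_mem (sum_mem fun v h => Submodule.smul_mem _ _ (hv v h)) (sum_mem fun α hα => ?_)
  obtain ⟨z, hz⟩ := ar_mul_eq α (y α)
  rw [hz]
  refine add_mem (Submodule.smul_mem _ _ (ha α hα)) (sum_mem fun β hβ => ?_)
  obtain ⟨w, hw⟩ := ar_mul_eq β (z β)
  rw [hw, mul_add, mul_smul_comm, Finset.mul_sum, Finset.sum_eq_zero, add_zero]
  · exact Submodule.smul_mem _ _ (hp α hα β hβ)
  · intro γ _
    rw [← mul_assoc (ar S K β), ← mul_assoc, ar_mul_ar_mul_ar, zero_mul]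

/-- The algebra of a connected quiver is connected. -/
lemma isConnectedRing {v₀ : Q.V} (h₀ : v₀ ∈ S)
    (hconn : ∀ v ∈ S, Relation.EqvGen
      (fun a b => ∃ α ∈ Q.arrows S, Q.src α = a ∧ Q.tgt α = b) v v₀) :
    IsConnectedRing (Q.Alg S K) := by
  refine ⟨⟨1, 0, fun h => ?_⟩, fun c hc hcomm => ?_⟩
  · have := eps_one (K := K) h₀
    rw [h, map_zero] at this
    exact zero_ne_one this
  · have hedge : ∀ α ∈ Q.arrows S, eps (Q.src α) c = eps (Q.tgt α) c := by
      intro α hα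
      have h := congrArg (co α) (hcomm (ar S K α))
      rw [co_ar_mul _ hα, co_mul_ar _ hα, if_pos rfl, if_pos rfl] at h
      exact h.symm
    have hgen : ∀ a b, Relation.EqvGen
        (fun a b => ∃ α ∈ Q.arrows S, Q.src α = a ∧ Q.tgt α = b) a b → eps a c = eps b c := by
      intro a b h
      induction h with
      | rel a b h => obtain ⟨α, hα, rfl, rfl⟩ := h; exact hedge α hα
      | refl => rfl
      | symm a b _ ih => exact ih.symm
      | trans a b c _ _ ih1 ih2 => exact ih1.trans ih2
    have hall : ∀ v ∈ S, eps v c = eps v₀ c := fun v hv => hgen _ _ (hconn v hv)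
    have hid : ∀ z : Q.Alg S K, z * z = z → (∀ v, eps v z = 0) → z = 0 := by
      intro z hz hz0
      calc z = z * (z * z) := by rw [hz, hz]
        _ = 0 := arrowIdeal_mul_mul hz0 hz0 hz0
    have h01 : eps v₀ c * eps v₀ c = eps v₀ c := by rw [← eps_mul, hc]
    rcases IsIdempotentElem.iff_eq_zero_or_one.mp h01 with h | h
    · left
      refine hid c hc fun v => ?_
      by_cases hv : v ∈ S
      · rw [hall v hv, h]
      · exact eps_of_notMem hv c
    · right
      have : 1 - c = 0 := by
        refine hid (1 - c) (hc.one_sub) fun v => ?_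
        by_cases hv : v ∈ S
        · rw [map_sub, eps_one hv, hall v hv, h, sub_self]
        · exact eps_of_notMem hv _
      exact (sub_eq_zero.mp this).symm

end QuadraticTable

namespace QuadraticTable

variable {Q : QuadraticTable} {S S' S'' : Finset Q.V} {K : Type u} [Field K]

open PathAlgebra

/-! ### Monomial algebras, corners and stacks -/

/-- If no path of length two has a nonzero residue class, then the algebra is monomial. -/
lemma isMonomial_bound (h : ∀ α ∈ Q.arrows S, ∀ β ∈ Q.arrows S, ∀ q, ¬ Q.Rel β α q) :
    (Q.bound S K).IsMonomial := by
  refine ⟨{p | 2 ≤ p.length}, le_antisymm (fun x hx => ?_) ?_⟩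
  · have hx' : x = Finsupp.sum (show Paths (Q.Vert S) →₀ K from x) fun p k => k • ofPath K p := by
      have h1 := Finsupp.sum_single (show Paths (Q.Vert S) →₀ K from x)
      refine h1.symm.trans (Finset.sum_congr rfl fun p _ => ?_)
      exact (Finsupp.smul_single_one p _).symm
    rw [hx', TwoSidedIdeal.mem_asIdeal]
    refine sum_mem fun p hp => ?_
    have hp2 : 2 ≤ p.length := by
      by_contra hlt
      exact (Finsupp.mem_support_iff.mp hp) (coeff_eq_zero_of_length hx p (by omega))
    have h2 : ofPath K p ∈ TwoSidedIdeal.span (ofPath K '' {p : Paths (Q.Vert S) | 2 ≤ p.length}) :=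
      TwoSidedIdeal.subset_span (Set.mem_image_of_mem _ hp2)
    have h3 : ∀ k : K, k • ofPath K p = (k • (1 : PathAlgebra K (Q.Vert S))) * ofPath K p :=
      fun k => by rw [smul_mul_assoc, one_mul]
    dsimp only
    rw [h3]
    exact TwoSidedIdeal.mul_mem_left _ _ _ h2
  · have h1 : TwoSidedIdeal.span (ofPath K '' {p : Paths (Q.Vert S) | 2 ≤ p.length}) ≤
        (ideal Q S K).toTwoSided := by
      rw [TwoSidedIdeal.span_le]
      rintro _ ⟨p, hp, rfl⟩
      change ofPath K p ∈ (ideal Q S K).toTwoSided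
      rw [Ideal.mem_toTwoSided]
      rcases Nat.lt_or_ge 2 p.length with h3 | h3
      · exact ofPath_mem_ideal p h3
      have hp2 : (word p.2.2).length = 2 := by
        rw [length_word]; exact le_antisymm h3 hp
      refine ⟨fun v => ?_, fun α => ?_, fun q => ?_⟩
      · rw [epsLin_ofPath, epsPath, if_neg]; rintro ⟨h, -⟩; simp [h] at hp2
      · rw [arrLin_ofPath, arrPath, if_neg]; intro h; simp [h] at hp2
      · rw [degLin_ofPath, degPath, if_neg]
        rintro ⟨β, α, hw, hr⟩
        have hs := src_of_word_append (l := [β]) _ hw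
        have ht := tgt_of_word_cons _ hw
        obtain ⟨a, b, p⟩ := p
        cases p with
        | nil => simp at hw
        | cons p γ =>
          simp only [word_cons, List.cons.injEq] at hw
          obtain ⟨rfl, hw⟩ := hw
          have hm := tgt_of_word_cons _ hw
          refine h α (mem_arrows.mpr ⟨?_, ?_⟩) γ.1 (mem_arrows.mpr ⟨?_, ?_⟩) q hr
          · rw [hs]; exact a.2
          · rw [hm]; exact Vert.mem _
          · rw [γ.2.1]; exact Vert.mem _
          · rw [γ.2.2]; exact Vert.mem _
    intro x hx
    exact Ideal.mem_toTwoSided.mp (h1 (TwoSidedIdeal.mem_asIdeal.mp hx))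

lemma hom_mem_arrows {a b : Q.Vert S} (α : a ⟶ b) : α.1 ∈ Q.arrows S :=
  mem_arrows.mpr ⟨by rw [α.2.1]; exact a.2, by rw [α.2.2]; exact b.2⟩

section Corner

variable (h : S' ⊆ S)

/-- The inclusion of the full subquiver on a smaller set of vertices. -/
def incl : Q.Vert S' ↪ Q.Vert S := ⟨fun v => ⟨v.1, h v.2⟩, fun v w e => by
  cases v; cases w; cases e; rfl⟩

/-- The inclusion of the full subquiver on a smaller set of vertices, as a prefunctor. -/
def inclPrefunctor : Q.Vert S' ⥤q Q.Vert S where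
  obj v := ⟨v.1, h v.2⟩
  map α := ⟨α.1, α.2⟩

/-- The image of a path under the inclusion of a full subquiver. -/
def inclPath (p : Paths (Q.Vert S')) : Paths (Q.Vert S) :=
  ⟨(inclPrefunctor h).obj p.1, (inclPrefunctor h).obj p.2.1, (inclPrefunctor h).mapPath p.2.2⟩

lemma word_mapPath {a b : Q.Vert S'} (p : Quiver.Path a b) :
    word ((inclPrefunctor h).mapPath p) = word p := by
  induction p with
  | nil => rfl
  | cons p α ih => rw [Prefunctor.mapPath_cons]; simp only [word_cons, ih]; rfl

lemma word_inclPath (p : Paths (Q.Vert S')) : word (inclPath h p).2.2 = word p.2.2 :=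
  word_mapPath h p.2.2

lemma inclPath_fst (p : Paths (Q.Vert S')) : (inclPath h p).1.1 = p.1.1 := rfl

variable (K) in
/-- The linear map on path algebras given by the inclusion of a full subquiver, followed by the
residue class map. -/
def inclLin : PathAlgebra K (Q.Vert S') →ₗ[K] Q.Alg S K :=
  extend K fun p => cls (ofPath K (inclPath h p))

lemma inclLin_ofPath (p : Paths (Q.Vert S')) :
    inclLin K h (ofPath K p) = cls (ofPath K (inclPath h p)) := extend_ofPath _ _ _

lemma eps_inclLin (v : Q.V) (x : PathAlgebra K (Q.Vert S')) :
    eps v (inclLin K h x) = epsLin K v x := by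
  have : eps v ∘ₗ inclLin K h = epsLin K v := lin_ext fun p => by
    rw [LinearMap.comp_apply, inclLin_ofPath, eps_cls, epsLin_ofPath, epsLin_ofPath, epsPath,
      epsPath, word_inclPath, inclPath_fst]
  exact LinearMap.congr_fun this x

lemma co_inclLin (v : Q.Arr) (x : PathAlgebra K (Q.Vert S')) :
    co v (inclLin K h x) = arrLin K v x := by
  have : co v ∘ₗ inclLin K h = arrLin K v := lin_ext fun p => by
    rw [LinearMap.comp_apply, inclLin_ofPath, co_cls, arrLin_ofPath, arrLin_ofPath, arrPath,
      arrPath, word_inclPath]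
  exact LinearMap.congr_fun this x

lemma de_inclLin (v : Q.D) (x : PathAlgebra K (Q.Vert S')) :
    de v (inclLin K h x) = degLin K v x := by
  have : de v ∘ₗ inclLin K h = degLin K v := lin_ext fun p => by
    rw [LinearMap.comp_apply, inclLin_ofPath, de_cls, degLin_ofPath, degLin_ofPath, degPath,
      degPath, word_inclPath]
  exact LinearMap.congr_fun this x

lemma inclLin_mul (x y : PathAlgebra K (Q.Vert S')) :
    inclLin K h (x * y) = inclLin K h x * inclLin K h y := by
  refine PathAlgebra.ind (C := fun x => inclLin K h (x * y) = inclLin K h x * inclLin K h y) x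
    (by simp) (fun x₁ x₂ h₁ h₂ => by rw [add_mul, map_add, map_add, add_mul, h₁, h₂]) fun k p => ?_
  refine PathAlgebra.ind (C := fun y => inclLin K h (k • ofPath K p * y) =
    inclLin K h (k • ofPath K p) * inclLin K h y) y
    (by simp) (fun x₁ x₂ h₁ h₂ => by rw [mul_add, map_add, map_add, mul_add, h₁, h₂]) fun l q => ?_
  simp only [smul_mul_assoc, mul_smul_comm, map_smul]
  congr 2
  rw [inclLin_ofPath, inclLin_ofPath, cls_mul]
  obtain ⟨a, b, p⟩ := p
  obtain ⟨c, d, q⟩ := q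
  by_cases hd : d = a
  · subst hd
    rw [ofPath_mul_of_eq, inclLin_ofPath]
    simp only [inclPath]
    rw [ofPath_mul_of_eq]
    rw [Prefunctor.mapPath_comp]
  · rw [ofPath_mul_of_ne (by exact hd), ofPath_mul_of_ne, map_zero]
    · rfl
    · intro h1
      have h2 : d.1 = a.1 := congrArg (fun w : Q.Vert S => w.1) h1
      exact hd (Vert.ext h2)

lemma inclLin_eq_zero_iff (x : PathAlgebra K (Q.Vert S')) :
    inclLin K h x = 0 ↔ x ∈ ideal Q S' K := by
  constructor
  · intro hx
    refine ⟨fun v => ?_, fun v => ?_, fun v => ?_⟩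
    · rw [← eps_inclLin h, hx, map_zero]
    · rw [← co_inclLin h, hx, map_zero]
    · rw [← de_inclLin h, hx, map_zero]
  · intro hx
    refine ext_coeff (fun v => ?_) (fun v => ?_) fun v => ?_
    · rw [eps_inclLin h, hx.1, map_zero]
    · rw [co_inclLin h, hx.2.1, map_zero]
    · rw [de_inclLin h, hx.2.2, map_zero]

/-- The homomorphism between the algebras given by the inclusion of a full subquiver. -/
def inclHom : Q.Alg S' K →ₙₐ[K] Q.Alg S K where
  toFun := ((ideal Q S' K).restrictScalars K).liftQ (inclLin K h)
    fun x hx => (inclLin_eq_zero_iff h x).mpr hx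
  map_smul' k x := map_smul (((ideal Q S' K).restrictScalars K).liftQ (inclLin K h) _) k x
  map_zero' := map_zero (((ideal Q S' K).restrictScalars K).liftQ (inclLin K h) _)
  map_add' x y := map_add (((ideal Q S' K).restrictScalars K).liftQ (inclLin K h) _) x y
  map_mul' x y := by
    obtain ⟨x, rfl⟩ := cls_surjective x
    obtain ⟨y, rfl⟩ := cls_surjective y
    exact inclLin_mul h x y

lemma inclHom_cls (x : PathAlgebra K (Q.Vert S')) : inclHom h (cls x) = inclLin K h x := rfl

lemma inclHom_injective : Function.Injective (inclHom (K := K) h) := by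
  intro x y hxy
  obtain ⟨x, rfl⟩ := cls_surjective x
  obtain ⟨y, rfl⟩ := cls_surjective y
  rw [inclHom_cls, inclHom_cls, ← sub_eq_zero, ← map_sub, inclLin_eq_zero_iff] at hxy
  exact Ideal.Quotient.eq.mpr hxy

lemma inclHom_ev {v : Q.V} (hv : v ∈ S') : inclHom h (ev S' K v) = ev S K v := by
  rw [ev_eq_cls hv, ev_eq_cls (h hv), inclHom_cls, vertex, inclLin_ofPath]; rfl

lemma arrows_mono (h : S' ⊆ S) : Q.arrows S' ⊆ Q.arrows S := fun α hα => by
  rw [mem_arrows] at hα ⊢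
  exact ⟨h hα.1, h hα.2⟩

lemma inclHom_ar {α : Q.Arr} (hα : α ∈ Q.arrows S') : inclHom h (ar S' K α) = ar S K α := by
  rw [ar_eq_cls hα, ar_eq_cls (arrows_mono h hα), inclHom_cls, arrow, inclLin_ofPath]; rfl

lemma eSum_eq (h : S' ⊆ S) : (Q.bound S K).eSum {v | v.1 ∈ S'} = ∑ v ∈ S', ev S K v := by
  classical
  rw [BoundQuiver.eSum]
  have h1 : ∑ v : Q.Vert S with v ∈ {v : Q.Vert S | v.1 ∈ S'}, ev S K v.1 = ∑ v ∈ S', ev S K v := by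
    refine Finset.sum_bij (fun v _ => v.1) ?_ ?_ ?_ ?_
    · intro v hv; simpa using hv
    · intro v _ w _ e; exact Vert.ext e
    · intro v hv; exact ⟨⟨v, h hv⟩, by simpa using hv, rfl⟩
    · intros; rfl
  rw [← h1]
  refine Finset.sum_congr ?_ fun v _ => e_eq_ev K v
  ext v; simp

lemma inclHom_one : inclHom (K := K) h 1 = ∑ v ∈ S', ev S K v := by
  rw [one_eq_sum, map_sum]
  exact Finset.sum_congr rfl fun v hv => inclHom_ev h hv

open Classical in
lemma sum_ev_mul_ar (α : Q.Arr) :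
    (∑ v ∈ S', ev S K v) * ar S K α = if Q.tgt α ∈ S' then ar S K α else 0 := by
  rw [Finset.sum_mul]
  split_ifs with hα
  · rw [Finset.sum_eq_single_of_mem _ hα fun v _ hv => ev_mul_ar_of_ne hv, ev_tgt_mul_ar]
  · exact Finset.sum_eq_zero fun v hv => ev_mul_ar_of_ne fun e => hα (e ▸ hv)

open Classical in
lemma ar_mul_sum_ev (α : Q.Arr) :
    ar S K α * (∑ v ∈ S', ev S K v) = if Q.src α ∈ S' then ar S K α else 0 := by
  rw [Finset.mul_sum]
  split_ifs with hα
  · rw [Finset.sum_eq_single_of_mem _ hα fun v _ hv => ar_mul_ev_of_ne hv.symm, ar_mul_ev_src]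
  · exact Finset.sum_eq_zero fun v hv => ar_mul_ev_of_ne fun e => hα (e ▸ hv)

lemma range_inclHom (h : S' ⊆ S) (hr : ∀ α ∈ Q.arrows S, ∀ β ∈ Q.arrows S, ∀ q, Q.Rel β α q →
    Q.src α ∈ S' → Q.tgt β ∈ S' → Q.tgt α ∈ S') :
    Set.range (inclHom (K := K) h) =
      {x | ∃ y, x = (∑ v ∈ S', ev S K v) * y * ∑ v ∈ S', ev S K v} := by
  classical
  rw [← inclHom_one h]
  ext x
  constructor
  · rintro ⟨w, rfl⟩
    exact ⟨inclHom h w, by rw [← map_mul, ← map_mul, one_mul, mul_one]⟩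
  · rintro ⟨y, rfl⟩
    obtain ⟨e, he⟩ : ∃ e, e = inclHom (K := K) h 1 := ⟨_, rfl⟩
    have he' : e = ∑ v ∈ S', ev S K v := he.trans (inclHom_one h)
    rw [← he]
    let R : Submodule K (Q.Alg S K) :=
      { carrier := Set.range (inclHom (K := K) h)
        add_mem' := by rintro _ _ ⟨x, rfl⟩ ⟨y, rfl⟩; exact ⟨x + y, map_add _ _ _⟩
        zero_mem' := ⟨0, map_zero _⟩
        smul_mem' := by rintro k _ ⟨x, rfl⟩; exact ⟨k • x, map_smul _ _ _⟩ }
    have hev : ∀ v ∈ S, e * ev S K v * e ∈ R := by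
      intro v hv
      by_cases hv' : v ∈ S'
      · have h1 : ev S K v = inclHom h (ev S' K v) := (inclHom_ev h hv').symm
        refine ⟨ev S' K v, ?_⟩
        rw [he, h1, ← map_mul, ← map_mul, one_mul, mul_one]
      · have : e * ev S K v = 0 := by
          rw [he', Finset.sum_mul]
          exact Finset.sum_eq_zero fun w hw => ev_mul_ev_of_ne fun e => hv' (e ▸ hw)
        rw [this, zero_mul]; exact R.zero_mem
    have har : ∀ α ∈ Q.arrows S, e * ar S K α * e ∈ R := by
      intro α hα
      rw [he', sum_ev_mul_ar]
      split_ifs with h1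
      · rw [ar_mul_sum_ev]
        split_ifs with h2
        · exact ⟨ar S' K α, inclHom_ar h (mem_arrows.mpr ⟨h2, h1⟩)⟩
        · exact R.zero_mem
      · rw [zero_mul]; exact R.zero_mem
    have hpa : ∀ α ∈ Q.arrows S, ∀ β ∈ Q.arrows S, e * (ar S K α * ar S K β) * e ∈ R := by
      intro β hβ α hα
      rw [he', ← mul_assoc, sum_ev_mul_ar]
      split_ifs with h1
      · rw [mul_assoc, ar_mul_sum_ev]
        split_ifs with h2
        · by_cases h3 : ∃ q, Q.Rel β α q
          · obtain ⟨q, hq⟩ := h3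
            have h4 := hr α hα β hβ q hq h2 h1
            refine ⟨ar S' K β * ar S' K α, ?_⟩
            rw [map_mul, inclHom_ar h (mem_arrows.mpr ⟨h2, h4⟩),
              inclHom_ar h (mem_arrows.mpr ⟨Q.rel_comp hq ▸ h4, h1⟩)]
          · rw [ar_mul_ar_eq_zero (not_exists.mp h3)]; exact R.zero_mem
        · rw [mul_zero]; exact R.zero_mem
      · rw [zero_mul, zero_mul]; exact R.zero_mem
    change e * y * e ∈ R
    obtain ⟨f, hf⟩ := exists_decomp y
    rw [hf, mul_add, add_mul, Finset.mul_sum, Finset.mul_sum, Finset.sum_mul, Finset.sum_mul]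
    refine R.add_mem (sum_mem fun v hv => ?_) (sum_mem fun α hα => ?_)
    · rw [mul_smul_comm, smul_mul_assoc]; exact R.smul_mem _ (hev v hv)
    · obtain ⟨g, hg⟩ := ar_mul_eq α (f α)
      rw [hg, mul_add, add_mul, Finset.mul_sum, Finset.sum_mul]
      refine R.add_mem ?_ (sum_mem fun β hβ => ?_)
      · rw [mul_smul_comm, smul_mul_assoc]; exact R.smul_mem _ (har α hα)
      · obtain ⟨k, hk⟩ := ar_mul_eq β (g β)
        rw [hk, mul_add, Finset.mul_sum, Finset.sum_eq_zero, add_zero]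
        · rw [mul_smul_comm, mul_smul_comm, smul_mul_assoc]
          exact R.smul_mem _ (hpa α hα β hβ)
        · intro γ _
          rw [← mul_assoc (ar S K β), ← mul_assoc, ar_mul_ar_mul_ar, zero_mul]

/-- If every path of length two between vertices of `S'` with nonzero residue class runs inside
`S'`, then the algebra of the full subquiver on `S'` is a corner. -/
lemma isCorner_bound (h : S' ⊆ S) (hr : ∀ α ∈ Q.arrows S, ∀ β ∈ Q.arrows S, ∀ q, Q.Rel β α q →
    Q.src α ∈ S' → Q.tgt β ∈ S' → Q.tgt α ∈ S') :
    (Q.bound S K).IsCorner {v | v.1 ∈ S'} (Q.bound S' K) := by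
  classical
  refine ⟨incl h, fun a b => Equiv.refl _, inclHom h, ?_, inclHom_injective h, ?_, ?_, ?_⟩
  · ext v
    exact ⟨by rintro ⟨w, rfl⟩; exact w.2, fun hv => ⟨⟨v.1, hv⟩, rfl⟩⟩
  · rw [eSum_eq h]
    exact range_inclHom h hr
  · intro v
    exact (congrArg _ (e_eq_ev K v)).trans ((inclHom_ev h v.2).trans (e_eq_ev K (incl h v)).symm)
  · intro a b α
    have h1 := arr_eq_ar K (a := incl h a) (b := incl h b) α
    exact (congrArg _ (arr_eq_ar K α)).trans ((inclHom_ar h (hom_mem_arrows α)).trans h1.symm)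

end Corner

/-- The algebra of the full subquiver on `S' ∪ S''` is a 2-stack if no arrow leads from `S'` to
`S''`, and arrows from `S''` to `S'` are preceded only by arrows that start in sources. -/
lemma isTwoStack_bound (hS : ∀ v, v ∈ S ↔ v ∈ S' ∨ v ∈ S'') (hdisj : ∀ v ∈ S', v ∉ S'')
    (hne' : S'.Nonempty) (hne'' : S''.Nonempty)
    (hcl : ∀ α ∈ Q.arrows S, Q.src α ∈ S' → Q.tgt α ∈ S')
    (hsrc : ∀ β α q, Q.Rel β α q → Q.src β ∈ S'' → Q.tgt β ∈ S' →
      ∀ γ ∈ Q.arrows S, Q.tgt γ ≠ Q.src α) :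
    (Q.bound S K).IsTwoStack (Q.bound S'' K) (Q.bound S' K) := by
  have h' : S' ⊆ S := fun v hv => (hS v).mpr (Or.inl hv)
  have h'' : S'' ⊆ S := fun v hv => (hS v).mpr (Or.inr hv)
  refine ⟨{v | v.1 ∈ S'}, ⟨?_, ?_⟩, ?_, ?_, ?_, ?_⟩
  · intro a b α ha
    have h1 := hcl α.1 (hom_mem_arrows α) (by rw [α.2.1]; exact ha)
    rw [α.2.2] at h1
    exact h1
  · intro a b c d β α ha hb hβα w
    refine ⟨fun γ => hβα ?_⟩
    have ha' : Q.src β.1 ∈ S'' := by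
      rw [β.2.1]; exact ((hS _).mp a.2).resolve_left ha
    have hb' : Q.tgt β.1 ∈ S' := by rw [β.2.2]; exact hb
    have h0 : ∀ q, ¬ Q.Rel β.1 α.1 q := fun q hq => by
      refine hsrc _ _ q hq ha' hb' γ.1 (hom_mem_arrows γ) ?_
      rw [γ.2.2, α.2.1]
    have h1 := ar_mul_ar_eq_zero (S := S) (K := K) h0
    rw [← arr_eq_ar K β, ← arr_eq_ar K α] at h1
    exact Ideal.Quotient.eq_zero_iff_mem.mp h1
  · obtain ⟨v, hv⟩ := hne'
    exact ⟨⟨v, h' hv⟩, hv⟩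
  · obtain ⟨v, hv⟩ := hne''
    exact ⟨⟨v, h'' hv⟩, fun hv' => hdisj v hv' hv⟩
  · exact isCorner_bound h' fun α hα β _ q _ hs _ => hcl α hα hs
  · have e : ({v : Q.Vert S | v.1 ∈ S'}ᶜ : Set (Q.Vert S)) = {v | v.1 ∈ S''} := by
      ext v
      refine ⟨fun hv => ((hS _).mp v.2).resolve_left hv, fun hv hv' => hdisj _ hv' hv⟩
    rw [e]
    refine isCorner_bound h'' fun α hα β hβ q hq _ ht => ?_
    refine ((hS _).mp (mem_arrows.mp hα).2).resolve_left fun hα' => ?_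
    exact hdisj _ (hcl β hβ (Q.rel_comp hq ▸ hα')) ht

end QuadraticTable

/-! ### The quiver and its table -/

/-- The numbers that govern the quiver: `bot` and `top` are the extreme values of the function to
be realized, and `N L` is the least number of generators for which it reaches the value `L`; this
is `0` if there is nothing to reach, that is, for `L ≤ bot`. -/
structure Profile where
  /-- the smallest value -/
  bot : ℕ
  /-- the largest value -/
  top : ℕ
  /-- the threshold of a level -/
  N : ℕ → ℕ
  one_le_bot : 1 ≤ bot
  bot_le_top : bot ≤ top
  mono : Monotone N
  N_eq_zero : ∀ L ≤ bot, N L = 0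

/-- The vertices: a vertex `z` with a loop, and, in the level `L`, the vertex `a L` and further
vertices `x L j`. -/
inductive Vtx
  | z
  | a (L : ℕ)
  | x (L j : ℕ)
  deriving DecidableEq

namespace Profile

variable (P : Profile)

/-- The index of the vertex in level `L` that serves the `i`-th generator: all generators below
the threshold share the vertex with index `0`. -/
def cl (L i : ℕ) : ℕ := if i < P.N L then 0 else i

lemma cl_of_lt {L i : ℕ} (h : i < P.N L) : P.cl L i = 0 := if_pos h
lemma cl_of_le {L i : ℕ} (h : P.N L ≤ i) : P.cl L i = i := if_neg (not_lt.mpr h)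

/-- The arrows; their ends are given by `Profile.src` and `Profile.tgt`. The arrows `lam`, `phiA`,
`phiX` and `zeta` end in `z` and serve to exclude modules of finite projective dimension; the
projective resolutions run along the arrows `rhoA`, `rho`, `sig` and `the`, which lead to the next
lower level. -/
inductive Arr
  | lam
  | phiA (L : ℕ) (h : P.bot ≤ L)
  | phiX (L j : ℕ)
  | zeta (L j : ℕ)
  | rhoA (L : ℕ)
  | rho (L i : ℕ)
  | sig (L j : ℕ)
  | the (L i : ℕ) (h : P.N (L + 1) ≤ i)

/-- The basis in degree two; its elements are the residue classes described by `Profile.Rel`. -/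
inductive Deg
  | betA (L : ℕ)
  | bet (L i : ℕ)
  | om (L : ℕ)
  | tau (L i : ℕ)
  | kap (L i j : ℕ)

open Vtx Arr Deg

variable {P}

/-- The vertex in which an arrow starts. -/
def src : P.Arr → Vtx
  | lam => z
  | phiA L _ => a L
  | phiX L j => x L j
  | zeta L j => x L j
  | rhoA L => a (L + 1)
  | rho L _ => a (L + 1)
  | sig L _ => x (L + 1) 0
  | the L i _ => x (L + 1) i

/-- The vertex in which an arrow ends. -/
def tgt : P.Arr → Vtx
  | lam => z
  | phiA _ _ => z
  | phiX _ _ => z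
  | zeta _ _ => z
  | rhoA L => a L
  | rho L i => x L (P.cl L i)
  | sig L j => x L j
  | the L _ _ => a L

/-- The vertex in which the paths of length two at a basis element start. -/
def start : Deg → Vtx
  | betA L => a (L + 1)
  | bet L _ => a (L + 1)
  | om L => x (L + 1) 0
  | tau L _ => a (L + 2)
  | kap L _ _ => a (L + 2)

/-- The vertex in which the paths of length two at a basis element end. -/
def finish : Deg → Vtx
  | betA _ => z
  | bet _ _ => z
  | om _ => z
  | tau L _ => a L
  | kap L _ j => x L j

/-- The pairs of arrows whose composition has coefficient one at a given basis element. Thus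
`rhoA L * rhoA (L + 1)` is the sum of the `the L i * rho (L + 1) i`, the paths
`rho L i * rhoA (L + 1)` and `sig L j * rho (L + 1) i` with `j = cl L i` agree, and the paths
`zeta L j * sig L j` with different `j` agree. -/
inductive Rel : P.Arr → P.Arr → Deg → Prop
  | betA (L : ℕ) (h) : Rel (phiA L h) (rhoA L) (betA L)
  | bet (L i j : ℕ) (hj : P.cl L i = j) : Rel (phiX L j) (rho L i) (bet L i)
  | om (L j : ℕ) : Rel (zeta L j) (sig L j) (om L)
  | tau_the (L i : ℕ) (h) : Rel (the L i h) (rho (L + 1) i) (tau L i)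
  | tau_rhoA (L i : ℕ) (h₁ : P.N (L + 1) ≤ i) (h₂ : i < P.N (L + 2)) :
      Rel (rhoA L) (rhoA (L + 1)) (tau L i)
  | kap_sig (L i j : ℕ) (h : i < P.N (L + 1)) : Rel (sig L j) (rho (L + 1) i) (kap L i j)
  | kap_rho (L i j : ℕ) (h : i < P.N (L + 1)) (hj : P.cl L i = j) :
      Rel (rho L i) (rhoA (L + 1)) (kap L i j)

/-- The level of a vertex. -/
def lev : Vtx → ℕ
  | z => 0
  | a L => L
  | x L _ => L

/-- A number that distinguishes the parallel arrows. -/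
def code : P.Arr → ℕ
  | phiX _ _ => 1
  | rhoA _ => 0
  | rho _ i => i + 1
  | _ => 0

lemma finite_hom (v w : Vtx) : Finite {α : P.Arr // src α = v ∧ tgt α = w} := by
  obtain ⟨b, hb⟩ : ∃ b, ∀ α : {α : P.Arr // src α = v ∧ tgt α = w}, code α.1 < b := by
    refine ⟨P.N (lev w) + (match w with | x _ j => j | _ => 0) + 2, ?_⟩
    rintro ⟨α, rfl, rfl⟩
    cases α <;> simp only [code, tgt, lev] <;> try omega
    rename_i L i
    rcases lt_or_ge i (P.N L) with h | h
    · omega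
    · rw [P.cl_of_le h]; omega
  refine Finite.of_injective (β := Fin b) (fun α => ⟨code α.1, hb α⟩) ?_
  rintro ⟨α, h1, h2⟩ ⟨β, h3, h4⟩ h
  simp only [Fin.mk.injEq] at h
  refine Subtype.ext ?_
  change α = β
  subst h1 h2
  cases α <;> cases β <;> simp_all [src, tgt, code]

lemma Rel.tgt_eq {β α : P.Arr} {q : Deg} (h : Rel β α q) : tgt α = src β := by
  cases h with
  | tau_the L i h => simp only [src, tgt, P.cl_of_le h]
  | kap_sig L i j h => simp only [src, tgt, P.cl_of_lt h]
  | bet L i j hj => simp only [src, tgt, hj]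
  | _ => rfl

lemma Rel.finish_eq {β α : P.Arr} {q : Deg} (h : Rel β α q) : tgt β = finish q := by
  cases h <;> simp only [finish, tgt]
  rw [‹P.cl _ _ = _›]

lemma Rel.left_unique {β α α' : P.Arr} {q : Deg} (h : Rel β α q) (h' : Rel β α' q) :
    α = α' := by
  cases h <;> cases h' <;> rfl

lemma Rel.right_unique {β β' α : P.Arr} {q : Deg} (h : Rel β α q) (h' : Rel β' α q) :
    β = β' := by
  cases h <;> cases h' <;> simp_all

variable (P) in
/-- The table of the paths of length two. -/
abbrev table : QuadraticTable where
  V := Vtx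
  Arr := P.Arr
  D := Deg
  src := src
  tgt := tgt
  start := start
  finish := finish
  Rel := Rel
  rel_comp := Rel.tgt_eq
  rel_start := by rintro _ _ _ ⟨⟩ <;> rfl
  rel_finish := Rel.finish_eq
  left_unique := Rel.left_unique
  right_unique := Rel.right_unique
  finite := finite_hom

variable (P)

/-- The vertices in a finite set of levels. In level `L` these are `a L` and the vertices
`x L (cl L i)` with `i < N (L + 1)`. -/
def levelVerts (T : Finset ℕ) : Finset Vtx :=
  T.biUnion fun L => insert (a L)
    (((Finset.range (P.N (L + 1))).filter fun j => j = 0 ∨ P.N L ≤ j).image (x L))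

/-- The vertices in a finite set of levels, and the vertex `z`. -/
def baseVerts (T : Finset ℕ) : Finset Vtx := insert z (P.levelVerts T)

/-- All vertices of the quiver. -/
def verts : Finset Vtx := P.baseVerts (Finset.range (P.top + 1))

variable {P}

@[simp] lemma z_notMem_levelVerts (T : Finset ℕ) : z ∉ P.levelVerts T := by simp [levelVerts]
@[simp] lemma a_mem_levelVerts {T : Finset ℕ} {L : ℕ} : a L ∈ P.levelVerts T ↔ L ∈ T := by
  simp [levelVerts]
@[simp] lemma x_mem_levelVerts {T : Finset ℕ} {L j : ℕ} : x L j ∈ P.levelVerts T ↔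
    L ∈ T ∧ j < P.N (L + 1) ∧ (j = 0 ∨ P.N L ≤ j) := by
  simp only [levelVerts, Finset.mem_biUnion, Finset.mem_insert, reduceCtorEq, Finset.mem_image,
    Finset.mem_filter, Finset.mem_range, x.injEq, false_or]
  constructor
  · rintro ⟨L, h, j, h2, rfl, rfl⟩; exact ⟨h, h2⟩
  · rintro ⟨h, h2⟩; exact ⟨L, h, j, h2, rfl, rfl⟩
@[simp] lemma z_mem_baseVerts (T : Finset ℕ) : z ∈ P.baseVerts T := by simp [baseVerts]
@[simp] lemma a_mem_baseVerts {T : Finset ℕ} {L : ℕ} : a L ∈ P.baseVerts T ↔ L ∈ T := by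
  simp [baseVerts]
@[simp] lemma x_mem_baseVerts {T : Finset ℕ} {L j : ℕ} : x L j ∈ P.baseVerts T ↔
    L ∈ T ∧ j < P.N (L + 1) ∧ (j = 0 ∨ P.N L ≤ j) := by
  simp [baseVerts]
@[simp] lemma z_mem_verts : z ∈ P.verts := z_mem_baseVerts _
@[simp] lemma a_mem_verts {L : ℕ} : a L ∈ P.verts ↔ L ≤ P.top := by
  simp [verts]
@[simp] lemma x_mem_verts {L j : ℕ} : x L j ∈ P.verts ↔
    L ≤ P.top ∧ j < P.N (L + 1) ∧ (j = 0 ∨ P.N L ≤ j) := by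
  simp [verts]

/-- The vertex that serves the `i`-th generator exists if `i` is below the next threshold. -/
lemma x_cl_mem_verts {L i : ℕ} (hL : L ≤ P.top) (hi : i < P.N (L + 1)) :
    x L (P.cl L i) ∈ P.verts := by
  rw [x_mem_verts]
  rcases lt_or_ge i (P.N L) with h | h
  · rw [P.cl_of_lt h]; exact ⟨hL, by omega, Or.inl rfl⟩
  · rw [P.cl_of_le h]; exact ⟨hL, hi, Or.inr h⟩

lemma lev_src {γ : P.Arr} (h : tgt γ ≠ z) : lev (src γ) = lev (tgt γ) + 1 ∧ src γ ≠ z := by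
  cases γ <;> simp_all [src, tgt, lev]

lemma lev_of_rel {β α : P.Arr} {q : Deg} (h : Rel β α q) :
    lev (src α) = lev (src β) + 1 ∧ src α ≠ z := by
  cases h <;> simp [src, lev]

lemma mem_levelVerts_iff {T : Finset ℕ} {v : Vtx} :
    v ∈ P.levelVerts T ↔ v ≠ z ∧ lev v ∈ T ∧
      ∀ L j, v = x L j → j < P.N (L + 1) ∧ (j = 0 ∨ P.N L ≤ j) := by
  cases v <;> simp [lev]

lemma mem_baseVerts_iff {T : Finset ℕ} {v : Vtx} :
    v ∈ P.baseVerts T ↔ v = z ∨ v ∈ P.levelVerts T := by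
  simp [baseVerts]

/-! ### The stack and connectedness -/

/-- Two consecutive levels give a monomial algebra. -/
lemma isMonomial_levelVerts (K : Type u) [Field K] {T : Finset ℕ} (m : ℕ)
    (hT : ∀ L ∈ T, L = m ∨ L = m + 1) : (P.table.bound (P.levelVerts T) K).IsMonomial := by
  refine QuadraticTable.isMonomial_bound fun α hα β hβ q hr => ?_
  have h1 := (QuadraticTable.mem_arrows.mp hα).1
  have h2 := (QuadraticTable.mem_arrows.mp hβ).2
  have h3 := (QuadraticTable.mem_arrows.mp hβ).1
  have h4 := (lev_of_rel hr).1
  have h5 : tgt β ≠ z := (mem_levelVerts_iff.mp h2).1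
  have h6 := (lev_src h5).1
  have h7 := hT _ (mem_levelVerts_iff.mp h1).2.1
  have h8 := hT _ (mem_levelVerts_iff.mp h2).2.1
  dsimp only [table] at h7 h8
  omega

/-- The levels up to `bot` give a monomial algebra. -/
lemma isMonomial_baseVerts (K : Type u) [Field K] :
    (P.table.bound (P.baseVerts (Finset.range (P.bot + 1))) K).IsMonomial := by
  refine QuadraticTable.isMonomial_bound fun α hα β hβ q hr => ?_
  have h1 := (QuadraticTable.mem_arrows.mp hα).1
  have h3 := (QuadraticTable.mem_arrows.mp hα).2
  have h2 := (QuadraticTable.mem_arrows.mp hβ).1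
  have hN : ∀ L ≤ P.bot, P.N L = 0 := P.N_eq_zero
  have hx : ∀ L j, x L j ∈ P.baseVerts (Finset.range (P.bot + 1)) → P.bot ≤ L := by
    intro L j h
    rw [x_mem_baseVerts, Finset.mem_range] at h
    by_contra h'
    have := hN (L + 1) (by omega)
    omega
  cases hr with
  | betA L h => replace h1 := Finset.mem_range.mp (a_mem_baseVerts.mp h1); omega
  | bet L i j hj =>
    have := hx _ _ h3
    replace h1 := Finset.mem_range.mp (a_mem_baseVerts.mp h1); omega
  | om L j =>
    have := hx _ _ h3
    replace h1 := Finset.mem_range.mp (x_mem_baseVerts.mp h1).1; omega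
  | tau_the L i h =>
    have := hx _ _ h3
    replace h1 := Finset.mem_range.mp (a_mem_baseVerts.mp h1); omega
  | tau_rhoA L i h h' =>
    replace h1 := Finset.mem_range.mp (a_mem_baseVerts.mp h1)
    have := hN (L + 2) (by omega)
    omega
  | kap_sig L i j h =>
    have := hx _ _ h3
    replace h1 := Finset.mem_range.mp (a_mem_baseVerts.mp h1); omega
  | kap_rho L i j h hj =>
    replace h1 := Finset.mem_range.mp (a_mem_baseVerts.mp h1)
    have := hN (L + 1) (by omega)
    omega

/-- Adding one or two levels on top gives a 2-stack. -/
lemma isTwoStack_baseVerts (K : Type u) [Field K] {m m' : ℕ} (h₁ : m < m') (h₂ : m' ≤ m + 2) :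
    (P.table.bound (P.baseVerts (Finset.range (m' + 1))) K).IsTwoStack
      (P.table.bound (P.levelVerts (Finset.Icc (m + 1) m')) K)
      (P.table.bound (P.baseVerts (Finset.range (m + 1))) K) := by
  refine QuadraticTable.isTwoStack_bound ?_ ?_ ⟨z, by simp⟩ ⟨a m', by simp; omega⟩ ?_ ?_
  · intro v
    simp only [mem_baseVerts_iff, mem_levelVerts_iff, Finset.mem_range, Finset.mem_Icc]
    constructor
    · rintro (h | ⟨h1, h2, h3⟩)
      · exact Or.inl (Or.inl h)
      · rcases lt_or_ge (lev v) (m + 1) with h | h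
        · exact Or.inl (Or.inr ⟨h1, h, h3⟩)
        · exact Or.inr ⟨h1, ⟨h, by omega⟩, h3⟩
    · rintro ((h | ⟨h1, h2, h3⟩) | ⟨h1, h2, h3⟩)
      · exact Or.inl h
      · exact Or.inr ⟨h1, by omega, h3⟩
      · exact Or.inr ⟨h1, by omega, h3⟩
  · intro v
    simp only [mem_baseVerts_iff, mem_levelVerts_iff, Finset.mem_range, Finset.mem_Icc]
    rintro (h | ⟨h1, h2, h3⟩) ⟨h4, h5, -⟩
    · exact h4 h
    · omega
  · intro γ hγ hs
    have ht := (QuadraticTable.mem_arrows.mp hγ).2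
    simp only [mem_baseVerts_iff, mem_levelVerts_iff, Finset.mem_range] at hs ht ⊢
    by_cases hz : tgt γ = z
    · exact Or.inl hz
    · have h1 := lev_src hz
      rcases ht with h | ⟨h2, h3, h4⟩
      · exact Or.inl h
      rcases hs with h | ⟨-, h5, -⟩
      · exact absurd h h1.2
      · exact Or.inr ⟨h2, by dsimp only [table] at *; omega, h4⟩
  · intro β α q hr hs _ γ hγ he
    have h1 := lev_of_rel hr
    have h2 := (QuadraticTable.mem_arrows.mp hγ).1
    have h3 := lev_src (γ := γ) (by dsimp only [table] at he; rw [he]; exact h1.2)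
    simp only [mem_baseVerts_iff, mem_levelVerts_iff, Finset.mem_range, Finset.mem_Icc] at hs h2
    have h4 := h2.resolve_left h3.2
    dsimp only [table] at *
    rw [he] at h3
    omega

lemma isStack_verts (K : Type u) [Field K] (c : ℕ) (hc : P.top ≤ P.bot + 2 * c)
    (hc' : P.bot + 2 * c ≤ P.top + 1) :
    ∃ Δ : Fin (c + 1) → BoundQuiver K, (∀ i, (Δ i).IsMonomial) ∧
      (P.table.bound P.verts K).IsStack c Δ := by
  let lv : ℕ → ℕ := fun i => min (P.bot + 2 * i) P.top
  refine ⟨fun i => if i = 0 then P.table.bound (P.baseVerts (Finset.range (P.bot + 1))) K else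
    P.table.bound (P.levelVerts (Finset.Icc (lv (i.1 - 1) + 1) (lv i.1))) K, fun i => ?_,
    fun i => P.table.bound (P.baseVerts (Finset.range (lv i.1 + 1))) K, ?_, ?_, fun i => ?_⟩
  · dsimp only
    split_ifs with h
    · exact isMonomial_baseVerts K
    · refine isMonomial_levelVerts K (lv (i.1 - 1) + 1) fun L hL => ?_
      simp only [Finset.mem_Icc, lv] at hL ⊢
      omega
  · have : lv ((0 : Fin (c + 1)) : ℕ) = P.bot := by
      have := P.bot_le_top
      simp [lv, this]
    simp only [this, if_pos]
  · have : lv ((Fin.last c : Fin (c + 1)) : ℕ) = P.top := by simp [lv, hc]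
    simp only [this, verts]
  · have h : (i.succ : Fin (c + 1)) ≠ 0 := Fin.succ_ne_zero i
    simp only [if_neg h, Fin.val_succ, Fin.val_castSucc, Nat.add_sub_cancel]
    have := i.2
    refine isTwoStack_baseVerts K ?_ ?_ <;> simp only [lv] <;> omega

lemma mem_arrows_verts {γ : P.Arr} :
    γ ∈ P.table.arrows P.verts ↔ src γ ∈ P.verts ∧ tgt γ ∈ P.verts := QuadraticTable.mem_arrows

lemma isConnectedRing_verts (K : Type u) [Field K] :
    IsConnectedRing (P.table.Alg P.verts K) := by
  refine QuadraticTable.isConnectedRing (v₀ := z) z_mem_verts fun v hv => ?_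
  have edge : ∀ γ : P.Arr, src γ ∈ P.verts → tgt γ ∈ P.verts → Relation.EqvGen
      (fun a b => ∃ α ∈ P.table.arrows P.verts, P.table.src α = a ∧ P.table.tgt α = b)
      (src γ) (tgt γ) := fun γ h1 h2 => .rel _ _ ⟨γ, mem_arrows_verts.mpr ⟨h1, h2⟩, rfl, rfl⟩
  cases v with
  | z => exact .refl _
  | x L j => exact edge (phiX L j) hv z_mem_verts
  | a L =>
    rw [a_mem_verts] at hv
    rcases le_total P.bot L with h | h
    · exact edge (phiA L h) (by simpa [src] using hv) z_mem_verts
    · induction h using Nat.decreasingInduction with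
      | self => exact edge (phiA _ le_rfl) (by simpa [src] using hv) z_mem_verts
      | of_succ L hL ih =>
        have := P.bot_le_top
        exact .trans _ _ _ (.symm _ _ (edge (rhoA L) (a_mem_verts.mpr (by omega))
          (a_mem_verts.mpr (by omega)))) (ih (by omega))

end Profile

/-! ### Dimension shifting -/

section

open CategoryTheory

variable {R : Type u} [Ring R] {N N' : Type u} [AddCommGroup N] [Module R N] [AddCommGroup N']
  [Module R N']

lemma hasProjectiveDimensionLT_congr (e : N ≃ₗ[R] N') (n : ℕ) :
    HasProjectiveDimensionLT (ModuleCat.of R N) n ↔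
      HasProjectiveDimensionLT (ModuleCat.of R N') n :=
  ⟨fun _ => hasProjectiveDimensionLT_of_iso e.toModuleIso n,
    fun _ => hasProjectiveDimensionLT_of_iso e.toModuleIso.symm n⟩

lemma hasProjectiveDimensionLT_succ_of_ker [Module.Projective R N] (f : N →ₗ[R] N')
    (hf : Function.Surjective f) {n : ℕ}
    (h : HasProjectiveDimensionLT (ModuleCat.of R (LinearMap.ker f)) n) :
    HasProjectiveDimensionLT (ModuleCat.of R N') (n + 1) := by
  have hP : HasProjectiveDimensionLT (ModuleCat.of R N) (n + 1) :=
    @hasProjectiveDimensionLT_of_ge _ _ _ _ 1 (n + 1) (by omega)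
      ((projective_iff_hasProjectiveDimensionLT_one).mp
        ((IsProjective.iff_projective N).mp inferInstance))
  exact (LinearMap.shortExact_shortComplexKer hf).hasProjectiveDimensionLT_X₃ n h hP

lemma hasProjectiveDimensionLT_ker_of_succ [Module.Projective R N] (f : N →ₗ[R] N')
    (hf : Function.Surjective f) {n : ℕ}
    (h : HasProjectiveDimensionLT (ModuleCat.of R N') (n + 2)) :
    HasProjectiveDimensionLT (ModuleCat.of R (LinearMap.ker f)) (n + 1) :=
  ((LinearMap.shortExact_shortComplexKer hf).hasProjectiveDimensionLT_X₃_iff n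
    ((IsProjective.iff_projective N).mp inferInstance)).mp h

end

namespace QuadraticTable

variable {Q : QuadraticTable} {S : Finset Q.V} {K : Type u} [Field K]

/-! ### Projective covers -/

section Modules

variable {N : Type u} [AddCommGroup N] [Module (Q.Alg S K) N]

variable (Q S K N) in
/-- The radical `JN` of a module. -/
abbrev rad : Submodule (Q.Alg S K) N := Ring.jacobson (Q.Alg S K) • ⊤

lemma smul_mem_rad {x : Q.Alg S K} (hx : x ∈ arrowIdeal Q S K) (n : N) : x • n ∈ rad Q S K N :=
  Submodule.smul_mem_smul (by rw [jacobson_eq]; exact hx) trivial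

lemma ar_smul_mem_rad (α : Q.Arr) (n : N) : ar S K α • n ∈ rad Q S K N :=
  smul_mem_rad (ar_mem_arrowIdeal α) n

lemma mem_rad {n : N} : n ∈ rad Q S K N ↔
    ∃ l : Q.Arr → N, n = ∑ α ∈ Q.arrows S, ar S K α • l α := by
  constructor
  · intro hn
    refine Submodule.smul_induction_on hn ?_ ?_
    · intro x hx m _
      rw [jacobson_eq] at hx
      obtain ⟨y, hy⟩ := exists_decomp_of_eps x hx
      refine ⟨fun α => y α • m, ?_⟩
      conv_lhs => rw [hy]
      rw [Finset.sum_smul]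
      simp only [mul_smul]
    · rintro _ _ ⟨l, rfl⟩ ⟨l', rfl⟩
      exact ⟨l + l', by simp [Finset.sum_add_distrib]⟩
  · rintro ⟨l, rfl⟩
    exact sum_mem fun α _ => ar_smul_mem_rad α _

/-- Nakayama's lemma; finite generation is not needed since the radical is nilpotent. -/
lemma eq_top_of_sup_rad {N' : Submodule (Q.Alg S K) N} (h : N' ⊔ rad Q S K N = ⊤) : N' = ⊤ := by
  have key : ∀ k : ℕ, N' ⊔ (Ring.jacobson (Q.Alg S K) ^ k) • (⊤ : Submodule _ N) = ⊤ := by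
    intro k
    induction k with
    | zero => rw [Submodule.pow_zero, Submodule.one_smul, sup_top_eq]
    | succ k ih =>
      refine eq_top_iff.mpr (ih.symm.le.trans (sup_le le_sup_left ?_))
      have h1 : (Ring.jacobson (Q.Alg S K) ^ k) • (⊤ : Submodule _ N) =
          (Ring.jacobson (Q.Alg S K) ^ k) • N' ⊔ (Ring.jacobson (Q.Alg S K) ^ (k + 1)) • ⊤ := by
        conv_lhs => rw [← h]
        rw [Submodule.smul_sup, ← Submodule.smul_assoc, smul_eq_mul, ← Submodule.pow_succ]
      rw [h1]
      exact sup_le (Submodule.smul_le_right.trans le_sup_left) le_sup_right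
  have := key 3
  rwa [jacobson_pow_three, Submodule.bot_smul, sup_bot_eq] at this

lemma eq_zero_of_mem_rad (h : ∀ n : N, n ∈ rad Q S K N) (n : N) : n = 0 := by
  have : (⊥ : Submodule (Q.Alg S K) N) = ⊤ :=
    eq_top_of_sup_rad (by rw [bot_sup_eq]; exact eq_top_iff.mpr fun n _ => h n)
  exact (Submodule.mem_bot _).mp (this ▸ trivial : n ∈ (⊥ : Submodule (Q.Alg S K) N))

lemma eq_sum_ev_smul (n : N) : n = ∑ w ∈ S, ev S K w • n := by
  rw [← Finset.sum_smul, ← one_eq_sum, one_smul]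

variable {N' : Type u} [AddCommGroup N']
  [Module (Q.Alg S K) N']

/-- An epimorphism onto a projective module whose kernel lies in the radical is injective. -/
lemma ker_eq_bot_of_projective [Module.Projective (Q.Alg S K) N'] (f : N →ₗ[Q.Alg S K] N')
    (hf : Function.Surjective f) (h : LinearMap.ker f ≤ rad Q S K N) : LinearMap.ker f = ⊥ := by
  obtain ⟨s, hs⟩ := Module.projective_lifting_property f LinearMap.id hf
  have hs' : ∀ n, f (s n) = n := fun n => LinearMap.congr_fun hs n
  let r : N →ₗ[Q.Alg S K] LinearMap.ker f :=
    (LinearMap.id - s ∘ₗ f).codRestrict _ fun p => by simp [LinearMap.mem_ker, hs']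
  have hr : ∀ x : LinearMap.ker f, r x.1 = x := fun x => Subtype.ext (by
    change x.1 - s (f x.1) = x.1
    rw [LinearMap.mem_ker.mp x.2, map_zero, sub_zero])
  have h0 := eq_zero_of_mem_rad (S := S) (K := K) (N := LinearMap.ker f) fun x => by
    obtain ⟨l, hl⟩ := mem_rad.mp (h x.2)
    rw [← hr x, hl, map_sum]
    refine sum_mem fun α _ => ?_
    rw [map_smul]
    exact ar_smul_mem_rad α _
  exact (Submodule.eq_bot_iff _).mpr fun x hx => congrArg Subtype.val (h0 ⟨x, hx⟩)

end Modules

section Free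

variable (S K)

/-- The direct sum of the projective modules `Λ e`, where `e` runs through the idempotents at the
vertices `v b`, as a submodule of a free module. -/
def projSubmodule {ι : Type u} (v : ι → Q.V) : Submodule (Q.Alg S K) (ι →₀ Q.Alg S K) where
  carrier := {p | ∀ b, p b * ev S K (v b) = p b}
  add_mem' hp hq b := by rw [Finsupp.add_apply, add_mul, hp b, hq b]
  zero_mem' b := by simp
  smul_mem' c p hp b := by rw [Finsupp.smul_apply, smul_eq_mul, mul_assoc, hp b]

/-- The direct sum of the projective modules `Λ e`, where `e` runs through the idempotents at the
vertices `v b`. -/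
def Pr {ι : Type u} (v : ι → Q.V) : Type u := projSubmodule S K v

variable {ι : Type u} {v : ι → Q.V}

instance : AddCommGroup (Pr S K v) := inferInstanceAs (AddCommGroup (projSubmodule S K v))
instance : Module (Q.Alg S K) (Pr S K v) :=
  inferInstanceAs (Module (Q.Alg S K) (projSubmodule S K v))
instance : Module K (Pr S K v) := inferInstanceAs (Module K (projSubmodule S K v))
instance : IsScalarTower K (Q.Alg S K) (Pr S K v) :=
  inferInstanceAs (IsScalarTower K (Q.Alg S K) (projSubmodule S K v))

variable {S K}

/-- The coordinates of an element. -/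
def crd (b : ι) : Pr S K v →ₗ[Q.Alg S K] Q.Alg S K :=
  Finsupp.lapply b ∘ₗ (projSubmodule S K v).subtype

lemma crd_ext {p q : Pr S K v} (h : ∀ b, crd b p = crd b q) : p = q :=
  Subtype.ext (Finsupp.ext h)

lemma crd_mul_ev (p : Pr S K v) (b : ι) : crd b p * ev S K (v b) = crd b p := p.2 b

variable (S K v) in
/-- The projection from a free module that multiplies each coordinate by its idempotent. -/
def toPr : (ι →₀ Q.Alg S K) →ₗ[Q.Alg S K] Pr S K v where
  toFun p := ⟨Finsupp.onFinset p.support (fun b => p b * ev S K (v b)) fun b hb => by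
    rw [Finsupp.mem_support_iff]; rintro h; rw [h, zero_mul] at hb; exact hb rfl, fun b => by
    rw [Finsupp.onFinset_apply, mul_assoc, ev_mul_ev_self]⟩
  map_add' p q := Subtype.ext (Finsupp.ext fun b => add_mul _ _ _)
  map_smul' c p := Subtype.ext (Finsupp.ext fun b => mul_assoc _ _ _)

lemma crd_toPr (p : ι →₀ Q.Alg S K) (b : ι) :
    crd b (toPr S K v p) = p b * ev S K (v b) := rfl

lemma toPr_coe (p : Pr S K v) : toPr S K v p.1 = p := crd_ext fun b => p.2 b

variable (v) in
/-- The generators. -/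
def gen (b : ι) : Pr S K v := toPr S K v (Finsupp.single b 1)

lemma crd_gen_self (b : ι) : crd b (gen (S := S) (K := K) v b) = ev S K (v b) := by
  rw [gen, crd_toPr]; simp

lemma crd_gen_of_ne {b b' : ι} (h : b ≠ b') : crd b (gen (S := S) (K := K) v b') = 0 := by
  rw [gen, crd_toPr]; simp [h]

lemma ev_smul_gen (b : ι) : ev S K (v b) • gen (S := S) (K := K) v b = gen v b := by
  refine crd_ext fun b' => ?_
  by_cases h : b' = b
  · subst h; rw [map_smul, crd_gen_self, smul_eq_mul, ev_mul_ev_self]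
  · rw [map_smul, crd_gen_of_ne h, smul_zero]

lemma eq_sum_smul_gen (p : Pr S K v) : p = ∑ b ∈ p.1.support, crd b p • gen v b := by
  have h2 : p.1 = ∑ b ∈ p.1.support, crd b p • Finsupp.single b (1 : Q.Alg S K) := by
    conv_lhs => rw [← Finsupp.sum_single p.1]
    refine Finset.sum_congr rfl fun b _ => ?_
    rw [Finsupp.smul_single, smul_eq_mul, mul_one]; rfl
  conv_lhs => rw [← toPr_coe p, h2]
  rw [map_sum]
  exact Finset.sum_congr rfl fun b _ => map_smul _ _ _

instance : Module.Projective (Q.Alg S K) (Pr S K v) :=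
  Module.Projective.of_split (projSubmodule S K v).subtype (toPr S K v) (LinearMap.ext toPr_coe)

lemma eps_crd_of_ne (p : Pr S K v) {b : ι} {w : Q.V} (h : v b ≠ w) : eps w (crd b p) = 0 := by
  classical
  rw [← crd_mul_ev p b, eps_mul_ev, if_neg h]

lemma mem_rad_Pr {p : Pr S K v} (h : ∀ b w, eps w (crd b p) = 0) : p ∈ rad Q S K (Pr S K v) := by
  rw [eq_sum_smul_gen p]
  exact sum_mem fun b _ => smul_mem_rad (h b) _

variable {N : Type u} [AddCommGroup N] [Module (Q.Alg S K) N]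

/-- The homomorphism from a direct sum of projective modules that is determined by elements. -/
def lift (g : ι → N) : Pr S K v →ₗ[Q.Alg S K] N :=
  Finsupp.linearCombination _ g ∘ₗ (projSubmodule S K v).subtype

lemma lift_toPr {g : ι → N} (hg : ∀ b, ev S K (v b) • g b = g b) (p : ι →₀ Q.Alg S K) :
    lift g (toPr S K v p) = Finsupp.linearCombination _ g p := by
  refine LinearMap.congr_fun (?_ : lift g ∘ₗ toPr S K v = Finsupp.linearCombination _ g) p
  refine Finsupp.lhom_ext fun b x => ?_
  have : (toPr S K v (Finsupp.single b x)).1 = Finsupp.single b (x * ev S K (v b)) := by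
    ext b'
    change (Finsupp.single b x) b' * ev S K (v b') = _
    by_cases h : b = b'
    · subst h; simp
    · simp [h]
  change Finsupp.linearCombination _ g (toPr S K v (Finsupp.single b x)).1 = _
  rw [this, Finsupp.linearCombination_single, Finsupp.linearCombination_single, mul_smul, hg]

end Free

section Cover

set_option linter.unusedSectionVars false

variable (Q S K)
variable (N : Type u) [AddCommGroup N] [Module (Q.Alg S K) N] [Module K N]
  [IsScalarTower K (Q.Alg S K) N]

/-- A basis of a module modulo its radical, consisting of residue classes of elements `g b` of
type `v b`. That it is a basis is expressed by dual functionals. -/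
structure Cover where
  /-- the index set of the basis -/
  ι : Type u
  /-- the types of the top elements -/
  v : ι → Q.V
  /-- the top elements -/
  g : ι → N
  /-- the dual functionals -/
  dual : ι → N →ₗ[K] K
  mem : ∀ b, v b ∈ S
  ev_smul : ∀ b, ev S K (v b) • g b = g b
  dual_rad : ∀ b, ∀ n ∈ rad Q S K N, dual b n = 0
  dual_self : ∀ b, dual b (g b) = 1
  dual_of_ne : ∀ b b', b ≠ b' → dual b (g b') = 0
  span : Submodule.span (Q.Alg S K) (Set.range g) = ⊤

variable {Q S K N}

lemma smul_comm' (k : K) (x : Q.Alg S K) (n : N) : x • k • n = k • x • n := by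
  rw [← smul_one_smul (Q.Alg S K) k n, ← smul_one_smul (Q.Alg S K) k (x • n), ← mul_smul,
    ← mul_smul, mul_smul_comm, smul_mul_assoc, one_mul, mul_one]

variable (Q S K N) in
/-- The action of an element of the algebra, as a map linear over the ground field. -/
def act (x : Q.Alg S K) : N →ₗ[K] N where
  toFun n := x • n
  map_add' := smul_add x
  map_smul' k n := smul_comm' k x n

lemma smul_sub_eps_smul_mem_rad {v : Q.V} {n : N} (h : ev S K v • n = n) (x : Q.Alg S K) :
    x • n - eps v x • n ∈ rad Q S K N := by
  classical
  have h1 : x • n - eps v x • n = (x * ev S K v - eps v x • ev S K v) • n := by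
    rw [sub_smul, mul_smul, smul_assoc, h]
  rw [h1]
  refine smul_mem_rad (fun w => ?_) n
  rw [map_sub, map_smul, eps_mul_ev]
  by_cases hv : v ∈ S
  · rw [eps_ev _ _ hv]
    by_cases hw : v = w
    · subst hw; simp
    · simp [hw]
  · rw [ev_of_notMem K hv]
    simp only [map_zero, smul_zero, sub_zero, ite_eq_right_iff]
    rintro rfl
    exact eps_of_notMem hv x

variable (Q S K N) in
/-- Every module has a projective cover. -/
lemma exists_cover : Nonempty (Cover Q S K N) := by
  classical
  let T := N ⧸ rad Q S K N
  let R : Q.V → Submodule K T := fun w => LinearMap.range (act Q S K T (ev S K w))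
  have hR : ∀ w, ∀ t ∈ R w, ev S K w • t = t := by
    rintro w _ ⟨t, rfl⟩
    change ev S K w • ev S K w • t = ev S K w • t
    rw [← mul_smul, ev_mul_ev_self]
  let B := fun w => Module.Basis.ofVectorSpace K (R w)
  let ι : Type u := Σ w : {w // w ∈ S}, Module.Basis.ofVectorSpaceIndex K (R w.1)
  let t : ι → T := fun b => (B b.1.1 b.2 : R b.1.1)
  have ht : ∀ b, ev S K b.1.1 • t b = t b := fun b => hR _ _ (B b.1.1 b.2).2
  have hlift : ∀ b : ι, ∃ n : N, ev S K b.1.1 • n = n ∧ (rad Q S K N).mkQ n = t b := by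
    intro b
    obtain ⟨n, hn⟩ := (rad Q S K N).mkQ_surjective (t b)
    exact ⟨ev S K b.1.1 • n, by rw [← mul_smul, ev_mul_ev_self], by rw [map_smul, hn, ht]⟩
  choose g hg hgt using hlift
  let q : N →ₗ[K] T := (rad Q S K N).mkQ.restrictScalars K
  let pr : ∀ w, T →ₗ[K] R w := fun w => (act Q S K T (ev S K w)).rangeRestrict
  let dual : ι → N →ₗ[K] K := fun b => (B b.1.1).coord b.2 ∘ₗ pr b.1.1 ∘ₗ q
  have hpr : ∀ (w) (t : R w), pr w t = t := fun w t => Subtype.ext (hR w t t.2)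
  have hpr0 : ∀ w (b : ι), w ≠ b.1.1 → pr w (t b) = 0 := fun w b hne => Subtype.ext (by
    change ev S K w • t b = 0
    rw [← ht b, ← mul_smul, ev_mul_ev_of_ne hne, zero_smul])
  refine ⟨⟨ι, fun b => b.1.1, g, dual, fun b => b.1.2, hg, ?_, ?_, ?_, ?_⟩⟩
  · intro b n hn
    have : q n = 0 := (Submodule.Quotient.mk_eq_zero _).mpr hn
    simp only [dual, LinearMap.comp_apply, this, map_zero]
  · intro b
    have : q (g b) = t b := hgt b
    simp only [dual, LinearMap.comp_apply, this, t, hpr]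
    simp
  · rintro ⟨w, i⟩ ⟨w', i'⟩ hne
    have : q (g ⟨w', i'⟩) = t ⟨w', i'⟩ := hgt _
    simp only [dual, LinearMap.comp_apply, this]
    by_cases h : w = w'
    · subst h
      have hi : i ≠ i' := fun h => hne (by rw [h])
      simp only [t, hpr]
      simp [hi.symm]
    · have h1 : w.1 ≠ w'.1 := fun h' => h (Subtype.ext h')
      rw [hpr0 _ _ h1, map_zero]
  · refine eq_top_of_sup_rad (eq_top_iff.mpr fun n _ => ?_)
    have hspan : ∀ (w : {w // w ∈ S}) (x : R w.1),
        (x : T) ∈ (Submodule.span (Q.Alg S K) (Set.range g)).map (rad Q S K N).mkQ := by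
      intro w x
      let W : Submodule K (R w.1) :=
        (((Submodule.span (Q.Alg S K) (Set.range g)).map (rad Q S K N).mkQ).restrictScalars K).comap
          (R w.1).subtype
      have hW : Submodule.span K (Set.range (B w.1)) ≤ W := by
        rw [Submodule.span_le]
        rintro _ ⟨i, rfl⟩
        exact ⟨g ⟨w, i⟩, Submodule.subset_span ⟨_, rfl⟩, hgt ⟨w, i⟩⟩
      exact hW ((B w.1).mem_span x)
    have hn : n = ∑ w ∈ S, ev S K w • n := eq_sum_ev_smul n
    rw [sup_comm, ← Submodule.comap_map_mkQ, Submodule.mem_comap, hn, map_sum]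
    refine sum_mem fun w hw => ?_
    exact hspan ⟨w, hw⟩ ⟨(rad Q S K N).mkQ (ev S K w • n), (rad Q S K N).mkQ n, rfl⟩

namespace Cover

variable (c : Cover Q S K N)

/-- The projective module of a cover. -/
abbrev proj : Type u := Pr S K c.v

/-- The covering map, which takes the generators to the top elements. -/
def π : c.proj →ₗ[Q.Alg S K] N := lift c.g

lemma π_apply (p : c.proj) : c.π p = ∑ b ∈ p.1.support, crd b p • c.g b := rfl

lemma π_surjective : Function.Surjective c.π := by
  intro n
  have : n ∈ Submodule.span (Q.Alg S K) (Set.range c.g) := by rw [c.span]; trivial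
  obtain ⟨p, hp⟩ := (Finsupp.mem_span_range_iff_exists_finsupp).mp this
  exact ⟨toPr S K c.v p, (lift_toPr c.ev_smul p).trans hp⟩

/-- A preimage of an element of type `v` can be chosen to be of type `v`. -/
lemma exists_π_eq {v : Q.V} {n : N} (h : ev S K v • n = n) :
    ∃ p : c.proj, ev S K v • p = p ∧ c.π p = n := by
  obtain ⟨p, rfl⟩ := c.π_surjective n
  exact ⟨ev S K v • p, by rw [← mul_smul, ev_mul_ev_self], by rw [map_smul, h]⟩

lemma dual_π (p : c.proj) (b : c.ι) : c.dual b (c.π p) = eps (c.v b) (crd b p) := by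
  rw [π_apply, map_sum]
  have h : ∀ b', c.dual b (crd b' p • c.g b') = eps (c.v b') (crd b' p) * c.dual b (c.g b') := by
    intro b'
    have h1 := c.dual_rad b _ (smul_sub_eps_smul_mem_rad (c.ev_smul b') (crd b' p))
    rw [map_sub, sub_eq_zero, (c.dual b).map_smul, smul_eq_mul] at h1
    exact h1
  rw [Finset.sum_eq_single b]
  · rw [h, c.dual_self, mul_one]
  · intro b' _ hb; rw [h, c.dual_of_ne _ _ hb.symm, mul_zero]
  · intro hb
    have h0 : crd b p = 0 := Finsupp.notMem_support_iff.mp hb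
    rw [h0, zero_smul, map_zero]

/-- The covering map is minimal: an element of the projective module that is mapped into the
radical lies in the radical. -/
lemma eps_eq_zero {p : c.proj} (hp : c.π p ∈ rad Q S K N) (b : c.ι) (w : Q.V) :
    eps w (crd b p) = 0 := by
  by_cases h : c.v b = w
  · rw [← h, ← c.dual_π, c.dual_rad _ _ hp]
  · exact eps_crd_of_ne p h

lemma π_mem_rad {p : c.proj} (hp : ∀ b, eps (c.v b) (crd b p) = 0) : c.π p ∈ rad Q S K N := by
  rw [π_apply]
  refine sum_mem fun b _ => smul_mem_rad (fun w => ?_) _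
  by_cases h : c.v b = w
  · rw [← h, hp]
  · exact eps_crd_of_ne p h

lemma eps_ker (p : LinearMap.ker c.π) (b : c.ι) (w : Q.V) : eps w (crd b p.1) = 0 :=
  c.eps_eq_zero (by rw [LinearMap.mem_ker.mp p.2]; exact zero_mem _) b w

lemma g_notMem_rad (b : c.ι) : c.g b ∉ rad Q S K N := fun h => by
  have := c.dual_rad b _ h
  rw [c.dual_self] at this
  exact one_ne_zero this

/-- The number of top elements of a given type is a multiplicity of a simple module. -/
lemma le_of_topMultiplicitiesLE {n k : ℕ} (hn : TopMultiplicitiesLE (Q.Alg S K) N n) {w : Q.V}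
    (f : Fin k → c.ι) (hf : Function.Injective f) (hw : ∀ i, c.v (f i) = w) : k ≤ n := by
  rcases Nat.eq_zero_or_pos k with hk | hk
  · omega
  have hwS : w ∈ S := hw ⟨0, hk⟩ ▸ c.mem _
  have hmax := isMaximal_kerEps (K := K) hwS
  have : IsSimpleModule (Q.Alg S K) (Q.Alg S K ⧸ kerEps Q S K w) :=
    isSimpleModule_iff_isCoatom.mpr hmax.out
  let q : N →ₗ[Q.Alg S K] TopQuotient (Q.Alg S K) N := (rad Q S K N).mkQ
  let ψ : Fin k → (Q.Alg S K ⧸ kerEps Q S K w) →ₗ[Q.Alg S K] TopQuotient (Q.Alg S K) N :=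
    fun i => (kerEps Q S K w).liftQ (q ∘ₗ LinearMap.toSpanSingleton _ _ (c.g (f i))) fun x hx => by
      have h1 := smul_sub_eps_smul_mem_rad (c.ev_smul (f i)) x
      rw [hw i, mem_kerEps.mp hx, zero_smul, sub_zero] at h1
      exact (Submodule.Quotient.mk_eq_zero _).mpr h1
  refine hn _ k (∑ i, ψ i ∘ₗ LinearMap.proj i) ((injective_iff_map_eq_zero _).mpr fun s hs => ?_)
  choose x hx using fun i => (kerEps Q S K w).mkQ_surjective (s i)
  have h1 : q (∑ i, x i • c.g (f i)) = 0 := by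
    rw [map_sum, ← hs, LinearMap.sum_apply]
    refine Finset.sum_congr rfl fun i _ => ?_
    rw [LinearMap.comp_apply, LinearMap.proj_apply, ← hx i]
    rfl
  have h2 : ∑ i, x i • c.g (f i) ∈ rad Q S K N := (Submodule.Quotient.mk_eq_zero _).mp h1
  funext i
  rw [← hx i, Pi.zero_apply]
  refine (Submodule.Quotient.mk_eq_zero _).mpr (mem_kerEps.mpr ?_)
  have h3 := c.dual_rad (f i) _ h2
  rw [map_sum, Finset.sum_eq_single i] at h3
  · have h4 := c.dual_rad (f i) _ (smul_sub_eps_smul_mem_rad (c.ev_smul (f i)) (x i))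
    rw [map_sub, h3, (c.dual (f i)).map_smul, c.dual_self, hw i] at h4
    simpa using h4
  · intro j _ hj
    have h4 := c.dual_rad (f i) _ (smul_sub_eps_smul_mem_rad (c.ev_smul (f j)) (x j))
    rw [map_sub, (c.dual (f i)).map_smul, c.dual_of_ne _ _ (fun h => hj (hf h).symm),
      smul_zero, sub_zero] at h4
    exact h4
  · simp

/-- The kernel of the projective cover of a projective module vanishes. -/
lemma ker_eq_zero (h : Module.Projective (Q.Alg S K) N) (x : LinearMap.ker c.π) : x = 0 := by
  have h0 := ker_eq_bot_of_projective c.π c.π_surjective fun x hx =>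
    mem_rad_Pr (c.eps_ker ⟨x, hx⟩)
  exact Subtype.ext ((Submodule.eq_bot_iff _).mp h0 x.1 x.2)

end Cover

end Cover

end QuadraticTable

namespace QuadraticTable

variable {Q : QuadraticTable} {S : Finset Q.V} {K : Type u} [Field K]

/-! ### A loop with vanishing products -/

open CategoryTheory

variable (Q S K) in
/-- A module of finite projective dimension. -/
def FinPD (N : Type u) [AddCommGroup N] [Module (Q.Alg S K) N] : Prop :=
  ∃ n, HasProjectiveDimensionLT (ModuleCat.of (Q.Alg S K) N) n

section

variable {N : Type u} [AddCommGroup N] [Module (Q.Alg S K) N] [Module K N]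
  [IsScalarTower K (Q.Alg S K) N]

lemma FinPD.ker (h : FinPD Q S K N) (c : Cover Q S K N) : FinPD Q S K (LinearMap.ker c.π) := by
  obtain ⟨n, hn⟩ := h
  exact ⟨n + 1, hasProjectiveDimensionLT_ker_of_succ _ c.π_surjective
    (hasProjectiveDimensionLT_of_ge _ n (n + 2) (by omega))⟩

/-- The coefficients at the arrows vanish on the radical of the kernel of a projective cover. -/
lemma Cover.co_rad_ker (c : Cover Q S K N) {x : LinearMap.ker c.π}
    (hx : x ∈ rad Q S K (LinearMap.ker c.π)) (β : Q.Arr) (b : c.ι) : co β (crd b x.1) = 0 := by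
  classical
  obtain ⟨l, rfl⟩ := mem_rad.mp hx
  rw [← Submodule.subtype_apply, map_sum, map_sum, map_sum]
  refine Finset.sum_eq_zero fun α hα => ?_
  rw [map_smul, map_smul, smul_eq_mul, co_ar_mul _ hα, Submodule.subtype_apply, c.eps_ker, ite_self]

/-- If a sum of products of arrows that end in `z` with elements of a projective cover lies in the
radical of the kernel, then these elements lie in the radical. -/
lemma Cover.eps_eq_zero_of_sum (c : Cover Q S K N) {X : Finset Q.Arr} (hX : X ⊆ Q.arrows S)
    {p : Q.Arr → c.proj} (hp : ∀ α ∈ X, ev S K (Q.src α) • p α = p α)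
    {x : LinearMap.ker c.π} (hx : x ∈ rad Q S K (LinearMap.ker c.π))
    (h : x.1 = ∑ α ∈ X, ar S K α • p α) {α : Q.Arr} (hα : α ∈ X) (b : c.ι) (w : Q.V) :
    eps w (crd b (p α)) = 0 := by
  classical
  by_cases hw : Q.src α = w
  · have h1 := c.co_rad_ker hx α b
    rw [h, map_sum, map_sum, Finset.sum_eq_single_of_mem α hα] at h1
    · rw [map_smul, smul_eq_mul, co_ar_mul _ (hX hα), if_pos rfl] at h1
      rw [← hw, h1]
    · intro β _ hβ
      rw [map_smul, smul_eq_mul, co_ar_mul_of_ne _ hβ.symm]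
  · rw [← hp α hα, map_smul, smul_eq_mul, eps_ev_mul, if_neg hw]

end

section Loop

variable {z : Q.V} {lam : Q.Arr}

/-- Let `z` be a vertex with a loop `lam` that annihilates the radical. Then, for a module of
finite projective dimension, the part at `z` of the kernel of a projective cover lies in the
radical of the kernel. -/
lemma Cover.mem_rad_ker (hs : Q.src lam = z) (ht : Q.tgt lam = z)
    (hl : lam ∈ Q.arrows S) (hrel : ∀ β q, ¬ Q.Rel lam β q) :
    ∀ (n : ℕ) (N : Type u) [AddCommGroup N] [Module (Q.Alg S K) N] [Module K N]
    [IsScalarTower K (Q.Alg S K) N]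
    (_ : HasProjectiveDimensionLT (ModuleCat.of (Q.Alg S K) N) (n + 1))
    (c : Cover Q S K N) (x : LinearMap.ker c.π), ev S K z • x = x →
      x ∈ rad Q S K (LinearMap.ker c.π) := by
  classical
  intro n
  induction n with
  | zero =>
    intro N _ _ _ _ hN c x _
    have : Projective (ModuleCat.of (Q.Alg S K) N) :=
      projective_iff_hasProjectiveDimensionLT_one.mpr hN
    rw [c.ker_eq_zero ((IsProjective.iff_projective _).mpr this) x]
    exact zero_mem _
  | succ n ih =>
    intro N _ _ _ _ hN c x hx
    have hL := hasProjectiveDimensionLT_ker_of_succ _ c.π_surjective hN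
    obtain ⟨c'⟩ := exists_cover Q S K (LinearMap.ker c.π)
    obtain ⟨p, hp, rfl⟩ := c'.exists_π_eq hx
    -- the loop annihilates `x` since `x` has coordinates in the radical
    have h0 : ar S K lam • c'.π p = 0 := by
      refine Subtype.ext (crd_ext fun b => ?_)
      have hJ := c.eps_ker (c'.π p) b
      rw [ZeroMemClass.coe_zero, map_zero, Submodule.coe_smul, map_smul, smul_eq_mul]
      refine ext_coeff (fun v => by simp) (fun β => ?_) fun q => ?_
      · rw [co_ar_mul _ hl, hJ, ite_self, map_zero]
      · rw [de_ar_mul_of_not _ fun β => hrel β q, map_zero]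
    refine c'.π_mem_rad fun b => ?_
    have hk : c'.π (ar S K lam • p) = 0 := by rw [map_smul, h0]
    -- so the loop maps the preimage `p` to the next syzygy, where the assertion is known
    have h1 := ih _ hL c' ⟨_, hk⟩ (Subtype.ext (by
      rw [Submodule.coe_smul, ← mul_smul]
      congr 1
      rw [← ht, ev_tgt_mul_ar]))
    exact c'.eps_eq_zero_of_sum (X := {lam}) (by simpa using hl) (p := fun _ => p)
      (fun α hα => by rw [Finset.mem_singleton.mp hα, hs, hp]) h1 (by simp)
      (Finset.mem_singleton_self _) b _

variable {N : Type u} [AddCommGroup N] [Module (Q.Alg S K) N] [Module K N]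
  [IsScalarTower K (Q.Alg S K) N]

/-- A relation between products with arrows that end in `z`, in a module of finite projective
dimension, involves only elements of the radical. -/
lemma mem_rad_of_sum_eq_zero (hs : Q.src lam = z) (ht : Q.tgt lam = z)
    (hl : lam ∈ Q.arrows S) (hrel : ∀ β q, ¬ Q.Rel lam β q) (hN : FinPD Q S K N)
    {X : Finset Q.Arr} (hX : X ⊆ Q.arrows S) (hXz : ∀ α ∈ X, Q.tgt α = z) {n : Q.Arr → N}
    (hn : ∀ α ∈ X, ev S K (Q.src α) • n α = n α) (h : ∑ α ∈ X, ar S K α • n α = 0)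
    {α : Q.Arr} (hα : α ∈ X) : n α ∈ rad Q S K N := by
  obtain ⟨c⟩ := exists_cover Q S K N
  obtain ⟨m, hm⟩ := hN
  have hp : ∀ α, ∃ p : c.proj, α ∈ X → (ev S K (Q.src α) • p = p ∧ c.π p = n α) := by
    intro α
    by_cases hα : α ∈ X
    · obtain ⟨p, hp⟩ := c.exists_π_eq (hn α hα)
      exact ⟨p, fun _ => hp⟩
    · exact ⟨0, fun h => absurd h hα⟩
  choose p hp using hp
  have hk : c.π (∑ α ∈ X, ar S K α • p α) = 0 := by
    rw [map_sum, ← h]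
    exact Finset.sum_congr rfl fun α hα => by rw [map_smul, (hp α hα).2]
  have hx := Cover.mem_rad_ker hs ht hl hrel m N
    (hasProjectiveDimensionLT_of_ge _ m (m + 1) (by omega)) c ⟨_, hk⟩ (Subtype.ext (by
      rw [Submodule.coe_smul, Finset.smul_sum]
      refine Finset.sum_congr rfl fun α hα => ?_
      rw [← mul_smul, ← hXz α hα, ev_tgt_mul_ar]))
  rw [← (hp α hα).2]
  exact c.π_mem_rad fun b => c.eps_eq_zero_of_sum hX (fun α hα => (hp α hα).1) hx rfl hα b _

lemma smul_eq_sum_co {u : N} (hu : ∀ (α β : Q.Arr) (y : Q.Alg S K), ar S K α • ar S K β • y • u = 0)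
    {x : Q.Alg S K} (hx : x ∈ arrowIdeal Q S K) :
    x • u = ∑ α ∈ Q.arrows S, co α x • ar S K α • u := by
  classical
  obtain ⟨y, hy⟩ := exists_decomp_of_eps x hx
  have h1 : ∀ α ∈ Q.arrows S, co α x = eps (Q.src α) (y α) := by
    intro α hα
    rw [hy, map_sum, Finset.sum_eq_single_of_mem α hα, co_ar_mul _ hα, if_pos rfl]
    intro β _ hβ
    exact co_ar_mul_of_ne _ hβ.symm
  conv_lhs => rw [hy]
  rw [Finset.sum_smul]
  refine Finset.sum_congr rfl fun α hα => ?_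
  rw [h1 α hα]
  obtain ⟨w, hw⟩ := ar_mul_eq α (y α)
  rw [hw, add_smul, Finset.sum_smul, Finset.sum_eq_zero, add_zero, smul_assoc]
  intro β _
  rw [mul_smul, mul_smul, hu]

/-- Let `φ` be an arrow from `v` to `z`, and let `n` be of type `v` with `φ n = 0`. In a module of
finite projective dimension and Loewy length two, `n` is a combination of products with
arrows `α` such that `φ α = 0`. -/
lemma exists_eq_sum_of_smul_eq_zero (hs : Q.src lam = z) (ht : Q.tgt lam = z)
    (hl : lam ∈ Q.arrows S) (hrel : ∀ β q, ¬ Q.Rel lam β q) (hN : FinPD Q S K N)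
    (hu : ∀ (α β : Q.Arr) (u : N), ar S K α • ar S K β • u = 0)
    {φ : Q.Arr} (hφ : φ ∈ Q.arrows S) (hφz : Q.tgt φ = z)
    (hφ' : ∀ β q α β', Q.Rel φ β q → Q.Rel α β' q → α = φ)
    {n : N} (hn : ev S K (Q.src φ) • n = n) (h : ar S K φ • n = 0) :
    ∃ u : Q.Arr → N, (∀ α, ev S K (Q.src α) • u α = u α) ∧
      (∀ α q, Q.Rel φ α q → u α = 0) ∧ (∀ α, Q.tgt α ≠ Q.src φ → u α = 0) ∧
      n = ∑ α ∈ Q.arrows S, ar S K α • u α := by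
  classical
  obtain ⟨c⟩ := exists_cover Q S K N
  obtain ⟨m, hm⟩ := hN
  obtain ⟨p, hp, rfl⟩ := c.exists_π_eq hn
  have hk : c.π (ar S K φ • p) = 0 := by rw [map_smul, h]
  have hx := Cover.mem_rad_ker hs ht hl hrel m N
    (hasProjectiveDimensionLT_of_ge _ m (m + 1) (by omega)) c ⟨_, hk⟩ (Subtype.ext (by
      rw [Submodule.coe_smul, ← mul_smul]
      congr 1
      rw [← hφz, ev_tgt_mul_ar]))
  have hp0 : ∀ b w, eps w (crd b p) = 0 := fun b w =>
    c.eps_eq_zero_of_sum (X := {φ}) (by simpa using hφ) (p := fun _ => p)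
      (fun α hα => by rw [Finset.mem_singleton.mp hα, hp]) hx (by simp)
      (Finset.mem_singleton_self _) b _
  obtain ⟨l, hl'⟩ := mem_rad.mp hx
  -- subtracting an element of the kernel removes the coefficients at the `α` with `φ α ≠ 0`
  let p' : c.proj := ev S K (Q.src φ) • (p - (l φ).1)
  have hp' : c.π p' = c.π p := by
    rw [map_smul, map_sub, LinearMap.mem_ker.mp (l φ).2, sub_zero, ← map_smul, hp]
  have hp'0 : ∀ b, crd b p' ∈ arrowIdeal Q S K := fun b w => by
    rw [map_smul, smul_eq_mul, eps_mul, map_sub, map_sub, hp0, c.eps_ker, sub_zero, mul_zero]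
  have hco : ∀ b α q, Q.Rel φ α q → co α (crd b p') = 0 := by
    intro b α q hr
    have h1 : de q (crd b (ar S K φ • p)) = co α (crd b p) := by
      rw [map_smul, smul_eq_mul, de_ar_mul _ hφ hr]
    have h2 : de q (crd b (ar S K φ • p)) = co α (crd b (l φ).1) := by
      have h3 : ar S K φ • p = ∑ α ∈ Q.arrows S, ar S K α • (l α).1 := by
        have := congrArg (LinearMap.ker c.π).subtype hl'
        rw [map_sum] at this
        exact this
      rw [h3, map_sum, map_sum, Finset.sum_eq_single_of_mem φ hφ]
      · rw [map_smul, smul_eq_mul, de_ar_mul _ hφ hr]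
      · intro γ hγ hne
        rw [map_smul, smul_eq_mul, de_ar_mul_of_not]
        exact fun β' h' => hne (hφ' _ _ _ _ hr h')
    rw [map_smul, smul_eq_mul, co_ev_mul, map_sub, map_sub, ← h1, ← h2, sub_self, ite_self]
  have hco' : ∀ b α, Q.tgt α ≠ Q.src φ → co α (crd b p') = 0 := by
    intro b α hne
    rw [map_smul, smul_eq_mul, co_ev_mul, if_neg hne.symm]
  refine ⟨fun α => ∑ b ∈ p'.1.support, co α (crd b p') • ev S K (Q.src α) • c.g b,
    fun α => ?_, fun α q hr => ?_, fun α hne => ?_, ?_⟩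
  · rw [Finset.smul_sum]
    refine Finset.sum_congr rfl fun b _ => ?_
    rw [smul_comm', ← mul_smul, ev_mul_ev_self]
  · exact Finset.sum_eq_zero fun b _ => by rw [hco b α q hr, zero_smul]
  · exact Finset.sum_eq_zero fun b _ => by rw [hco' b α hne, zero_smul]
  · rw [← hp', c.π_apply]
    simp only [Finset.smul_sum]
    rw [Finset.sum_comm]
    refine Finset.sum_congr rfl fun b _ => ?_
    rw [smul_eq_sum_co (fun α β y => hu α β _) (hp'0 b)]
    refine Finset.sum_congr rfl fun α _ => ?_
    rw [smul_comm', ← mul_smul, ar_mul_ev_src]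

end Loop

end QuadraticTable

namespace QuadraticTable

variable {Q : QuadraticTable} {S : Finset Q.V} {K : Type u} [Field K]
variable {N : Type u} [AddCommGroup N] [Module (Q.Alg S K) N]

/-- An element of the radical is a combination of elements `α n` with `n` of the type of the
vertex in which `α` starts; if it is of type `w`, then only arrows that end in `w` occur. -/
lemma exists_eq_sum_of_mem_rad {n : N} (hn : n ∈ rad Q S K N) {w : Q.V}
    (hw : ev S K w • n = n) : ∃ l : Q.Arr → N, n = ∑ α ∈ Q.arrows S, ar S K α • l α ∧
      (∀ α, ev S K (Q.src α) • l α = l α) ∧ ∀ α, Q.tgt α ≠ w → l α = 0 := by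
  classical
  obtain ⟨l, rfl⟩ := mem_rad.mp hn
  refine ⟨fun α => if Q.tgt α = w then ev S K (Q.src α) • l α else 0, ?_, fun α => ?_,
    fun α h => if_neg h⟩
  · conv_lhs => rw [← hw, Finset.smul_sum]
    refine Finset.sum_congr rfl fun α _ => ?_
    dsimp only
    split_ifs with h
    · rw [← mul_smul, ← mul_smul, ar_mul_ev_src, ← h, ev_tgt_mul_ar]
    · rw [smul_zero, ← mul_smul, ev_mul_ar_of_ne (Ne.symm h), zero_smul]
  · dsimp only
    split_ifs
    · rw [← mul_smul, ev_mul_ev_self]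
    · exact smul_zero _

variable [Module K N] [IsScalarTower K (Q.Alg S K) N]

/-- A criterion for an element of the kernel of a projective cover to lie in the radical of the
kernel. -/
lemma Cover.mem_rad_ker_of_sum (c : Cover Q S K N) (k : LinearMap.ker c.π) (p : Q.Arr → c.proj)
    (hk : k.1 = ∑ α ∈ Q.arrows S, ar S K α • p α)
    (ht : ∀ α ∈ Q.arrows S, ∃ t : Q.Arr → N, c.π (p α) = ∑ β ∈ Q.arrows S, ar S K β • t β ∧
      ∀ β, t β ≠ 0 → ar S K α * ar S K β = 0) :
    k ∈ rad Q S K (LinearMap.ker c.π) := by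
  classical
  have h1 : ∀ α, ∃ m : LinearMap.ker c.π, α ∈ Q.arrows S → ar S K α • m.1 = ar S K α • p α := by
    intro α
    by_cases hα : α ∈ Q.arrows S
    · obtain ⟨t, h1, h2⟩ := ht α hα
      choose s hs using fun β => c.π_surjective (t β)
      let s' : Q.Arr → c.proj := fun β => if t β = 0 then 0 else s β
      have hs' : ∀ β, c.π (s' β) = t β := fun β => by
        by_cases h : t β = 0
        · simp only [s', if_pos h, map_zero, h]
        · simp only [s', if_neg h, hs]
      refine ⟨⟨p α - ∑ β ∈ Q.arrows S, ar S K β • s' β, ?_⟩, fun _ => ?_⟩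
      · rw [LinearMap.mem_ker, map_sub, h1, map_sum, sub_eq_zero]
        exact Finset.sum_congr rfl fun β _ => by rw [map_smul, hs']
      · rw [smul_sub, sub_eq_self, Finset.smul_sum]
        refine Finset.sum_eq_zero fun β _ => ?_
        by_cases h : t β = 0
        · simp only [s', if_pos h, smul_zero]
        · rw [← mul_smul, h2 β h, zero_smul]
    · exact ⟨0, fun h => absurd h hα⟩
  choose m hm using h1
  refine mem_rad.mpr ⟨m, Subtype.ext ?_⟩
  rw [hk, ← Submodule.subtype_apply, map_sum]
  exact Finset.sum_congr rfl fun α hα => by rw [map_smul]; exact (hm α hα).symm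

/-- Elements of the kernel of a projective cover are annihilated by paths of length two. -/
lemma Cover.ar_smul_ar_smul (c : Cover Q S K N) (α β : Q.Arr) (u : LinearMap.ker c.π) :
    ar S K α • ar S K β • u = 0 := by
  refine Subtype.ext (crd_ext fun b => ?_)
  rw [Submodule.coe_smul, Submodule.coe_smul, map_smul, map_smul, ZeroMemClass.coe_zero, map_zero]
  exact arrowIdeal_mul_mul (ar_mem_arrowIdeal α) (ar_mem_arrowIdeal β) (c.eps_ker u b)

end QuadraticTable

namespace Profile

open Vtx Arr Deg CategoryTheory QuadraticTable

variable {P : Profile} {K : Type u} [Field K]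

/-! ### Projective dimensions and tops -/

variable (P K) in
/-- The algebra of the quiver. -/
abbrev Al : Type u := P.table.Alg P.verts K

variable (P K) in
/-- The idempotents. -/
abbrev ide (v : Vtx) : P.Al K := ev (Q := P.table) P.verts K v

variable (K) in
/-- The residue classes of the arrows. -/
abbrev arw (α : P.Arr) : P.Al K := ar (Q := P.table) P.verts K α

/-- The coefficients at the arrows. -/
abbrev cf (α : P.Arr) : P.Al K →ₗ[K] K := co (Q := P.table) α

variable (P) in
/-- The coefficients in degree two. -/
abbrev df (q : Deg) : P.Al K →ₗ[K] K := de (Q := P.table) q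

/-- Modules of finite projective dimension. -/
abbrev FPD (P : Profile) (K : Type u) [Field K] (N : Type u) [AddCommGroup N]
    [Module (P.Al K) N] : Prop := FinPD P.table P.verts K N

/-- Projective covers. -/
abbrev Cov (P : Profile) (K : Type u) [Field K] (N : Type u) [AddCommGroup N]
    [Module (P.Al K) N] [Module K N] := Cover P.table P.verts K N

/-- Radicals. -/
abbrev rd (P : Profile) (K : Type u) [Field K] (N : Type u) [AddCommGroup N]
    [Module (P.Al K) N] : Submodule (P.Al K) N := rad P.table P.verts K N

lemma lam_mem : (lam : P.Arr) ∈ P.table.arrows P.verts :=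
  mem_arrows_verts.mpr ⟨z_mem_verts, z_mem_verts⟩

lemma not_rel_lam (β : P.Arr) (q : Deg) : ¬ Rel (lam : P.Arr) β q := nofun

lemma phiX_mem {L j : ℕ} (h : x L j ∈ P.verts) : (phiX L j : P.Arr) ∈ P.table.arrows P.verts :=
  mem_arrows_verts.mpr ⟨h, z_mem_verts⟩

lemma phiA_mem {L : ℕ} (hL : P.bot ≤ L) (h : a L ∈ P.verts) :
    (phiA L hL : P.Arr) ∈ P.table.arrows P.verts :=
  mem_arrows_verts.mpr ⟨h, z_mem_verts⟩

lemma lev_finish_lt {q : Deg} (h : finish q ≠ z) :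
    lev (finish q) < lev (start q) ∧ start q ≠ z := by
  cases q <;> simp_all [start, finish, lev]

section

variable {N : Type u} [AddCommGroup N] [Module (P.Al K) N] [Module K N] [IsScalarTower K (P.Al K) N]

lemma mem_rad_ker_z (hN : P.FPD K N) (c : P.Cov K N) {k : LinearMap.ker c.π}
    (hk : P.ide K z • k = k) : k ∈ P.rd K (LinearMap.ker c.π) := by
  obtain ⟨m, hm⟩ := hN
  exact Cover.mem_rad_ker (Q := P.table) (S := P.verts) (z := z) (lam := lam) rfl rfl lam_mem
    not_rel_lam m N (hasProjectiveDimensionLT_of_ge _ m (m + 1) (by omega)) c k hk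

end

/-- A module of finite projective dimension without top elements of type `z`, and with all top
elements in levels less than `j`, has projective dimension less than `j`. -/
lemma hasProjectiveDimensionLT_of_tops (j : ℕ) : ∀ (N : Type u) [AddCommGroup N] [Module (P.Al K) N]
    [Module K N] [IsScalarTower K (P.Al K) N], P.FPD K N →
    (∀ n : N, P.ide K z • n = n → n ∈ P.rd K N) →
    (∀ w, w ≠ z → j ≤ lev w → ∀ n : N, P.ide K w • n = n → n ∈ P.rd K N) →
    HasProjectiveDimensionLT (ModuleCat.of (P.Al K) N) j := by
  classical
  induction j with
  | zero =>
    intro N _ _ _ _ _ hz hw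
    have h0 : ∀ n : N, n = 0 :=
        eq_zero_of_mem_rad (Q := P.table) (S := P.verts) (K := K) fun n => by
      rw [eq_sum_ev_smul (Q := P.table) (S := P.verts) (K := K) n]
      refine sum_mem fun w _ => ?_
      have h1 : P.ide K w • P.ide K w • n = P.ide K w • n := by
        rw [← mul_smul, ev_mul_ev_self]
      by_cases h : w = z
      · subst h; exact hz _ h1
      · exact hw w h (Nat.zero_le _) _ h1
    have : Subsingleton N := ⟨fun a b => by rw [h0 a, h0 b]⟩
    rw [hasProjectiveDimensionLT_zero_iff_isZero]
    exact ModuleCat.isZero_of_subsingleton _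
  | succ j ih =>
    intro N _ _ _ _ hN hz hw
    obtain ⟨c⟩ := exists_cover P.table P.verts K N
    refine hasProjectiveDimensionLT_succ_of_ker _ c.π_surjective (ih _ (hN.ker c)
      (fun k hk => mem_rad_ker_z hN c hk) ?_)
    intro w hwz hj k hk
    have hv : ∀ b, c.v b ≠ z → lev (c.v b) < j + 1 := fun b hb => by
      by_contra h
      exact c.g_notMem_rad b (hw _ hb (not_lt.mp h) _ (c.ev_smul b))
    -- arrows and paths of length two lower the levels, so the syzygy has no elements in level `j`
    have h0 : k = 0 := by
      refine Subtype.ext (crd_ext fun b => ?_)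
      have h1 : crd b k.1 = P.ide K w * (crd b k.1 * P.ide K (c.v b)) := by
        conv_lhs => rw [← hk, Submodule.coe_smul, map_smul, smul_eq_mul, ← crd_mul_ev]
      rw [ZeroMemClass.coe_zero, map_zero]
      refine ext_coeff (fun v => by rw [c.eps_ker, map_zero]) (fun α => ?_) fun q => ?_
      · rw [h1, co_ev_mul, co_mul_ev, map_zero]
        split_ifs with h2 h3
        · have h4 := lev_src (γ := α) (fun h => hwz (h2.trans h))
          have h5 : c.v b = src α := h3
          have h6 : w = tgt α := h2
          have h7 := hv b (h5 ▸ h4.2)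
          rw [h5] at h7
          rw [h6] at hj
          omega
        · rfl
        · rfl
      · rw [h1, de_ev_mul, de_mul_ev, map_zero]
        split_ifs with h2 h3
        · have h4 := lev_finish_lt (q := q) (fun h => hwz (h2.trans h))
          have h5 : c.v b = start q := h3
          have h6 : w = finish q := h2
          have h7 := hv b (h5 ▸ h4.2)
          rw [h5] at h7
          rw [h6] at hj
          omega
        · rfl
        · rfl
    rw [h0]
    exact zero_mem _

end Profile

namespace Profile

open Vtx Arr Deg CategoryTheory QuadraticTable

variable {P : Profile} {K : Type u} [Field K]

/-! ### Counting top elements -/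

section

variable {M : Type u} [AddCommGroup M] [Module (P.Al K) M] [Module K M] [IsScalarTower K (P.Al K) M]

/-- The vectors indexed by the top elements of a fixed type are at most `n`-dimensional. -/
lemma le_of_linearIndependent (c : P.Cov K M) {n k : ℕ} (hn : TopMultiplicitiesLE (P.Al K) M n)
    {w : Vtx} (s : Fin k → {b // c.v b = w} → K) (hs : LinearIndependent K s) : k ≤ n := by
  have key : ∀ (k : ℕ) (f : Fin k → {b // c.v b = w}), Function.Injective f → k ≤ n :=
    fun k f hf => c.le_of_topMultiplicitiesLE hn (fun i => (f i).1)
      (Subtype.val_injective.comp hf) fun i => (f i).2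
  have hfin : Finite {b // c.v b = w} := by
    by_contra h
    rw [not_finite_iff_infinite] at h
    have := key (n + 1) (fun i => Infinite.natEmbedding _ i.1)
        fun i j h => Fin.ext (by simpa using h)
    omega
  have := Fintype.ofFinite {b // c.v b = w}
  have h1 := hs.fintype_card_le_finrank
  rw [Fintype.card_fin, Module.finrank_fintype_fun_eq_card] at h1
  exact h1.trans (key _ (Fintype.equivFin _).symm (Fintype.equivFin _).symm.injective)

/-- If the first syzygy of a module of finite projective dimension contains elements `Y i` whose
coefficients at the arrows `rho m i'` form a nonzero scalar matrix, then the module has at least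
`N (m + 1)` top elements of type `x (m + 1) 0`. -/
lemma le_of_dual_family (hM : P.FPD K M) (c : P.Cov K M) {n : ℕ}
    (hn : TopMultiplicitiesLE (P.Al K) M n) {m : ℕ} (hm : m ≤ P.top)
    (Y : ℕ → LinearMap.ker c.π) (hY : ∀ i < P.N (m + 1), P.ide K (x m (P.cl m i)) • Y i = Y i)
    {η : K} (hη : η ≠ 0) (b : c.ι) (hc : ∀ i < P.N (m + 1), ∀ i' < P.N (m + 1),
      cf (rho m i') (crd b (Y i).1) = if i = i' then η else 0) : P.N (m + 1) ≤ n := by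
  classical
  refine le_of_linearIndependent c hn (w := x (m + 1) 0)
    (fun i b => cf (sig m (P.cl m i)) (crd b.1 (Y i).1)) ?_
  rw [Fintype.linearIndependent_iff]
  intro g hg
  have hs : ∀ b, ∑ i, g i * cf (sig m (P.cl m i)) (crd b (Y i).1) = 0 := by
    intro b
    by_cases hb : c.v b = x (m + 1) 0
    · have := congrFun hg ⟨b, hb⟩
      simpa using this
    · refine Finset.sum_eq_zero fun i _ => ?_
      rw [← crd_mul_ev, co_mul_ev, if_neg (show ¬ c.v b = src (sig m (P.cl m i)) from hb), mul_zero]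
  have hζ : ∀ i < P.N (m + 1), (zeta m (P.cl m i) : P.Arr) ∈ P.table.arrows P.verts := fun i hi =>
    mem_arrows_verts.mpr ⟨x_cl_mem_verts hm hi, z_mem_verts⟩
  -- the combination of the products with the arrows `zeta` has no coefficients
  have h0 : ∑ i : Fin (P.N (m + 1)), arw (P := P) K (zeta m (P.cl m i)) • g i • Y i = 0 := by
    refine Subtype.ext (crd_ext fun b => ?_)
    rw [← Submodule.subtype_apply, map_sum, map_sum, ZeroMemClass.coe_zero, map_zero]
    have h1 : ∀ i : Fin (P.N (m + 1)), crd b ((LinearMap.ker c.π).subtype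
        (arw (P := P) K (zeta m (P.cl m i)) • g i • Y i)) =
        g i • (arw (P := P) K (zeta m (P.cl m i)) * crd b (Y i).1) := fun i => by
      rw [smul_comm']
      rfl
    simp only [h1]
    refine ext_coeff (fun v => ?_) (fun β => ?_) fun q => ?_
    · rw [map_sum, map_zero]
      refine Finset.sum_eq_zero fun i _ => ?_
      rw [map_smul, eps_mul, c.eps_ker, mul_zero, smul_zero]
    · rw [map_sum, map_zero]
      refine Finset.sum_eq_zero fun i _ => ?_
      rw [map_smul, co_ar_mul _ (hζ i i.2), c.eps_ker, ite_self, smul_zero]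
    · rw [map_sum, map_zero]
      by_cases hq : q = om m
      · subst hq
        rw [← hs b]
        refine Finset.sum_congr rfl fun i _ => ?_
        rw [map_smul, de_ar_mul (Q := P.table) _ (hζ i i.2) (Rel.om m (P.cl m i)), smul_eq_mul]
      · refine Finset.sum_eq_zero fun i _ => ?_
        rw [map_smul, de_ar_mul_of_not (Q := P.table), smul_zero]
        rintro β ⟨⟩
        exact hq rfl
  -- different indices `i` may share the arrow `zeta m (cl m i)`: collect the terms of each arrow
  let X : Finset P.Arr := Finset.univ.image fun i : Fin (P.N (m + 1)) => zeta m (P.cl m i)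
  let T : P.Arr → Finset (Fin (P.N (m + 1))) := fun α =>
    Finset.univ.filter fun i => zeta m (P.cl m i) = α
  let y : P.Arr → LinearMap.ker c.π := fun α => ∑ i ∈ T α, g i • Y i
  have hsum : ∑ α ∈ X, arw K α • y α = 0 := by
    rw [← h0, ← Finset.sum_fiberwise_of_maps_to (t := X) (g := fun i : Fin (P.N (m + 1)) =>
      (zeta m (P.cl m i) : P.Arr)) fun i _ => Finset.mem_image_of_mem _ (Finset.mem_univ i)]
    refine Finset.sum_congr rfl fun α _ => ?_
    rw [Finset.smul_sum]
    refine Finset.sum_congr rfl fun i hi => ?_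
    rw [(Finset.mem_filter.mp hi).2]
  intro i₀
  have hrad : y (zeta m (P.cl m i₀)) ∈ P.rd K (LinearMap.ker c.π) := by
    refine mem_rad_of_sum_eq_zero (Q := P.table) (S := P.verts) (z := z) (lam := lam) rfl rfl
      lam_mem not_rel_lam (hM.ker c) (X := X) ?_ ?_ ?_ hsum ?_
    · intro α hα
      obtain ⟨i, -, rfl⟩ := Finset.mem_image.mp hα
      exact hζ i i.2
    · intro α hα
      obtain ⟨i, -, rfl⟩ := Finset.mem_image.mp hα
      rfl
    · intro α _
      rw [Finset.smul_sum]
      refine Finset.sum_congr rfl fun i hi => ?_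
      rw [← (Finset.mem_filter.mp hi).2, smul_comm']
      exact congrArg _ (hY i i.2)
    · exact Finset.mem_image_of_mem _ (Finset.mem_univ i₀)
  have hsm : ∀ i : Fin (P.N (m + 1)), co (Q := P.table) (rho m i₀) (crd b
      ((LinearMap.ker c.π).subtype (g i • Y i))) = g i * cf (rho m i₀) (crd b (Y i).1) :=
    fun i => (cf (rho m i₀)).map_smul (g i) (crd b (Y i).1)
  have h1 := c.co_rad_ker hrad (rho m i₀) b
  rw [← Submodule.subtype_apply, map_sum, map_sum, map_sum, Finset.sum_eq_single_of_mem i₀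
    (show i₀ ∈ T _ from Finset.mem_filter.mpr ⟨Finset.mem_univ _, rfl⟩)] at h1
  · have h2 := hc i₀ i₀.2 i₀ i₀.2
    rw [if_pos rfl] at h2
    rw [hsm, h2] at h1
    exact (mul_eq_zero.mp h1).resolve_right hη
  · intro i _ hne
    have h2 := hc i i.2 i₀ i₀.2
    rw [if_neg fun h => hne (Fin.ext h)] at h2
    rw [hsm, h2, mul_zero]

/-- An element of the first syzygy that is annihilated by an arrow to `z` is a combination of
products with arrows that this arrow annihilates. -/
lemma exists_eq_sum_of_phi (hM : P.FPD K M) (c : P.Cov K M) {φ : P.Arr}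
    (hφ : φ ∈ P.table.arrows P.verts) (hφ' : (∃ L h, φ = phiA L h) ∨ ∃ L j, φ = phiX L j)
    {u : LinearMap.ker c.π} (hu : P.ide K (src φ) • u = u) (h : arw K φ • u = 0) :
    ∃ y : P.Arr → LinearMap.ker c.π, (∀ α, P.ide K (src α) • y α = y α) ∧
      (∀ α q, Rel φ α q → y α = 0) ∧ (∀ α, tgt α ≠ src φ → y α = 0) ∧
      u = ∑ α ∈ P.table.arrows P.verts, arw K α • y α := by
  refine exists_eq_sum_of_smul_eq_zero (Q := P.table) (S := P.verts) (z := z) (lam := lam) rfl rfl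
    lam_mem not_rel_lam (hM.ker c) (fun α β u => c.ar_smul_ar_smul α β u) hφ ?_ ?_ hu h
  · obtain ⟨L, h, rfl⟩ | ⟨L, j, rfl⟩ := hφ' <;> rfl
  · obtain ⟨L, h, rfl⟩ | ⟨L, j, rfl⟩ := hφ'
    · rintro _ _ α β' ⟨⟩ ⟨⟩; rfl
    · rintro _ _ α β' ⟨⟩ hr
      cases hr
      simp_all

/-- If `rhoA l u` is a combination of products with other arrows, and the module does not have
enough top elements, then `u` has no coefficient at `rhoA (l + 1)`. -/
lemma cf_rhoA_eq_zero (hM : P.FPD K M) (c : P.Cov K M) {n : ℕ}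
    (hn : TopMultiplicitiesLE (P.Al K) M n) {l : ℕ} (hl : l + 2 ≤ P.top → n < P.N (l + 2))
    {u : LinearMap.ker c.π} (hu : P.ide K (a (l + 1)) • u = u) {y : P.Arr → LinearMap.ker c.π}
    (hy : ∀ α, P.ide K (src α) • y α = y α) (hy0 : y (rhoA l) = 0)
    (h : arw (P := P) K (rhoA l) • u = ∑ α ∈ P.table.arrows P.verts, arw K α • y α) (b : c.ι) :
    cf (rhoA (l + 1)) (crd b u.1) = 0 := by
  classical
  by_contra hη
  have hmem : (rhoA (l + 1) : P.Arr) ∈ P.table.arrows P.verts := by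
    by_contra h'
    exact hη (co_of_notMem h' _)
  have hl2 : l + 2 ≤ P.top := a_mem_verts.mp (mem_arrows_verts.mp hmem).1
  have hnl := hl hl2
  have ha : ∀ i ≤ l + 2, a i ∈ P.verts := fun i hi => a_mem_verts.mpr (by omega)
  have hrhoA : (rhoA l : P.Arr) ∈ P.table.arrows P.verts :=
    mem_arrows_verts.mpr ⟨ha _ (by omega), ha _ (by omega)⟩
  have hrho : ∀ i < P.N (l + 1), (rho l i : P.Arr) ∈ P.table.arrows P.verts := fun i hi =>
    mem_arrows_verts.mpr ⟨ha _ (by omega), x_cl_mem_verts (by omega) hi⟩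
  have hphi : ∀ i < P.N (l + 1), (phiX l (P.cl l i) : P.Arr) ∈ P.table.arrows P.verts :=
    fun i hi => phiX_mem (x_cl_mem_verts (by omega) hi)
  -- the elements `Y i` with `i < N (l + 1)`: `rho l i * u` is annihilated by the arrow to `z`
  have hF : ∀ i, ∃ Y : LinearMap.ker c.π, i < P.N (l + 1) → P.ide K (x (l + 1) 0) • Y = Y ∧
      arw (P := P) K (rho l i) • u = arw (P := P) K (sig l (P.cl l i)) • Y := by
    intro i
    by_cases hi : i < P.N (l + 1)
    · obtain ⟨y, h1, h2, h3, h4⟩ := exists_eq_sum_of_phi hM c (hphi i hi) (Or.inr ⟨_, _, rfl⟩)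
        (u := arw (P := P) K (rho l i) • u) (by
          rw [← mul_smul]
          exact congrArg (· • u) (ev_tgt_mul_ar (Q := P.table) (K := K) (rho l i)))
        (c.ar_smul_ar_smul _ _ u)
      refine ⟨y (sig l (P.cl l i)), fun _ => ⟨h1 (sig l (P.cl l i)), ?_⟩⟩
      rw [h4]
      refine Finset.sum_eq_single _ (fun α _ hα => ?_) fun hs => ?_
      · by_cases ht : tgt α = src (phiX l (P.cl l i) : P.Arr)
        · cases α with
          | sig L j => simp only [src, tgt, x.injEq] at ht; exact absurd (by rw [ht.1, ht.2]) hα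
          | rho L i' =>
            simp only [src, tgt, x.injEq] at ht
            obtain ⟨rfl, ht⟩ := ht
            rw [h2 _ _ (Rel.bet L i' _ ht), smul_zero]
          | _ => simp [src, tgt] at ht
        · rw [h3 α ht, smul_zero]
      · refine absurd (mem_arrows_verts.mpr ⟨?_, x_cl_mem_verts (by omega) hi⟩) hs
        have := P.mono (show l + 1 ≤ l + 2 by omega)
        exact x_mem_verts.mpr ⟨by omega, show 0 < P.N (l + 2) by omega, Or.inl rfl⟩
    · exact ⟨0, fun h => absurd h hi⟩
  choose Y₁ hY₁ using hF
  -- the elements `Y i` with `N (l + 1) ≤ i` occur in the given expression for `rhoA l * u`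
  let Y : ℕ → LinearMap.ker c.π := fun i =>
    if hi : i < P.N (l + 1) then Y₁ i else y (the l i (not_lt.mp hi))
  have hYlt : ∀ i, i < P.N (l + 1) → Y i = Y₁ i := fun i hi => dif_pos hi
  have hYge : ∀ i (hi : P.N (l + 1) ≤ i), Y i = y (the l i hi) := fun i hi =>
    dif_neg (not_lt.mpr hi)
  have hYe : ∀ i < P.N (l + 2), P.ide K (x (l + 1) (P.cl (l + 1) i)) • Y i = Y i := by
    intro i _
    rcases lt_or_ge i (P.N (l + 1)) with h | h
    · rw [hYlt i h, P.cl_of_lt h]; exact (hY₁ i h).1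
    · rw [hYge i h, P.cl_of_le h]; exact hy (the l i h)
  refine not_le.mpr hnl (le_of_dual_family hM c hn (m := l + 1) (by omega) Y hYe hη b ?_)
  intro i hi i' hi'
  -- coefficients of `Y i` at arrows that do not end in its vertex vanish
  have htype : P.cl (l + 1) i ≠ P.cl (l + 1) i' → cf (rho (l + 1) i') (crd b (Y i).1) = 0 := by
    intro hne
    have h1 := congrArg (fun y : LinearMap.ker c.π => crd b y.1) (hYe i hi)
    simp only [Submodule.coe_smul, map_smul, smul_eq_mul] at h1
    rw [← h1, co_ev_mul, if_neg]
    intro h2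
    simp only [tgt, x.injEq, true_and] at h2
    exact hne h2
  rcases lt_or_ge i (P.N (l + 1)) with h1 | h1
  · rcases lt_or_ge i' (P.N (l + 1)) with h2 | h2
    · have h3 := congrArg (fun y : LinearMap.ker c.π => df P (kap l i' (P.cl l i)) (crd b y.1))
        (hY₁ i h1).2
      simp only [Submodule.coe_smul, map_smul, smul_eq_mul] at h3
      have hsig : (sig l (P.cl l i) : P.Arr) ∈ P.table.arrows P.verts :=
        mem_arrows_verts.mpr ⟨x_mem_verts.mpr ⟨by omega, show 0 < P.N (l + 2) by omega, Or.inl rfl⟩,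
          x_cl_mem_verts (by omega) h1⟩
      rw [de_ar_mul (Q := P.table) _ hsig (Rel.kap_sig l i' _ h2)] at h3
      rw [hYlt i h1, cf, ← h3]
      by_cases h4 : i = i'
      · subst h4
        rw [if_pos rfl, de_ar_mul (Q := P.table) _ (hrho i h1) (Rel.kap_rho l i _ h1 rfl)]
      · rw [if_neg h4, de_ar_mul_of_not (Q := P.table)]
        rintro β ⟨⟩
        exact h4 rfl
    · rw [if_neg (by omega)]
      refine htype ?_
      rw [P.cl_of_lt h1, P.cl_of_le h2]
      omega
  · by_cases h4 : i = i'
    · subst h4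
      rw [if_pos rfl]
      have h3 := congrArg (fun y : LinearMap.ker c.π => df P (tau l i) (crd b y.1)) h
      simp only [Submodule.coe_smul, map_smul, smul_eq_mul] at h3
      rw [de_ar_mul (Q := P.table) _ hrhoA (Rel.tau_rhoA l i h1 hi)] at h3
      have hthe : (the l i h1 : P.Arr) ∈ P.table.arrows P.verts :=
        mem_arrows_verts.mpr ⟨x_mem_verts.mpr ⟨by omega, hi, Or.inr h1⟩, ha _ (by omega)⟩
      rw [← Submodule.subtype_apply (Finset.sum _ _), map_sum, map_sum, map_sum,
        Finset.sum_eq_single_of_mem _ hthe] at h3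
      · rw [Submodule.subtype_apply, SetLike.val_smul, map_smul, smul_eq_mul,
          de_ar_mul (Q := P.table) _ hthe (Rel.tau_the l i h1)] at h3
        rw [hYge i h1]
        exact h3.symm
      · intro α _ hα
        by_cases hr : α = rhoA l
        · rw [hr, hy0, smul_zero, map_zero, map_zero, map_zero]
        · rw [Submodule.subtype_apply, SetLike.val_smul, map_smul, smul_eq_mul,
            de_ar_mul_of_not (Q := P.table)]
          rintro β ⟨⟩
          · exact hα rfl
          · exact hr rfl
    · rw [if_neg h4]
      refine htype ?_
      rw [P.cl_of_le h1]
      rcases lt_or_ge i' (P.N (l + 1)) with h2 | h2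
      · rw [P.cl_of_lt h2]; omega
      · rw [P.cl_of_le h2]; exact h4

end

end Profile

namespace Profile

open Vtx Arr Deg CategoryTheory QuadraticTable

variable {P : Profile} {K : Type u} [Field K]

/-! ### The upper bound -/

/-- The arrows `phiA` and `phiX` detect the products with all arrows that start at the same vertex
and do not end in `z`. -/
lemma not_rel_of_phi {φ α β : P.Arr} (hφ : (∃ L h, φ = phiA L h) ∨ ∃ L j, φ = phiX L j)
    (hs : src φ = src α) (hα : tgt α ≠ z) (h : ∀ q, ¬ Rel φ β q) (q : Deg) : ¬ Rel α β q := by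
  intro hr
  obtain ⟨L, h', rfl⟩ | ⟨L, j, rfl⟩ := hφ
  · cases hr <;> simp only [src, a.injEq, reduceCtorEq] at hs <;> try exact hα rfl
    · subst hs; exact h _ (Rel.betA _ _)
    · subst hs; exact h _ (Rel.betA _ _)
  · cases hr <;> simp only [src, x.injEq, reduceCtorEq] at hs <;> try exact hα rfl
    · obtain ⟨rfl, rfl⟩ := hs; exact h _ (Rel.bet _ _ _ (P.cl_of_le ‹_›))
    · obtain ⟨rfl, rfl⟩ := hs; exact h _ (Rel.bet _ _ _ (P.cl_of_lt ‹_›))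

/-- A coefficient in degree two of a product with an arrow vanishes if the corresponding
coefficients of the other factor do. -/
lemma de_ar_mul_eq_zero {α : P.Arr} (hα : α ∈ P.table.arrows P.verts) {y : P.Al K} {q : Deg}
    (h : ∀ β, Rel α β q → cf β y = 0) : df P q (arw K α * y) = 0 := by
  by_cases hr : ∃ β, Rel α β q
  · obtain ⟨β, hβ⟩ := hr
    rw [de_ar_mul (Q := P.table) _ hα hβ]
    exact h β hβ
  · exact de_ar_mul_of_not (Q := P.table) _ fun β hβ => hr ⟨β, hβ⟩

section

variable {M : Type u} [AddCommGroup M] [Module (P.Al K) M] [Module K M]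

lemma sum_df_eq_zero (c : P.Cov K M) {u : P.Arr → LinearMap.ker c.π}
    (h : ∑ α ∈ P.table.arrows P.verts, arw K α • u α = 0) (b : c.ι) (q : Deg) :
    ∑ α ∈ P.table.arrows P.verts, df P q (arw K α * crd b (u α).1) = 0 := by
  have h1 := congrArg (fun y => df P q (crd b ((LinearMap.ker c.π).subtype y))) h
  simp only [map_sum, map_zero, map_smul] at h1
  exact h1

variable [IsScalarTower K (P.Al K) M]

lemma ar_smul_ker_eq_zero (c : P.Cov K M) {α : P.Arr} (hα : α ∈ P.table.arrows P.verts)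
    {u : LinearMap.ker c.π} (h : ∀ b β q, Rel α β q → cf β (crd b u.1) = 0) : arw K α • u = 0 := by
  classical
  refine Subtype.ext (crd_ext fun b => ?_)
  rw [Submodule.coe_smul, map_smul, smul_eq_mul, ZeroMemClass.coe_zero, map_zero]
  refine ext_coeff (fun v => by rw [eps_mul, c.eps_ker, mul_zero, map_zero])
    (fun β => ?_) fun q => ?_
  · rw [co_ar_mul _ hα, c.eps_ker, ite_self, map_zero]
  · rw [map_zero]
    exact de_ar_mul_eq_zero hα fun β => h b β q

/-- Top elements of the second syzygy of a module of finite projective dimension lie in low levels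
unless the module has many generators. -/
lemma mem_rad_ker_ker (hM : P.FPD K M) (c₀ : P.Cov K M) {n F : ℕ}
    (hn : TopMultiplicitiesLE (P.Al K) M n) (hF : P.bot ≤ F)
    (hFn : ∀ L, F < L → L ≤ P.top → n < P.N L) (c : P.Cov K (LinearMap.ker c₀.π)) {w : Vtx}
    (hwz : w ≠ z) (hw : F ≤ lev w + 1) {k : LinearMap.ker c.π} (hk : P.ide K w • k = k) :
    k ∈ P.rd K (LinearMap.ker c.π) := by
  classical
  obtain ⟨p, hp, hps, hpw⟩ := exists_eq_sum_of_mem_rad (N := c.proj) (mem_rad_Pr (c.eps_ker k))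
    (w := w) (congrArg Subtype.val hk)
  let u : P.Arr → LinearMap.ker c₀.π := fun α => c.π (p α)
  have hu0 : ∀ α, tgt α ≠ w → u α = 0 := fun α h => by
    change c.π (p α) = 0
    rw [hpw α h, map_zero]
  have hus : ∀ α, P.ide K (src α) • u α = u α := fun α => by
    change ev (Q := P.table) P.verts K (src α) • c.π (p α) = c.π (p α)
    rw [← map_smul]
    exact congrArg c.π (hps α)
  have husum : ∑ α ∈ P.table.arrows P.verts, arw K α • u α = 0 := by
    have h1 := LinearMap.mem_ker.mp k.2
    rw [hp, map_sum] at h1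
    rw [← h1]
    exact Finset.sum_congr rfl fun α _ => (map_smul c.π _ _).symm
  have hsum : ∀ b q, ∑ α ∈ P.table.arrows P.verts, df P q (arw K α * crd b (u α).1) = 0 :=
    sum_df_eq_zero c₀ husum
  have hL : ∀ l, lev w = l → l + 2 ≤ P.top → n < P.N (l + 2) := fun l hl => hFn _ (by omega)
  -- for elements of type `a (l + 1)`, the coefficients at `rhoA (l + 1)` vanish
  have hA : ∀ α ∈ P.table.arrows P.verts, tgt α = w → ∀ l, src α = a (l + 1) → ∀ b,
      cf (rhoA (l + 1)) (crd b (u α).1) = 0 := by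
    intro α hα ht l hs
    have hus' : P.ide K (a (l + 1)) • u α = u α := hs ▸ hus α
    cases α with
    | rhoA l' =>
      obtain rfl : l' = l := by simpa [src] using hs
      refine cf_rhoA_eq_zero hM c₀ hn (hL l' (by rw [← ht]; rfl)) hus'
        (y := fun β => if β = rhoA l' then 0 else - u β) (fun β => ?_) (if_pos rfl) ?_
      · split_ifs
        · exact smul_zero _
        · rw [smul_neg, hus]
      · rw [← Finset.add_sum_erase _ _ hα] at husum
        rw [← Finset.add_sum_erase _ _ hα, if_pos rfl, smul_zero, zero_add,
          eq_neg_of_add_eq_zero_left husum, ← Finset.sum_neg_distrib]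
        refine Finset.sum_congr rfl fun β hβ => ?_
        rw [if_neg (Finset.mem_erase.mp hβ).1, smul_neg]
    | rho l' i =>
      obtain rfl : l' = l := by simpa [src] using hs
      have h1 := x_mem_verts.mp (mem_arrows_verts.mp hα).2
      have h2 : P.bot ≤ l' := by
        by_contra h
        have := P.N_eq_zero (l' + 1) (by omega)
        omega
      have hphi := phiA_mem h2 (a_mem_verts.mpr h1.1)
      obtain ⟨y, hy1, hy2, -, hy4⟩ := exists_eq_sum_of_phi hM c₀ hphi (Or.inl ⟨_, _, rfl⟩)
        (u := arw (P := P) K (rhoA l') • u (rho l' i)) (by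
          rw [← mul_smul]
          exact congrArg (· • u (rho l' i)) (ev_tgt_mul_ar (Q := P.table) (K := K) (rhoA l')))
        (c₀.ar_smul_ar_smul _ _ _)
      exact cf_rhoA_eq_zero hM c₀ hn (hL l' (by rw [← ht]; rfl)) hus' hy1
        (hy2 _ _ (Rel.betA l' h2)) hy4
    | _ => simp_all [src, tgt]
  -- for elements of type `x (l + 1) j`, the coefficients at `rho (l + 1) i` vanish: compare the
  -- coefficients in degree two of the relation between the `u α`
  have hX : ∀ α ∈ P.table.arrows P.verts, tgt α = w → ∀ l j, src α = x (l + 1) j → ∀ b i,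
      P.cl (l + 1) i = j → cf (rho (l + 1) i) (crd b (u α).1) = 0 := by
    intro α hα ht l j hs b i hi
    cases α with
    | sig l' j' =>
      obtain ⟨rfl, rfl⟩ : l' = l ∧ 0 = j := by simpa [src] using hs
      have h1 := x_mem_verts.mp (mem_arrows_verts.mp hα).2
      have h2 : i < P.N (l' + 1) := by
        by_contra h
        rw [P.cl_of_le (not_lt.mp h)] at hi
        omega
      have h3 := hsum b (kap l' i j')
      rw [Finset.sum_eq_single_of_mem _ hα,
        de_ar_mul (Q := P.table) _ hα (Rel.kap_sig l' i j' h2)] at h3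
      · exact h3
      · intro β hβ hne
        refine de_ar_mul_eq_zero hβ ?_
        rintro γ ⟨⟩
        · exact absurd rfl hne
        · refine hA _ hβ ?_ _ rfl b
          rw [← ht]
          simp only [tgt]
          rw [‹P.cl l' i = j'›]
    | the l' i' h =>
      obtain ⟨rfl, rfl⟩ : l' = l ∧ i' = j := by simpa [src] using hs
      obtain rfl : i = i' := by
        rcases lt_or_ge i (P.N (l' + 1)) with h1 | h1
        · rw [P.cl_of_lt h1] at hi; omega
        · rwa [P.cl_of_le h1] at hi
      have h3 := hsum b (tau l' i)
      rw [Finset.sum_eq_single_of_mem _ hα,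
        de_ar_mul (Q := P.table) _ hα (Rel.tau_the l' i h)] at h3
      · exact h3
      · intro β hβ hne
        refine de_ar_mul_eq_zero hβ ?_
        rintro γ ⟨⟩
        · exact absurd rfl hne
        · exact hA _ hβ ht _ rfl b
    | _ => simp_all [src, tgt]
  refine c.mem_rad_ker_of_sum k p hp fun α hα => ?_
  by_cases ht : tgt α = w
  swap
  · refine ⟨0, ?_, fun β h => absurd rfl h⟩
    rw [hpw α ht, map_zero]
    simp
  -- hence `u α` is annihilated by the arrow from its vertex to `z`
  have hφ : ∃ φ ∈ P.table.arrows P.verts, ((∃ L h, φ = phiA L h) ∨ ∃ L j, φ = phiX L j) ∧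
      src φ = src α ∧ arw K φ • u α = 0 := by
    have h1 := lev_src (γ := α) (ht ▸ hwz)
    rw [ht] at h1
    have h2 := (mem_arrows_verts.mp hα).1
    cases hs : src α with
    | z => exact absurd hs h1.2
    | a L =>
      rw [hs] at h1 h2
      replace h1 : L = lev w + 1 := h1.1
      subst h1
      have h3 := phiA_mem (P := P) (by omega) h2
      refine ⟨_, h3, Or.inl ⟨_, _, rfl⟩, rfl, ar_smul_ker_eq_zero c₀ h3 ?_⟩
      rintro b β q ⟨⟩
      exact hA α hα ht _ hs b
    | x L j =>
      rw [hs] at h1 h2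
      replace h1 : L = lev w + 1 := h1.1
      subst h1
      have h3 := phiX_mem h2
      refine ⟨_, h3, Or.inr ⟨_, _, rfl⟩, rfl, ar_smul_ker_eq_zero c₀ h3 ?_⟩
      rintro b β q ⟨⟩
      exact hX α hα ht _ j hs b _ ‹_›
  obtain ⟨φ, hφ, hφ', hφs, hφu⟩ := hφ
  obtain ⟨t, -, ht2, -, ht4⟩ := exists_eq_sum_of_phi hM c₀ hφ hφ' (hφs ▸ hus α) hφu
  refine ⟨t, ht4, fun β hβ => ar_mul_ar_eq_zero fun q => ?_⟩
  exact not_rel_of_phi hφ' hφs (ht ▸ hwz) (fun q hr => hβ (ht2 β q hr)) q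

/-- The upper bound for finite projective dimensions: the top elements of the second syzygy lie in
levels below `F - 1`, so its projective dimension is less than `F - 1`. -/
lemma hasProjectiveDimensionLT_of_topMultiplicitiesLE (hM : P.FPD K M) {n F : ℕ}
    (hn : TopMultiplicitiesLE (P.Al K) M n) (hF : P.bot ≤ F)
    (hFn : ∀ L, F < L → L ≤ P.top → n < P.N L) :
    HasProjectiveDimensionLT (ModuleCat.of (P.Al K) M) (F + 1) := by
  obtain ⟨c₀⟩ := exists_cover P.table P.verts K M
  obtain ⟨c⟩ := exists_cover P.table P.verts K (LinearMap.ker c₀.π)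
  have h1 := P.one_le_bot
  obtain ⟨F, rfl⟩ : ∃ F', F = F' + 1 := ⟨F - 1, by omega⟩
  have hU := hM.ker c₀
  exact hasProjectiveDimensionLT_succ_of_ker _ c₀.π_surjective
    (hasProjectiveDimensionLT_succ_of_ker _ c.π_surjective
    (hasProjectiveDimensionLT_of_tops F _ (hU.ker c) (fun k hk => mem_rad_ker_z hU c hk)
      fun w hwz hw k hk => mem_rad_ker_ker hM c₀ hn hF hFn c hwz (by omega) hk))

end

end Profile

/-! ### Trees, and elements with given coordinates -/

/-- A finite graph given by a function that assigns to each vertex other than the root its parent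
is a tree. -/
lemma SimpleGraph.isTree_of_parent {V : Type*} [Finite V] (G : SimpleGraph V) (r : V) (par : V → V)
    (rank : V → ℕ) (hrank : ∀ i, i ≠ r → rank (par i) < rank i)
    (hadj : ∀ i j, G.Adj i j ↔ (i ≠ r ∧ par i = j) ∨ (j ≠ r ∧ par j = i)) : G.IsTree := by
  classical
  rw [SimpleGraph.isTree_iff_connected_and_card]
  have hr : ∀ i, G.Reachable i r := by
    intro i
    induction h : rank i using Nat.strong_induction_on generalizing i with
    | _ n ih =>
      by_cases hi : i = r
      · rw [hi]
      · exact ((hadj i (par i)).mpr (Or.inl ⟨hi, rfl⟩)).reachable.trans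
          (ih _ (h ▸ hrank i hi) _ rfl)
  have : Nonempty V := ⟨r⟩
  refine ⟨⟨fun i j => (hr i).trans (hr j).symm⟩, ?_⟩
  let e : {i // i ≠ r} → G.edgeSet := fun i =>
    ⟨s(i.1, par i.1), (hadj _ _).mpr (Or.inl ⟨i.2, rfl⟩)⟩
  have he : Function.Bijective e := by
    constructor
    · rintro ⟨i, hi⟩ ⟨j, hj⟩ h
      have h1 : s(i, par i) = s(j, par j) := congrArg Subtype.val h
      rcases Sym2.eq_iff.mp h1 with h2 | h2
      · exact Subtype.ext h2.1
      · have h3 := hrank i hi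
        have h4 := hrank j hj
        rw [h2.2] at h3
        rw [← h2.1] at h4
        omega
    · rintro ⟨s, hs⟩
      induction s using Sym2.ind with
      | _ i j =>
        rcases (hadj i j).mp hs with ⟨h, rfl⟩ | ⟨h, rfl⟩
        · exact ⟨⟨i, h⟩, rfl⟩
        · exact ⟨⟨j, h⟩, Subtype.ext Sym2.eq_swap⟩
  rw [← Nat.card_eq_of_bijective e he]
  have h1 : Nat.card ({i // i = r} ⊕ {i // i ≠ r}) = Nat.card V :=
    Nat.card_congr (Equiv.sumCompl fun i => i = r)
  rw [← h1, Nat.card_sum, Nat.card_unique (α := {i // i = r}), add_comm]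

namespace QuadraticTable

variable {Q : QuadraticTable} {S : Finset Q.V} {K : Type u} [Field K]

/-- An element without coefficients in degrees zero and one is a combination of paths of
length two. -/
lemma exists_eq_sum_of_mem_degTwo {x : Q.Alg S K} (hx : x ∈ degTwo Q S K) :
    ∃ k : Q.Arr → Q.Arr → K, x = ∑ α ∈ Q.arrows S, ∑ β ∈ Q.arrows S,
      k α β • (ar S K α * ar S K β) := by
  classical
  obtain ⟨y, hy⟩ := exists_decomp_of_eps x hx.1
  have h1 : ∀ α ∈ Q.arrows S, eps (Q.src α) (y α) = 0 := by
    intro α hα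
    have h := hx.2 α
    rwa [hy, map_sum, Finset.sum_eq_single_of_mem α hα fun β _ hβ => co_ar_mul_of_ne _ hβ.symm,
      co_ar_mul _ hα, if_pos rfl] at h
  choose w hw using fun α => ar_mul_eq α (y α)
  refine ⟨fun α β => eps (Q.src β) (w α β), hy.trans (Finset.sum_congr rfl fun α hα => ?_)⟩
  rw [hw, h1 α hα, zero_smul, zero_add]
  refine Finset.sum_congr rfl fun β _ => ?_
  obtain ⟨t, ht⟩ := ar_mul_eq β (w α β)
  rw [ht, mul_add, mul_smul_comm, Finset.mul_sum, add_eq_left]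
  exact Finset.sum_eq_zero fun γ _ => by
    rw [← mul_assoc (ar S K β), ← mul_assoc, ar_mul_ar_mul_ar, zero_mul]

section

variable {ι : Type u} {v : ι → Q.V}

/-- The element of a direct sum of projective modules with given coordinates. -/
def mkPr [Finite ι] (f : ι → Q.Alg S K) (hf : ∀ b, f b * ev S K (v b) = f b) : Pr S K v :=
  ⟨Finsupp.equivFunOnFinite.symm f, hf⟩

lemma crd_mkPr [Finite ι] (f : ι → Q.Alg S K) (hf : ∀ b, f b * ev S K (v b) = f b) (b : ι) :
    crd b (mkPr f hf) = f b := rfl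

end

end QuadraticTable

namespace Profile

open Vtx Arr Deg CategoryTheory QuadraticTable

variable {P : Profile} {K : Type u} [Field K]

/-! ### Projective resolutions -/

/-- The indices of the generators of the projective modules in the resolutions: one generator of
type `a L` and `n` further generators. -/
inductive Gen (n : ℕ) : Type u
  | eta
  | y (i : Fin n)

instance (n : ℕ) : Finite (Gen.{u} n) :=
  Finite.of_surjective (fun o : Option (Fin n) => o.elim Gen.eta Gen.y) fun
    | .eta => ⟨none, rfl⟩
    | .y i => ⟨some i, rfl⟩

variable (P) in
/-- The types of the generators. -/
def genVtx (L n : ℕ) : Gen.{u} n → Vtx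
  | .eta => a L
  | .y i => x L (P.cl L i)

variable (P K) in
/-- The terms of the resolutions. -/
abbrev Res (L n : ℕ) : Type u := Pr (Q := P.table) P.verts K (P.genVtx L n)

/-- The coordinates of the differential. -/
def diffCrd (l n : ℕ) (q : P.Res K l (P.N (l + 1))) : Gen.{u} n → P.Al K
  | .eta => crd .eta q * arw K (rhoA l) + ∑ i : Fin (P.N (l + 1)), crd (.y i) q * arw K (rho l i)
  | .y i => - if h : i < P.N (l + 1) then crd (.y ⟨i, h⟩) q * arw K (sig l (P.cl l i)) else
      crd .eta q * arw K (the l i (not_lt.mp h))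

lemma diffCrd_mul_ev (l n : ℕ) (q : P.Res K l (P.N (l + 1))) (b : Gen.{u} n) :
    diffCrd l n q b * P.ide K (P.genVtx (l + 1) n b) = diffCrd l n q b := by
  have h : ∀ α : P.Arr, arw K α * P.ide K (src α) = arw K α := ar_mul_ev_src (Q := P.table)
  cases b with
  | eta =>
    simp only [diffCrd, genVtx, add_mul, Finset.sum_mul, mul_assoc]
    congr 1
    · exact congrArg _ (h (rhoA l))
    · exact Finset.sum_congr rfl fun i _ => congrArg _ (h (rho l i))
  | y i =>
    simp only [diffCrd, genVtx, neg_mul]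
    split_ifs with hi
    · rw [P.cl_of_lt hi, mul_assoc]
      exact congrArg (fun t => - (_ * t)) (h (sig l (P.cl l i)))
    · rw [P.cl_of_le (not_lt.mp hi), mul_assoc]
      exact congrArg (fun t => - (_ * t)) (h (the l i (not_lt.mp hi)))

/-- The differential. It maps the generator of type `a l` to the difference of the multiple of the
generator of type `a (l + 1)` by `rhoA l` and the sum of the multiples of the `i`-th generators by
`the l i`, where `N (l + 1) ≤ i < n`, and for `i < N (l + 1)` it maps the `i`-th generator to the
difference of the multiples of these two generators by `rho l i` and `sig l (cl l i)`. -/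
def diff (l n : ℕ) : P.Res K l (P.N (l + 1)) →ₗ[P.Al K] P.Res K (l + 1) n where
  toFun q := mkPr (diffCrd l n q) (diffCrd_mul_ev l n q)
  map_add' q q' := crd_ext fun b => by
    rw [map_add, crd_mkPr, crd_mkPr, crd_mkPr]
    cases b with
    | eta => simp only [diffCrd, map_add, add_mul, Finset.sum_add_distrib]; abel
    | y i => simp only [diffCrd, map_add, add_mul]; split_ifs <;> abel
  map_smul' c q := crd_ext fun b => by
    rw [map_smul, crd_mkPr, crd_mkPr]
    cases b with
    | eta => simp only [diffCrd, map_smul, smul_eq_mul, mul_add, Finset.mul_sum, mul_assoc,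
        RingHom.id_apply]
    | y i =>
      simp only [diffCrd, map_smul, smul_eq_mul, RingHom.id_apply, mul_neg]
      split_ifs <;> rw [mul_assoc]

lemma crd_diff (l n : ℕ) (q : P.Res K l (P.N (l + 1))) (b : Gen.{u} n) :
    crd b (diff l n q) = diffCrd l n q b := rfl

section

variable {l n : ℕ}

lemma rhoA_mem (hl : l + 1 ≤ P.top) : (rhoA l : P.Arr) ∈ P.table.arrows P.verts :=
  mem_arrows_verts.mpr ⟨a_mem_verts.mpr hl, a_mem_verts.mpr (by omega)⟩

lemma rho_mem (hl : l + 1 ≤ P.top) {i : ℕ} :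
    (rho l i : P.Arr) ∈ P.table.arrows P.verts ↔ i < P.N (l + 1) := by
  refine ⟨fun h => ?_, fun h =>
    mem_arrows_verts.mpr ⟨a_mem_verts.mpr hl, x_cl_mem_verts (by omega) h⟩⟩
  have h1 := (x_mem_verts.mp (mem_arrows_verts.mp h).2).2.1
  by_contra h2
  have := P.mono (show l ≤ l + 1 by omega)
  rw [P.cl_of_le (by omega)] at h1
  omega

lemma sig_mem (hl : l + 1 ≤ P.top) {i : ℕ} (hi : i < P.N (l + 1)) :
    (sig l (P.cl l i) : P.Arr) ∈ P.table.arrows P.verts := by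
  have := P.mono (show l + 1 ≤ l + 2 by omega)
  exact mem_arrows_verts.mpr ⟨x_mem_verts.mpr ⟨hl, show 0 < P.N (l + 2) by omega, Or.inl rfl⟩,
    x_cl_mem_verts (by omega) hi⟩

lemma the_mem (hl : l + 1 ≤ P.top) {i : ℕ} (h : P.N (l + 1) ≤ i) (hi : i < P.N (l + 2)) :
    (the l i h : P.Arr) ∈ P.table.arrows P.verts :=
  mem_arrows_verts.mpr ⟨x_mem_verts.mpr ⟨hl, hi, Or.inr h⟩, a_mem_verts.mpr (by omega)⟩

lemma eps_diff (q : P.Res K l (P.N (l + 1))) (b : Gen.{u} n) (w : Vtx) :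
    eps (Q := P.table) w (crd b (diff l n q)) = 0 := by
  rw [crd_diff]
  cases b with
  | eta => simp [diffCrd, eps_mul]
  | y i =>
    simp only [diffCrd, map_neg, neg_eq_zero]
    split_ifs <;> simp [eps_mul]

lemma cf_rhoA_diff (hl : l + 1 ≤ P.top) (q : P.Res K l (P.N (l + 1))) :
    cf (rhoA l) (crd .eta (diff l n q)) = eps (Q := P.table) (a l) (crd .eta q) := by
  classical
  simp only [crd_diff, diffCrd, map_add, map_sum]
  rw [co_mul_ar _ (rhoA_mem hl), if_pos rfl]
  refine add_eq_left.mpr ?_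
  exact Finset.sum_eq_zero fun i _ => co_mul_ar_of_ne _ nofun

lemma cf_rho_diff (hl : l + 1 ≤ P.top) (q : P.Res K l (P.N (l + 1))) (i : Fin (P.N (l + 1))) :
    cf (rho l i) (crd .eta (diff l n q)) =
      eps (Q := P.table) (x l (P.cl l i)) (crd (.y i) q) := by
  classical
  simp only [crd_diff, diffCrd, map_add, map_sum]
  rw [cf, co_mul_ar_of_ne (Q := P.table) (α := rhoA l) _ (by rintro ⟨⟩), zero_add,
    Finset.sum_eq_single i]
  · rw [co_mul_ar _ ((rho_mem hl).mpr i.2), if_pos rfl]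
    rfl
  · intro j _ hj
    refine co_mul_ar_of_ne _ fun h => hj ?_
    simp only [rho.injEq, true_and] at h
    exact Fin.ext h.symm
  · simp

lemma cf_eta_diff_of_ne (q : P.Res K l (P.N (l + 1))) {β : P.Arr} (h₁ : β ≠ rhoA l)
    (h₂ : ∀ i, β ≠ rho l i) : cf β (crd .eta (diff l n q)) = 0 := by
  simp only [crd_diff, diffCrd, map_add, map_sum]
  rw [co_mul_ar_of_ne _ h₁, zero_add]
  exact Finset.sum_eq_zero fun i _ => co_mul_ar_of_ne _ (h₂ i)

lemma cf_sig_diff (hl : l + 1 ≤ P.top) (q : P.Res K l (P.N (l + 1))) (i : Fin n)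
    (hi : i < P.N (l + 1)) :
    cf (sig l (P.cl l i)) (crd (.y i) (diff l n q)) =
      - eps (Q := P.table) (x l (P.cl l i)) (crd (.y ⟨i, hi⟩) q) := by
  classical
  simp only [crd_diff, diffCrd, map_neg, dif_pos hi]
  rw [co_mul_ar _ (sig_mem hl hi), if_pos rfl]
  rfl

lemma cf_the_diff (hl : l + 1 ≤ P.top) (q : P.Res K l (P.N (l + 1))) (i : Fin n)
    (hi : P.N (l + 1) ≤ i)
    (hi' : i < P.N (l + 2)) :
    cf (the l i hi) (crd (.y i) (diff l n q)) = - eps (Q := P.table) (a l) (crd .eta q) := by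
  classical
  simp only [crd_diff, diffCrd, map_neg, dif_neg (not_lt.mpr hi)]
  rw [co_mul_ar _ (the_mem hl hi hi'), if_pos rfl]
  rfl

lemma cf_y_diff_of_ne (q : P.Res K l (P.N (l + 1))) (i : Fin n) {β : P.Arr}
    (h₁ : i < P.N (l + 1) → β ≠ sig l (P.cl l i)) (h₂ : ∀ h, β ≠ the l i h) :
    cf β (crd (.y i) (diff l n q)) = 0 := by
  simp only [crd_diff, diffCrd, map_neg, neg_eq_zero]
  split_ifs with h
  · exact co_mul_ar_of_ne _ (h₁ h)
  · exact co_mul_ar_of_ne _ (h₂ _)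

end

/-- The linear equations for the image of the differential, which are also those for the kernel of
the next differential. -/
structure IsSyz {l n : ℕ} (p : P.Res K (l + 1) n) : Prop where
  eps_eq_zero : ∀ b w, eps (Q := P.table) w (crd b p) = 0
  cf_eq_zero : ∀ b (β : P.Arr), tgt β = z → cf β (crd b p) = 0
  cf_sig : ∀ (i : Fin n) (j : ℕ), i < P.N (l + 1) → P.cl l i ≠ j →
    cf (sig l j) (crd (.y i) p) = 0
  cf_sig_add : ∀ i : Fin n, i < P.N (l + 1) →
    cf (sig l (P.cl l i)) (crd (.y i) p) + cf (rho l i) (crd .eta p) = 0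
  cf_the_add : ∀ (i : Fin n) (hi : P.N (l + 1) ≤ i),
    cf (the l i hi) (crd (.y i) p) + cf (rhoA l) (crd .eta p) = 0

lemma isSyz_diff {l n : ℕ} (hl : l + 1 ≤ P.top) (hn : n ≤ P.N (l + 2))
    (q : P.Res K l (P.N (l + 1))) : IsSyz (diff l n q) where
  eps_eq_zero := eps_diff q
  cf_eq_zero b β hβ := by
    cases b with
    | eta => exact cf_eta_diff_of_ne q (by rintro rfl; cases hβ) (by rintro i rfl; cases hβ)
    | y i => exact cf_y_diff_of_ne q i (by rintro _ rfl; cases hβ) (by rintro _ rfl; cases hβ)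
  cf_sig i j _ hj := cf_y_diff_of_ne q i (fun _ h => hj (by simpa using h.symm)) nofun
  cf_sig_add i hi := by rw [cf_sig_diff hl q i hi, cf_rho_diff hl q ⟨i, hi⟩]; simp
  cf_the_add i hi := by
    rw [cf_the_diff hl q i hi (i.2.trans_le hn), cf_rhoA_diff hl]; simp

end Profile

namespace Profile

open Vtx Arr Deg CategoryTheory QuadraticTable

variable {P : Profile} {K : Type u} [Field K]

lemma Gen.eta_ne_y {n : ℕ} {i : Fin n} : Gen.eta.{u} ≠ Gen.y i := nofun
lemma Gen.y_ne_eta {n : ℕ} {i : Fin n} : Gen.y.{u} i ≠ Gen.eta := nofun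

section

variable {l n : ℕ}

lemma crd_eta_diff_smul_eta (c : P.Al K) :
    crd .eta (diff l n (c • gen (P.genVtx l (P.N (l + 1))) .eta)) = c * arw K (rhoA l) := by
  rw [crd_diff, diffCrd, map_smul, crd_gen_self, smul_eq_mul, mul_assoc,
    Finset.sum_eq_zero fun i _ => ?_, add_zero]
  · exact congrArg _ (ev_tgt_mul_ar (Q := P.table) (K := K) (rhoA l))
  · rw [map_smul, crd_gen_of_ne Gen.y_ne_eta, smul_zero, zero_mul]

lemma crd_y_diff_smul_eta (c : P.Al K) (i : Fin n) :
    crd (.y i) (diff l n (c • gen (P.genVtx l (P.N (l + 1))) .eta)) =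
      if h : i < P.N (l + 1) then 0 else - (c * arw K (the l i (not_lt.mp h))) := by
  rw [crd_diff, diffCrd]
  split_ifs with h
  · rw [map_smul, crd_gen_of_ne Gen.y_ne_eta, smul_zero, zero_mul, neg_zero]
  · rw [map_smul, crd_gen_self, smul_eq_mul, mul_assoc]
    exact congrArg (fun t => - (c * t))
      (ev_tgt_mul_ar (Q := P.table) (K := K) (the l i (not_lt.mp h)))

lemma crd_eta_diff_smul_y (c : P.Al K) (i : Fin (P.N (l + 1))) :
    crd .eta (diff l n (c • gen (P.genVtx l (P.N (l + 1))) (.y i))) = c * arw K (rho l i) := by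
  rw [crd_diff, diffCrd, map_smul, crd_gen_of_ne Gen.eta_ne_y, smul_zero, zero_mul, zero_add,
    Finset.sum_eq_single i]
  · rw [map_smul, crd_gen_self, smul_eq_mul, mul_assoc]
    exact congrArg _ (ev_tgt_mul_ar (Q := P.table) (K := K) (rho l i))
  · intro j _ hj
    rw [map_smul, crd_gen_of_ne (by simpa using hj), smul_zero, zero_mul]
  · simp

lemma crd_y_diff_smul_y (c : P.Al K) (i : Fin (P.N (l + 1))) (j : Fin n) :
    crd (.y j) (diff l n (c • gen (P.genVtx l (P.N (l + 1))) (.y i))) =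
      if (j : ℕ) = i then - (c * arw K (sig l (P.cl l i))) else 0 := by
  rw [crd_diff, diffCrd]
  split_ifs with h h' h'
  · have : (⟨j, h⟩ : Fin (P.N (l + 1))) = i := Fin.ext h'
    rw [this, map_smul, crd_gen_self, smul_eq_mul, mul_assoc, h']
    exact congrArg (fun t => - (c * t))
      (ev_tgt_mul_ar (Q := P.table) (K := K) (sig l (P.cl l i)))
  · rw [map_smul, crd_gen_of_ne, smul_zero, zero_mul, neg_zero]
    simp only [ne_eq, Gen.y.injEq, Fin.ext_iff]
    exact h'
  · omega
  · rw [map_smul, crd_gen_of_ne Gen.eta_ne_y, smul_zero, zero_mul, neg_zero]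

lemma ar_mul_the_eq_zero (α : P.Arr) {i : ℕ} (h : P.N (l + 1) ≤ i) :
    arw K α * arw K (the l i h) = 0 := ar_mul_ar_eq_zero (Q := P.table) nofun

lemma ar_mul_sig_eq_zero {α : P.Arr} (hα : ∀ j, α ≠ zeta l j) (j : ℕ) :
    arw K α * arw (P := P) K (sig l j) = 0 := ar_mul_ar_eq_zero (Q := P.table) fun q hr => by
  cases hr; exact hα _ rfl

lemma zeta_mul_sig (hl : l + 1 ≤ P.top) {i j : ℕ} (hi : i < P.N (l + 1))
    (hj : (sig l j : P.Arr) ∈ P.table.arrows P.verts) :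
    arw (P := P) K (zeta l j) * arw (P := P) K (sig l j) =
      arw (P := P) K (zeta l (P.cl l i)) * arw (P := P) K (sig l (P.cl l i)) := by
  classical
  have h1 : (zeta l j : P.Arr) ∈ P.table.arrows P.verts :=
    mem_arrows_verts.mpr ⟨(mem_arrows_verts.mp hj).2, z_mem_verts⟩
  have h2 : (zeta l (P.cl l i) : P.Arr) ∈ P.table.arrows P.verts :=
    mem_arrows_verts.mpr ⟨x_cl_mem_verts (by omega) hi, z_mem_verts⟩
  refine ext_coeff (fun v => by simp) (fun β => ?_) fun q => ?_
  · rw [co_ar_mul _ h1, co_ar_mul _ h2, eps_ar, eps_ar, ite_self, ite_self]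
  · by_cases hq : q = om l
    · subst hq
      rw [de_ar_mul (Q := P.table) _ h1 (Rel.om l j), de_ar_mul (Q := P.table) _ h2 (Rel.om l _),
        co_ar hj, co_ar (sig_mem hl hi), if_pos rfl, if_pos rfl]
    · rw [de_ar_mul_of_not (Q := P.table), de_ar_mul_of_not (Q := P.table)]
      · rintro β ⟨⟩; exact hq rfl
      · rintro β ⟨⟩; exact hq rfl

/-- Multiples of the generators by paths of length two lie in the image of the differential. For
`zeta L j * sig L j` this holds since these products do not depend on `j`. -/
lemma ar_mul_ar_smul_gen_mem (hl : l + 1 ≤ P.top) (hn : P.N (l + 1) ≤ n) {α β : P.Arr}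
    (hβ : β ∈ P.table.arrows P.verts) (b : Gen.{u} n) :
    (arw K α * arw K β) • (gen _ b : P.Res K (l + 1) n) ∈ LinearMap.range (diff (K := K) l n) := by
  by_cases hs : src β = P.genVtx (l + 1) n b
  swap
  · have h0 : arw K β * P.ide K (P.genVtx (l + 1) n b) = 0 := ar_mul_ev_of_ne (Q := P.table) hs
    rw [← ev_smul_gen, ← mul_smul, mul_assoc, h0, mul_zero, zero_smul]
    exact zero_mem _
  by_cases hr : ∀ q, ¬ Rel α β q
  · have h0 : arw K α * arw K β = 0 := ar_mul_ar_eq_zero (Q := P.table) hr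
    rw [h0, zero_smul]
    exact zero_mem _
  push Not at hr
  obtain ⟨q, hr⟩ := hr
  have hβs : arw K β * P.ide K (P.genVtx (l + 1) n b) = arw K β := by
    rw [← hs]; exact ar_mul_ev_src (Q := P.table) β
  have key1 : β = rhoA l → b = .eta → (arw K α * arw K β) • (gen _ b : P.Res K (l + 1) n) ∈
      LinearMap.range (diff (K := K) l n) := by
    rintro rfl rfl
    refine ⟨arw K α • gen _ .eta, crd_ext fun b => ?_⟩
    cases b with
    | eta =>
      rw [crd_eta_diff_smul_eta, map_smul, crd_gen_self, smul_eq_mul, mul_assoc]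
      exact congrArg _ hβs.symm
    | y i =>
      rw [crd_y_diff_smul_eta, map_smul, crd_gen_of_ne Gen.y_ne_eta, smul_zero]
      split_ifs with h
      · rfl
      · rw [ar_mul_the_eq_zero, neg_zero]
  have key2 : ∀ i, β = rho l i → b = .eta → (arw K α * arw K β) • (gen _ b : P.Res K (l + 1) n) ∈
      LinearMap.range (diff (K := K) l n) := by
    rintro i rfl rfl
    have hi := (rho_mem hl).mp hβ
    refine ⟨arw K α • gen _ (.y ⟨i, hi⟩), crd_ext fun b => ?_⟩
    cases b with
    | eta =>
      rw [crd_eta_diff_smul_y, map_smul, crd_gen_self, smul_eq_mul, mul_assoc]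
      exact congrArg _ hβs.symm
    | y j =>
      rw [crd_y_diff_smul_y, map_smul, crd_gen_of_ne Gen.y_ne_eta, smul_zero,
        ar_mul_sig_eq_zero (by rintro j rfl; cases hr), neg_zero, ite_self]
  cases b with
  | eta =>
    cases β with
    | rhoA l' =>
      obtain rfl : l' = l := by simpa [src, genVtx] using hs
      exact key1 rfl rfl
    | rho l' i =>
      obtain rfl : l' = l := by simpa [src, genVtx] using hs
      exact key2 i rfl rfl
    | phiA => cases hr
    | _ => simp [src, genVtx] at hs
  | y i =>
    cases hr with
    | om L j =>
      simp only [src, genVtx, x.injEq, add_left_inj] at hs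
      obtain ⟨rfl, h0⟩ := hs
      have hi : (i : ℕ) < P.N (L + 1) := by
        by_contra h
        rw [P.cl_of_le (not_lt.mp h)] at h0
        have := (x_mem_verts.mp (mem_arrows_verts.mp hβ).2).2.1
        omega
      refine ⟨- (arw (P := P) K (zeta L (P.cl L i)) • gen _ (.y ⟨i, hi⟩)), crd_ext fun b => ?_⟩
      rw [map_neg, map_neg]
      cases b with
      | eta =>
        rw [crd_eta_diff_smul_y, map_smul, crd_gen_of_ne Gen.eta_ne_y, smul_zero, neg_eq_zero]
        exact ar_mul_ar_eq_zero (Q := P.table) nofun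
      | y j =>
        rw [crd_y_diff_smul_y, map_smul, smul_eq_mul]
        split_ifs with h
        · obtain rfl : j = i := Fin.ext h
          rw [neg_neg, crd_gen_self, mul_assoc, hβs, zeta_mul_sig hl hi hβ]
        · rw [crd_gen_of_ne (by simpa [Fin.ext_iff] using h), mul_zero, neg_zero]
    | _ => simp [src, genVtx] at hs

lemma mem_range_of_degTwo (hl : l + 1 ≤ P.top) (hn : P.N (l + 1) ≤ n) {p : P.Res K (l + 1) n}
    (hp : ∀ b, crd b p ∈ degTwo P.table P.verts K) : p ∈ LinearMap.range (diff (K := K) l n) := by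
  rw [eq_sum_smul_gen p]
  refine sum_mem fun b _ => ?_
  obtain ⟨k, hk⟩ := exists_eq_sum_of_mem_degTwo (hp b)
  rw [hk, Finset.sum_smul]
  refine sum_mem fun α _ => ?_
  rw [Finset.sum_smul]
  refine sum_mem fun β hβ => ?_
  rw [smul_assoc]
  exact Submodule.smul_of_tower_mem _ _ (ar_mul_ar_smul_gen_mem hl hn hβ b)

/-- The equations describe the image of the differential. -/
lemma mem_range_of_isSyz (hl : l + 1 ≤ P.top) (hn : P.N (l + 1) ≤ n) (hn' : n ≤ P.N (l + 2))
    {p : P.Res K (l + 1) n} (hp : IsSyz p) : p ∈ LinearMap.range (diff (K := K) l n) := by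
  classical
  -- the preimage is read off from the coefficients at the generator of type `a (l + 1)`; it is
  -- correct up to terms of degree two
  let f : Gen.{u} (P.N (l + 1)) → P.Al K
    | .eta => cf (rhoA l) (crd .eta p) • P.ide K (a l)
    | .y i => cf (rho l i) (crd .eta p) • P.ide K (x l (P.cl l i))
  have hf : ∀ b, f b * P.ide K (P.genVtx l (P.N (l + 1)) b) = f b := by
    rintro (_ | i) <;> exact (smul_mul_assoc _ _ _).trans (congrArg _ (ev_mul_ev_self _))
  let q : P.Res K l (P.N (l + 1)) := mkPr f hf
  have hq0 : eps (Q := P.table) (a l) (crd .eta q) = cf (rhoA l) (crd .eta p) := by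
    change eps (Q := P.table) (a l) (cf (rhoA l) (crd .eta p) • P.ide K (a l)) = _
    rw [map_smul, eps_ev (Q := P.table) _ _ (a_mem_verts.mpr (by omega)), if_pos rfl, smul_eq_mul,
      mul_one]
  have hq : ∀ i : Fin (P.N (l + 1)), eps (Q := P.table) (x l (P.cl l i)) (crd (.y i) q) =
      cf (rho l i) (crd .eta p) := fun i => by
    change eps (Q := P.table) (x l (P.cl l i)) (cf (rho l i) (crd .eta p) •
      P.ide K (x l (P.cl l i))) = _
    rw [map_smul, eps_ev (Q := P.table) _ _ (x_cl_mem_verts (by omega) i.2), if_pos rfl,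
      smul_eq_mul, mul_one]
  rw [← sub_add_cancel p (diff l n q)]
  refine add_mem (mem_range_of_degTwo hl hn fun b => ⟨fun w => ?_, fun β => ?_⟩)
    (LinearMap.mem_range_self _ _)
  · rw [map_sub, map_sub, hp.eps_eq_zero, eps_diff, sub_zero]
  · have hd := isSyz_diff hl hn' q
    by_cases hz : tgt β = z
    · rw [map_sub, map_sub, hp.cf_eq_zero b β hz, hd.cf_eq_zero b β hz, sub_zero]
    by_cases hs : src β = P.genVtx (l + 1) n b
    swap
    · rw [← crd_mul_ev, co_mul_ev, if_neg]
      exact fun h => hs h.symm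
    by_cases hβ : β ∈ P.table.arrows P.verts
    swap
    · exact co_of_notMem hβ _
    rw [map_sub, map_sub, sub_eq_zero]
    cases b with
    | eta =>
      cases β with
      | rhoA l' =>
        obtain rfl : l' = l := by simpa [src, genVtx] using hs
        exact (hq0.symm.trans (cf_rhoA_diff hl q).symm)
      | rho l' i =>
        obtain rfl : l' = l := by simpa [src, genVtx] using hs
        have hi := (rho_mem hl).mp hβ
        exact ((hq ⟨i, hi⟩).symm.trans (cf_rho_diff hl q ⟨i, hi⟩).symm)
      | phiA => exact absurd rfl hz
      | _ => simp [src, genVtx] at hs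
    | y i =>
      cases β with
      | sig l' j =>
        simp only [src, genVtx, x.injEq, add_left_inj] at hs
        obtain ⟨rfl, h0⟩ := hs
        have hi : (i : ℕ) < P.N (l' + 1) := by
          by_contra h
          rw [P.cl_of_le (not_lt.mp h)] at h0
          have := (x_mem_verts.mp (mem_arrows_verts.mp hβ).2).2.1
          omega
        by_cases hj : P.cl l' i = j
        · subst hj
          refine (eq_neg_of_add_eq_zero_left (hp.cf_sig_add i hi)).trans
            (Eq.trans ?_ (eq_neg_of_add_eq_zero_left (hd.cf_sig_add i hi)).symm)
          rw [cf_rho_diff hl q ⟨i, hi⟩, hq ⟨i, hi⟩]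
        · exact (hp.cf_sig i j hi hj).trans (hd.cf_sig i j hi hj).symm
      | the l' i' h =>
        simp only [src, genVtx, x.injEq, add_left_inj] at hs
        obtain ⟨rfl, h0⟩ := hs
        obtain rfl : i' = i := by
          rcases lt_or_ge (i : ℕ) (P.N (l' + 1)) with hi | hi
          · rw [P.cl_of_lt hi] at h0; omega
          · rwa [P.cl_of_le hi] at h0
        refine (eq_neg_of_add_eq_zero_left (hp.cf_the_add i h)).trans
          (Eq.trans ?_ (eq_neg_of_add_eq_zero_left (hd.cf_the_add i h)).symm)
        rw [cf_rhoA_diff hl q, hq0]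
      | phiX => exact absurd rfl hz
      | zeta => exact absurd rfl hz
      | _ => simp [src, genVtx] at hs

end

end Profile

namespace Profile

open Vtx Arr Deg CategoryTheory QuadraticTable

variable {P : Profile} {K : Type u} [Field K]

/-! ### Exactness -/

section

variable {l n : ℕ}

lemma rel_rho_inj {β β' : P.Arr} {L i i' : ℕ} {d : Deg} (h : Rel β (rho L i) d)
    (h' : Rel β' (rho L i') d) : i = i' := by
  cases h <;> cases h' <;> rfl

lemma df_eta_diff (d : Deg) (q : P.Res K l (P.N (l + 1))) :
    df P d (crd .eta (diff l n q)) = df P d (crd .eta q * arw K (rhoA l)) +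
      ∑ i : Fin (P.N (l + 1)), df P d (crd (.y i) q * arw K (rho l i)) := by
  simp only [crd_diff, diffCrd, map_add, map_sum]

lemma df_eta_diff_of_rel (hl : l + 1 ≤ P.top) {d : Deg} {β : P.Arr} {i : Fin (P.N (l + 1))}
    (h : Rel β (rho l i) d) (q : P.Res K l (P.N (l + 1))) :
    df P d (crd .eta (diff l n q)) = df P d (crd .eta q * arw K (rhoA l)) +
      cf β (crd (.y i) q) := by
  rw [df_eta_diff, Finset.sum_eq_single i, de_mul_ar (Q := P.table) _ ((rho_mem hl).mpr i.2) h]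
  · intro j _ hj
    exact de_mul_ar_of_not (Q := P.table) _ fun β' h' => hj (Fin.ext (rel_rho_inj h' h))
  · simp

lemma df_mul_rhoA_of_not {d : Deg} (h : ∀ β, ¬ Rel β (rhoA l : P.Arr) d) (y : P.Al K) :
    df P d (y * arw K (rhoA l)) = 0 := de_mul_ar_of_not (Q := P.table) _ h

lemma df_mul_rhoA (hl : l + 1 ≤ P.top) {d : Deg} {β : P.Arr} (h : Rel β (rhoA l : P.Arr) d)
    (y : P.Al K) : df P d (y * arw K (rhoA l)) = cf β y :=
  de_mul_ar (Q := P.table) _ (rhoA_mem hl) h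

/-- Each equation of `IsSyz` is the vanishing of one coefficient of `diff p`. -/
lemma isSyz_of_diff_eq_zero (hl : l + 2 ≤ P.top) (hn : P.N (l + 2) ≤ n)
    {p : P.Res K (l + 1) (P.N (l + 2))} (hp : diff (l + 1) n p = 0) : IsSyz p := by
  have h0 : ∀ b, crd b (diff (l + 1) n p) = 0 := fun b => by rw [hp, map_zero]
  have hmono := P.mono (show l + 1 ≤ l + 2 by omega)
  have hd : ∀ (d : Deg) {β : P.Arr} {i : Fin (P.N (l + 2))}, Rel β (rho (l + 1) i) d →
      df P d (crd .eta p * arw K (rhoA (l + 1))) + cf β (crd (.y i) p) = 0 := fun d β i h => by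
    rw [← df_eta_diff_of_rel hl h, h0, map_zero]
  refine ⟨fun b w => ?_, fun b β hβ => ?_, fun i j hi hj => ?_, fun i hi => ?_, fun i hi => ?_⟩
  · by_cases hw : P.genVtx (l + 1) _ b = w
    · subst hw
      cases b with
      | eta => rw [genVtx, ← cf_rhoA_diff (n := n) hl, h0, map_zero]
      | y i => rw [genVtx, ← cf_rho_diff (n := n) hl, h0, map_zero]
    · exact eps_crd_of_ne p hw
  · by_cases hs : src β = P.genVtx (l + 1) _ b
    swap
    · rw [← crd_mul_ev, co_mul_ev, if_neg]
      exact fun h => hs h.symm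
    cases b with
    | eta =>
      cases β with
      | phiA L h =>
        obtain rfl : L = l + 1 := by simpa [src, genVtx] using hs
        have h1 := df_eta_diff (n := n) (betA (l + 1)) p
        rw [h0, map_zero, df_mul_rhoA hl (Rel.betA (l + 1) h), Finset.sum_eq_zero, add_zero] at h1
        · exact h1.symm
        · exact fun i _ => de_mul_ar_of_not (Q := P.table) _ nofun
      | _ => simp [src, tgt, genVtx] at hs hβ
    | y i =>
      cases β with
      | phiX L j =>
        simp only [src, genVtx, x.injEq] at hs
        obtain ⟨rfl, rfl⟩ := hs
        have h1 := hd _ (Rel.bet (l + 1) i _ rfl)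
        rwa [df_mul_rhoA_of_not (by rintro _ ⟨⟩), zero_add] at h1
      | zeta L j =>
        simp only [src, genVtx, x.injEq] at hs
        obtain ⟨rfl, rfl⟩ := hs
        have h1 := congrArg (df P (om (l + 1))) (h0 (.y ⟨i, i.2.trans_le hn⟩))
        rw [crd_diff, diffCrd, dif_pos i.2, map_neg, map_zero, neg_eq_zero,
          de_mul_ar (Q := P.table) _ (sig_mem hl i.2) (Rel.om (l + 1) _)] at h1
        exact h1
      | _ => simp [src, tgt, genVtx] at hs hβ
  · have h1 := hd _ (Rel.kap_sig l i j hi)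
    rwa [df_mul_rhoA_of_not (by rintro β ⟨⟩; exact hj ‹_›), zero_add] at h1
  · have h1 := hd _ (Rel.kap_sig l i (P.cl l i) hi)
    rwa [df_mul_rhoA hl (Rel.kap_rho l i _ hi rfl), add_comm] at h1
  · have h1 := hd _ (Rel.tau_the l i hi)
    rwa [df_mul_rhoA hl (Rel.tau_rhoA l i hi i.2), add_comm] at h1

lemma diff_eq_zero_of_isSyz (hl : l + 2 ≤ P.top) {p : P.Res K (l + 1) (P.N (l + 2))}
    (hp : IsSyz p) : diff (l + 1) n p = 0 := by
  classical
  have hmono := P.mono (show l + 1 ≤ l + 2 by omega)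
  have hco : ∀ b (α β : P.Arr), co (Q := P.table) β (crd b p * arw K α) = 0 := fun b α β =>
    (mul_mem_degTwo_of_mem (hp.eps_eq_zero b) (ar_mem_arrowIdeal α)).2 β
  refine crd_ext fun b => ?_
  rw [map_zero]
  refine ext_coeff (fun w => by rw [eps_diff, map_zero]) (fun β => ?_) fun d => ?_
  · rw [crd_diff, map_zero]
    cases b with
    | eta => simp only [diffCrd, map_add, map_sum, hco, Finset.sum_const_zero, add_zero]
    | y i => simp only [diffCrd]; split_ifs <;> rw [map_neg, hco, neg_zero]
  · rw [map_zero]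
    cases b with
    | eta =>
      by_cases h : ∃ (i : Fin (P.N (l + 2))) (β : P.Arr), Rel β (rho (l + 1) i) d
      · obtain ⟨i, β, h⟩ := h
        refine (df_eta_diff_of_rel hl h p).trans ?_
        cases h with
        | bet _ _ j hj =>
          rw [df_mul_rhoA_of_not (by rintro _ ⟨⟩), zero_add, cf, hp.cf_eq_zero _ _ rfl]
        | tau_the _ _ h =>
          rw [df_mul_rhoA hl (Rel.tau_rhoA l i h i.2), add_comm, hp.cf_the_add]
        | kap_sig _ _ j h =>
          by_cases hj : P.cl l i = j
          · subst hj
            rw [df_mul_rhoA hl (Rel.kap_rho l i _ h rfl), add_comm, hp.cf_sig_add i h]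
          · rw [df_mul_rhoA_of_not (by rintro β ⟨⟩; exact hj ‹_›), zero_add, hp.cf_sig i j h hj]
      · refine (df_eta_diff d p).trans ?_
        rw [Finset.sum_eq_zero fun i _ => de_mul_ar_of_not (Q := P.table) _ fun β hβ =>
          h ⟨i, β, hβ⟩, add_zero]
        by_cases h' : ∃ β, Rel β (rhoA (l + 1) : P.Arr) d
        · obtain ⟨β, h'⟩ := h'
          rw [df_mul_rhoA hl h']
          cases h' with
          | betA => exact hp.cf_eq_zero _ _ rfl
          | tau_rhoA _ i h₁ h₂ => exact absurd ⟨⟨i, h₂⟩, _, Rel.tau_the l i h₁⟩ h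
          | kap_rho _ i j h₁ hj =>
            exact absurd ⟨⟨i, h₁.trans_le hmono⟩, _, Rel.kap_sig l i j h₁⟩ h
        · exact df_mul_rhoA_of_not (fun β hβ => h' ⟨β, hβ⟩) _
    | y i =>
      rw [crd_diff]
      simp only [diffCrd]
      split_ifs with hi
      · rw [map_neg, neg_eq_zero]
        by_cases h : ∃ β, Rel β (sig (l + 1) (P.cl (l + 1) i) : P.Arr) d
        · obtain ⟨β, h⟩ := h
          rw [de_mul_ar (Q := P.table) _ (sig_mem hl hi) h]
          cases h
          exact hp.cf_eq_zero _ _ rfl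
        · exact de_mul_ar_of_not (Q := P.table) _ fun β hβ => h ⟨β, hβ⟩
      · rw [map_neg, neg_eq_zero]
        exact de_mul_ar_of_not (Q := P.table) _ nofun

/-- The sequence of the differentials is exact. -/
lemma ker_diff (hl : l + 2 ≤ P.top) (hn : P.N (l + 2) ≤ n) :
    LinearMap.ker (diff (P := P) (K := K) (l + 1) n) = LinearMap.range (diff l (P.N (l + 2))) := by
  ext p
  rw [LinearMap.mem_ker]
  refine ⟨fun h => mem_range_of_isSyz (by omega) (P.mono (by omega)) le_rfl
    (isSyz_of_diff_eq_zero hl hn h), ?_⟩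
  rintro ⟨q, rfl⟩
  exact diff_eq_zero_of_isSyz hl (isSyz_diff (by omega) le_rfl q)

/-- The first differential is injective. -/
lemma ker_diff_zero (hl : 1 ≤ P.top) : LinearMap.ker (diff (P := P) (K := K) 0 n) = ⊥ := by
  refine (Submodule.eq_bot_iff _).mpr fun p hp => crd_ext fun b => ?_
  have hN : P.N (0 + 1) = 0 := P.N_eq_zero 1 P.one_le_bot
  have hbot := P.one_le_bot
  cases b with
  | y i => exact absurd (i.2.trans_eq hN) (Nat.not_lt_zero _)
  | eta =>
    rw [map_zero]
    refine ext_coeff (fun w => ?_) (fun β => ?_) fun d => ?_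
    · by_cases hw : a 0 = w
      · subst hw
        rw [← cf_rhoA_diff (n := n) hl, LinearMap.mem_ker.mp hp]
        simp
      · exact (eps_crd_of_ne p (b := .eta) hw).trans (map_zero _).symm
    · classical
      rw [← crd_mul_ev, co_mul_ev, if_neg, map_zero]
      intro h
      cases β <;> simp [src, genVtx] at h
      omega
    · classical
      rw [← crd_mul_ev, de_mul_ev, if_neg, map_zero]
      intro h
      cases d <;> simp [start, genVtx] at h

end

end Profile

open CategoryTheory

namespace Profile

open Vtx Arr Deg QuadraticTable

variable {P : Profile} {K : Type u} [Field K]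

/-! ### Modules of given projective dimension -/

section

variable {l n : ℕ}

lemma range_diff_le_rad :
    LinearMap.range (diff (P := P) (K := K) l n) ≤ P.rd K (P.Res K (l + 1) n) := by
  rintro _ ⟨q, rfl⟩
  exact mem_rad_Pr (eps_diff q)

/-- The image of the differential in level `l` has projective dimension `l`. -/
lemma hasProjectiveDimensionLT_range_diff (hl : l + 1 ≤ P.top) (hn : P.N (l + 1) ≤ n) :
    HasProjectiveDimensionLT
      (ModuleCat.of (P.Al K) (LinearMap.range (diff (P := P) (K := K) l n))) (l + 1) ∧
    ¬ HasProjectiveDimensionLT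
      (ModuleCat.of (P.Al K) (LinearMap.range (diff (P := P) (K := K) l n))) l := by
  induction l generalizing n with
  | zero =>
    have hs := (diff (P := P) (K := K) 0 n).surjective_rangeRestrict
    refine ⟨hasProjectiveDimensionLT_succ_of_ker _ hs ?_, fun h => ?_⟩
    · rw [hasProjectiveDimensionLT_zero_iff_isZero]
      have : Subsingleton (LinearMap.ker (diff (P := P) (K := K) 0 n).rangeRestrict) := by
        rw [LinearMap.ker_rangeRestrict, ker_diff_zero hl]
        infer_instance
      exact ModuleCat.isZero_of_subsingleton _
    · rw [hasProjectiveDimensionLT_zero_iff_isZero] at h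
      have h1 := ModuleCat.subsingleton_of_isZero h
      have h2 : diff (P := P) (K := K) 0 n (gen _ .eta) = 0 :=
        congrArg Subtype.val (h1.elim ⟨_, LinearMap.mem_range_self _ _⟩ 0)
      have h3 := cf_rhoA_diff (n := n) hl (gen (K := K) _ .eta)
      classical
      rw [h2, map_zero, map_zero, crd_gen_self,
        show P.genVtx 0 (P.N (0 + 1)) .eta = Vtx.a 0 from rfl,
        eps_ev (Q := P.table) _ _ (a_mem_verts.mpr (by omega)), if_pos rfl] at h3
      exact zero_ne_one h3
  | succ l ih =>
    have hs := (diff (P := P) (K := K) (l + 1) n).surjective_rangeRestrict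
    have hk : LinearMap.ker (diff (P := P) (K := K) (l + 1) n).rangeRestrict =
        LinearMap.range (diff l (P.N (l + 2))) := by
      rw [LinearMap.ker_rangeRestrict, ker_diff hl hn]
    obtain ⟨ih1, ih2⟩ := ih (n := P.N (l + 2)) (by omega) (P.mono (by omega))
    rw [← hasProjectiveDimensionLT_congr (LinearEquiv.ofEq _ _ hk)] at ih1 ih2
    refine ⟨hasProjectiveDimensionLT_succ_of_ker _ hs ih1, fun h => ih2 ?_⟩
    cases l with
    | zero =>
      have : Module.Projective (P.Al K) (LinearMap.range (diff (P := P) (K := K) (0 + 1) n)) :=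
        (IsProjective.iff_projective _).mpr (projective_iff_hasProjectiveDimensionLT_one.mpr h)
      have h0 := ker_eq_bot_of_projective _ hs (by rw [hk]; exact range_diff_le_rad)
      rw [hasProjectiveDimensionLT_zero_iff_isZero]
      have : Subsingleton (LinearMap.ker (diff (P := P) (K := K) (0 + 1) n).rangeRestrict) := by
        rw [h0]
        infer_instance
      exact ModuleCat.isZero_of_subsingleton _
    | succ l => exact hasProjectiveDimensionLT_ker_of_succ _ hs h

end

variable (P K) in
/-- The module in level `l + 1`: the cokernel of the differential with `n = N (l + 1)`, so that all
generators other than the first have the type `x (l + 1) 0`. -/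
abbrev TreeMod (l : ℕ) : Type u :=
  P.Res K (l + 1) (P.N (l + 1)) ⧸ LinearMap.range (diff (P := P) (K := K) l (P.N (l + 1)))

lemma projectiveDimension_treeMod {l : ℕ} (hl : l + 2 ≤ P.top) :
    projectiveDimension (ModuleCat.of (P.Al K) (P.TreeMod K (l + 1))) =
      ((l + 2 : ℕ) : WithBot ℕ∞) := by
  obtain ⟨h1, h2⟩ := hasProjectiveDimensionLT_range_diff (K := K) (n := P.N (l + 2)) hl le_rfl
  have hs := (LinearMap.range (diff (P := P) (K := K) (l + 1) (P.N (l + 2)))).mkQ_surjective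
  have hk := (LinearMap.range (diff (P := P) (K := K) (l + 1) (P.N (l + 2)))).ker_mkQ
  rw [← hasProjectiveDimensionLT_congr (LinearEquiv.ofEq _ _ hk)] at h1 h2
  refine le_antisymm ?_ ?_
  · rw [projectiveDimension_le_iff]
    exact hasProjectiveDimensionLT_succ_of_ker _ hs h1
  · rw [projectiveDimension_ge_iff]
    exact fun h => h2 (hasProjectiveDimensionLT_ker_of_succ _ hs h)

end Profile

namespace Profile

open Vtx Arr Deg CategoryTheory QuadraticTable

variable {P : Profile} {K : Type u} [Field K]

/-! ### Bases of the modules -/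

/-- The index of a generator in an arbitrary universe. -/
def Gen.up {n : ℕ} : Gen.{0} n → Gen.{u} n
  | .eta => .eta
  | .y i => .y i

lemma Gen.up_injective {n : ℕ} : Function.Injective (Gen.up.{u} (n := n)) := by
  rintro (_ | i) (_ | j) h <;> simp_all [Gen.up]

variable (P) in
/-- The arrow `α` starts at the type of the generator `b` and gives a further basis element. -/
structure IsLow (l : ℕ) (b : Gen.{0} (P.N (l + 1))) (α : P.Arr) : Prop where
  mem : α ∈ P.table.arrows P.verts
  src_eq : src α = P.genVtx (l + 1) (P.N (l + 1)) b
  ne_rhoA : ∀ L, α ≠ rhoA L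
  ne_rho : ∀ L i, α ≠ rho L i

variable (P) in
/-- The index set of a basis of the module in level `l + 1`: the generators, and the products of
the generators with the arrows that start at their types, other than the arrows `rhoA` and
`rho`. -/
inductive Node (l : ℕ)
  | top (b : Gen.{0} (P.N (l + 1)))
  | low (b : Gen.{0} (P.N (l + 1))) (α : P.Arr) (h : P.IsLow l b α)

instance (l : ℕ) : Finite (P.Node l) := by
  refine Finite.of_injective (β := Gen.{0} (P.N (l + 1)) × Option (P.table.arrows P.verts))
    (fun n => match n with
      | .top b => (b, none)
      | .low b α h => (b, some ⟨α, h.mem⟩)) ?_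
  rintro (b | ⟨b, α, h⟩) (b' | ⟨b', α', h'⟩) he <;> simp_all

section

variable {l : ℕ}

/-- The basis elements, before passing to the quotient. -/
def nodeElt : P.Node l → P.Res K (l + 1) (P.N (l + 1))
  | .top b => gen _ b.up
  | .low b α _ => arw K α • gen _ b.up

open Classical in
/-- The coefficients with respect to the basis, as functionals that vanish on the image of the
differential: since `rho l i` times the first generator agrees with `sig l (cl l i)` times the
`i`-th generator in the quotient, the coefficients of these two elements are added. -/
def nodeDual : P.Node l → P.Res K (l + 1) (P.N (l + 1)) →ₗ[K] K
  | .top b => eps (Q := P.table) (P.genVtx (l + 1) _ b) ∘ₗ (crd b.up).restrictScalars K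
  | .low .eta α _ => cf α ∘ₗ (crd .eta).restrictScalars K
  | .low (.y i) α _ => cf α ∘ₗ (crd (.y i)).restrictScalars K +
      if α = sig l (P.cl l i) then cf (rho l i) ∘ₗ (crd .eta).restrictScalars K else 0

lemma genVtx_up {L n : ℕ} (b : Gen.{0} n) : P.genVtx L n b.up = P.genVtx L n b := by
  cases b <;> rfl

lemma genVtx_mem (hl : l + 1 ≤ P.top) (b : Gen.{0} (P.N (l + 1))) :
    P.genVtx (l + 1) (P.N (l + 1)) b ∈ P.verts := by
  cases b with
  | eta => exact a_mem_verts.mpr hl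
  | y i => exact x_cl_mem_verts hl (i.2.trans_le (P.mono (Nat.le_succ _)))

lemma crd_nodeElt_top_self (b : Gen.{0} (P.N (l + 1))) :
    crd b.up (nodeElt (K := K) (Node.top b : P.Node l)) = P.ide K (P.genVtx (l + 1) _ b) := by
  rw [nodeElt, crd_gen_self, genVtx_up]

lemma crd_nodeElt_low_self (b : Gen.{0} (P.N (l + 1))) {α : P.Arr} (h : P.IsLow l b α) :
    crd b.up (nodeElt (K := K) (Node.low b α h)) = arw K α := by
  rw [nodeElt, map_smul, crd_gen_self, genVtx_up, ← h.src_eq]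
  exact ar_mul_ev_src (Q := P.table) α

lemma crd_nodeElt_top_of_ne {b : Gen.{u} (P.N (l + 1))} {b' : Gen.{0} (P.N (l + 1))}
    (h : b ≠ b'.up) : crd b (nodeElt (K := K) (Node.top b' : P.Node l)) = 0 := crd_gen_of_ne h

lemma crd_nodeElt_low_of_ne {b : Gen.{u} (P.N (l + 1))} {b' : Gen.{0} (P.N (l + 1))} {α : P.Arr}
    (h : P.IsLow l b' α) (hb : b ≠ b'.up) : crd b (nodeElt (K := K) (Node.low b' α h)) = 0 := by
  rw [nodeElt, map_smul, crd_gen_of_ne hb, smul_zero]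

lemma cf_rho_nodeElt (i : ℕ) (n : P.Node l) :
    cf (rho l i) (crd .eta (nodeElt (K := K) n)) = 0 := by
  classical
  rcases n with (_ | j) | ⟨_ | j, α, h⟩
  · rw [show Gen.eta = Gen.up.{u} (Gen.eta (n := P.N (l + 1))) from rfl, crd_nodeElt_top_self]
    exact co_ev (Q := P.table) _ _
  · rw [crd_nodeElt_top_of_ne Gen.eta_ne_y, map_zero]
  · rw [show Gen.eta = Gen.up.{u} (Gen.eta (n := P.N (l + 1))) from rfl, crd_nodeElt_low_self]
    rw [cf, co_ar h.mem, if_neg (h.ne_rho l i).symm]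
  · rw [crd_nodeElt_low_of_ne h Gen.eta_ne_y, map_zero]

lemma nodeDual_top (b : Gen.{0} (P.N (l + 1))) (p : P.Res K (l + 1) (P.N (l + 1))) :
    nodeDual (Node.top b) p = eps (Q := P.table) (P.genVtx (l + 1) _ b) (crd b.up p) := rfl

open Classical in
lemma nodeDual_low (b : Gen.{0} (P.N (l + 1))) {α : P.Arr} (h : P.IsLow l b α)
    {p : P.Res K (l + 1) (P.N (l + 1))} (hp : ∀ i, cf (rho l i) (crd .eta p) = 0) :
    nodeDual (Node.low b α h) p = cf α (crd b.up p) := by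
  cases b with
  | eta => rfl
  | y i =>
    change cf α (crd _ p) + (if _ then cf (rho l i) ∘ₗ _ else 0 : _ →ₗ[K] K) p = _
    split_ifs
    · exact (congrArg _ (hp i)).trans (add_zero _)
    · exact add_zero _

open Classical in
lemma nodeDual_low_of_ne (b : Gen.{0} (P.N (l + 1))) {α : P.Arr} (h : P.IsLow l b α)
    (hα : ∀ i, b = .y i → α ≠ sig l (P.cl l i)) (p : P.Res K (l + 1) (P.N (l + 1))) :
    nodeDual (Node.low b α h) p = cf α (crd b.up p) := by
  cases b with
  | eta => rfl
  | y i =>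
    change cf α (crd _ p) + (if _ then cf (rho l i) ∘ₗ _ else 0 : _ →ₗ[K] K) p = _
    rw [if_neg (hα i rfl)]
    exact add_zero _

open Classical in
lemma nodeDual_sig (i : Fin (P.N (l + 1))) (h : P.IsLow l (.y i) (sig l (P.cl l i)))
    (p : P.Res K (l + 1) (P.N (l + 1))) : nodeDual (Node.low (.y i) _ h) p =
      cf (sig l (P.cl l i)) (crd (.y i) p) + cf (rho l i) (crd .eta p) := by
  change _ + (if _ then cf (rho l i) ∘ₗ _ else 0 : _ →ₗ[K] K) p = _
  rw [if_pos rfl]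
  rfl

open Classical in
lemma nodeDual_nodeElt (hl : l + 1 ≤ P.top) (n n' : P.Node l) :
    nodeDual n (nodeElt (K := K) n') = if n = n' then 1 else 0 := by
  rcases n with b | ⟨b, α, h⟩
  · rw [nodeDual_top]
    rcases n' with b' | ⟨b', α', h'⟩
    · by_cases hb : b = b'
      · subst hb
        rw [crd_nodeElt_top_self, eps_ev (Q := P.table) _ _ (genVtx_mem hl b), if_pos rfl,
          if_pos rfl]
      · rw [crd_nodeElt_top_of_ne fun h => hb (Gen.up_injective h), map_zero, if_neg]
        simpa using hb
    · rw [if_neg nofun]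
      by_cases hb : b = b'
      · subst hb
        rw [crd_nodeElt_low_self]
        exact eps_ar (Q := P.table) _ _
      · rw [crd_nodeElt_low_of_ne h' fun h => hb (Gen.up_injective h), map_zero]
  · rw [nodeDual_low b h fun i => cf_rho_nodeElt i n']
    rcases n' with b' | ⟨b', α', h'⟩
    · rw [if_neg nofun]
      by_cases hb : b = b'
      · subst hb
        rw [crd_nodeElt_top_self]
        exact co_ev (Q := P.table) _ _
      · rw [crd_nodeElt_top_of_ne fun h => hb (Gen.up_injective h), map_zero]
    · by_cases hb : b = b'
      · subst hb
        rw [crd_nodeElt_low_self, cf, co_ar h'.mem]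
        simp
      · rw [crd_nodeElt_low_of_ne h' fun h => hb (Gen.up_injective h), map_zero, if_neg]
        simp [hb]

lemma isLow_y (hl : l + 1 ≤ P.top) {i : Fin (P.N (l + 1))} :
    P.IsLow l (.y i) (sig l (P.cl l i)) :=
  ⟨sig_mem hl i.2, by rw [genVtx, P.cl_of_lt i.2]; rfl, nofun, nofun⟩

lemma nodeDual_diff (hl : l + 1 ≤ P.top) (n : P.Node l) (q : P.Res K l (P.N (l + 1))) :
    nodeDual n (diff l (P.N (l + 1)) q) = 0 := by
  rcases n with b | ⟨b, α, h⟩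
  · exact eps_diff q _ _
  · by_cases hα : ∃ i, b = .y i ∧ α = sig l (P.cl l i)
    · obtain ⟨i, rfl, rfl⟩ := hα
      rw [nodeDual_sig]
      exact (isSyz_diff hl (P.mono (by omega)) q).cf_sig_add i i.2
    · push Not at hα
      rw [nodeDual_low_of_ne b h hα]
      cases b with
      | eta => exact cf_eta_diff_of_ne q (h.ne_rhoA l) (h.ne_rho l)
      | y i =>
        exact cf_y_diff_of_ne q i (fun _ => hα i rfl) fun h => absurd i.2 (not_lt.mpr h)

lemma mem_range_of_nodeDual (hl : l + 1 ≤ P.top) {p : P.Res K (l + 1) (P.N (l + 1))}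
    (hp : ∀ n, nodeDual n p = 0) : p ∈ LinearMap.range (diff (K := K) l (P.N (l + 1))) := by
  have hup : ∀ b : Gen.{u} (P.N (l + 1)), ∃ b' : Gen.{0} (P.N (l + 1)), b'.up = b := by
    rintro (_ | i)
    · exact ⟨.eta, rfl⟩
    · exact ⟨.y i, rfl⟩
  have hlow : ∀ (b : Gen.{0} (P.N (l + 1))) (α : P.Arr), (∀ L, α ≠ rhoA L) →
      (∀ L i, α ≠ rho L i) → (∀ i, b = .y i → α ≠ sig l (P.cl l i)) → cf α (crd b.up p) = 0 := by
    intro b α h1 h2 h3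
    by_cases hs : src α = P.genVtx (l + 1) _ b
    · by_cases hα : α ∈ P.table.arrows P.verts
      · rw [← nodeDual_low_of_ne b ⟨hα, hs, h1, h2⟩ h3, hp]
      · exact co_of_notMem hα _
    · classical
      rw [← crd_mul_ev, co_mul_ev, if_neg]
      exact fun h => hs (h.symm.trans (genVtx_up b))
  refine mem_range_of_isSyz hl le_rfl (P.mono (by omega)) ⟨fun b w => ?_, fun b β hβ => ?_,
    fun i j _ hj => ?_, fun i hi => ?_, fun i hi => absurd i.2 (not_lt.mpr hi)⟩
  · obtain ⟨b, rfl⟩ := hup b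
    by_cases hw : P.genVtx (l + 1) _ b.up = w
    · subst hw
      rw [genVtx_up]
      exact hp (.top b)
    · exact eps_crd_of_ne p hw
  · obtain ⟨b, rfl⟩ := hup b
    exact hlow b β (by rintro L rfl; cases hβ) (by rintro L i rfl; cases hβ)
      (by rintro i - rfl; cases hβ)
  · refine hlow (.y i) (sig l j) nofun nofun fun i' h h' => hj ?_
    obtain rfl : i = i' := by simpa using h
    simpa using h'.symm
  · have := hp (.low (.y i) _ (isLow_y hl))
    rwa [nodeDual_sig] at this

/-- The basis elements of the module in level `l + 1`. -/
def nodeVec (n : P.Node l) : P.TreeMod K l := Submodule.Quotient.mk (nodeElt n)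

lemma sum_nodeVec (c : P.Node l →₀ K) :
    (c.sum fun n k => algebraMap K (P.Al K) k • nodeVec (K := K) n) =
      Submodule.Quotient.mk (c.sum fun n k => k • nodeElt (K := K) n) := by
  rw [Finsupp.sum, Finsupp.sum, ← Submodule.mkQ_apply, map_sum]
  refine Finset.sum_congr rfl fun n _ => ?_
  rw [← algebraMap_smul (P.Al K) (c n) (nodeElt n), map_smul]
  rfl

lemma nodeDual_sum (hl : l + 1 ≤ P.top) (c : P.Node l →₀ K) (n : P.Node l) :
    nodeDual n (c.sum fun n k => k • nodeElt (K := K) n) = c n := by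
  classical
  rw [map_finsuppSum]
  simp only [map_smul, nodeDual_nodeElt hl, smul_eq_mul, mul_ite, mul_one, mul_zero]
  simp [eq_comm]

lemma eq_zero_of_sum_nodeVec (hl : l + 1 ≤ P.top) (c : P.Node l →₀ K)
    (h : (c.sum fun n k => algebraMap K (P.Al K) k • nodeVec (K := K) n) = 0) : c = 0 := by
  rw [sum_nodeVec, Submodule.Quotient.mk_eq_zero] at h
  obtain ⟨q, hq⟩ := h
  ext n
  rw [← nodeDual_sum hl c n, ← hq, nodeDual_diff hl, Finsupp.zero_apply]

lemma mk_eq_sum_nodeVec (hl : l + 1 ≤ P.top) (p : P.Res K (l + 1) (P.N (l + 1))) :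
    (Submodule.Quotient.mk p : P.TreeMod K l) =
      (Finsupp.equivFunOnFinite.symm fun n => nodeDual n p).sum
        fun n k => algebraMap K (P.Al K) k • nodeVec (K := K) n := by
  rw [sum_nodeVec, Submodule.Quotient.eq]
  refine mem_range_of_nodeDual hl fun n => ?_
  rw [map_sub, nodeDual_sum hl]
  simp

end

end Profile

namespace Profile

open Vtx Arr Deg CategoryTheory QuadraticTable

variable {P : Profile} {K : Type u} [Field K]

/-! ### Layers and the tree -/

section

variable {l : ℕ}

/-- The type of a basis element. -/
def nodeVtx : P.Node l → Vtx
  | .top b => P.genVtx (l + 1) _ b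
  | .low _ α _ => tgt α

/-- The layer of a basis element. -/
def nodeLayer : P.Node l → ℕ
  | .top _ => 0
  | .low _ _ _ => 1

lemma nodeVtx_mem (hl : l + 1 ≤ P.top) (n : P.Node l) : nodeVtx n ∈ P.verts := by
  rcases n with b | ⟨b, α, h⟩
  · exact genVtx_mem hl b
  · exact (mem_arrows_verts.mp h.mem).2

lemma ev_smul_nodeVec (n : P.Node l) :
    P.ide K (nodeVtx n) • nodeVec (K := K) n = nodeVec n := by
  rcases n with b | ⟨b, α, h⟩
  · refine congrArg Submodule.Quotient.mk ?_
    rw [nodeVtx, ← genVtx_up]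
    exact ev_smul_gen (Q := P.table) b.up
  · refine congrArg Submodule.Quotient.mk ?_
    change P.ide K (tgt α) • arw K α • gen _ b.up = _
    rw [← mul_smul]
    exact congrArg (· • gen _ b.up) (ev_tgt_mul_ar (Q := P.table) (K := K) α)

lemma nodeVec_low_mem_rad (b : Gen.{0} (P.N (l + 1))) {α : P.Arr} (h : P.IsLow l b α) :
    nodeVec (.low b α h) ∈ P.rd K (P.TreeMod K l) :=
  ar_smul_mem_rad (Q := P.table) (S := P.verts) (K := K) α (nodeVec (.top b))

lemma nodeDual_top_eq_zero (hl : l + 1 ≤ P.top) {p : P.Res K (l + 1) (P.N (l + 1))}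
    (hp : (Submodule.Quotient.mk p : P.TreeMod K l) ∈ P.rd K (P.TreeMod K l))
    (b : Gen.{0} (P.N (l + 1))) : nodeDual (.top b) p = 0 := by
  obtain ⟨m, hm⟩ := mem_rad.mp hp
  choose r hr using fun α => Submodule.Quotient.mk_surjective _ (m α)
  have h1 : p - ∑ α ∈ P.table.arrows P.verts, arw K α • r α ∈
      LinearMap.range (diff (K := K) l (P.N (l + 1))) := by
    rw [← Submodule.Quotient.eq, hm, ← Submodule.mkQ_apply, map_sum]
    exact Finset.sum_congr rfl fun α _ => by rw [map_smul, Submodule.mkQ_apply, hr]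
  obtain ⟨q, hq⟩ := h1
  have h2 := nodeDual_diff hl (.top b) q
  rw [hq, map_sub, map_sum, Finset.sum_eq_zero, sub_zero] at h2
  · exact h2
  · intro α _
    rw [nodeDual_top, map_smul, smul_eq_mul]
    exact eps_ar_mul (Q := P.table) _ _ _

/-- The radical of the module is annihilated by the radical of the algebra. -/
lemma smul_eq_zero_of_mem_rad (hl : l + 1 ≤ P.top) {c : P.Al K}
    (hc : c ∈ arrowIdeal P.table P.verts K)
    {m : P.TreeMod K l} (hm : m ∈ P.rd K (P.TreeMod K l)) : c • m = 0 := by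
  obtain ⟨r, rfl⟩ := mem_rad.mp hm
  rw [Finset.smul_sum]
  refine Finset.sum_eq_zero fun α _ => ?_
  obtain ⟨p, hp⟩ := Submodule.Quotient.mk_surjective _ (r α)
  rw [← hp, ← Submodule.Quotient.mk_smul, ← Submodule.Quotient.mk_smul,
    Submodule.Quotient.mk_eq_zero]
  refine mem_range_of_degTwo hl le_rfl fun b => ?_
  rw [map_smul, map_smul]
  exact mul_mem_degTwo_of_mem hc fun v => eps_ar_mul (Q := P.table) _ _ _

lemma jacobson_sq_smul_top (hl : l + 1 ≤ P.top) :
    (Ring.jacobson (P.Al K) ^ 2) • (⊤ : Submodule (P.Al K) (P.TreeMod K l)) = ⊥ := by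
  rw [eq_bot_iff, Submodule.pow_succ, Submodule.pow_one, Submodule.mul_smul]
  refine Submodule.smul_le.mpr fun c hc m hm => ?_
  rw [jacobson_eq] at hc
  exact (Submodule.mem_bot _).mpr (smul_eq_zero_of_mem_rad hl hc hm)

lemma jacobson_pow_smul_top (hl : l + 1 ≤ P.top) (n : ℕ) :
    (Ring.jacobson (P.Al K) ^ (n + 2)) • (⊤ : Submodule (P.Al K) (P.TreeMod K l)) = ⊥ := by
  rw [Submodule.pow_add _ two_ne_zero, Submodule.mul_smul, jacobson_sq_smul_top hl,
    Submodule.smul_bot]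

lemma mem_jacobson_pow_smul_top_iff (hl : l + 1 ≤ P.top) (n : ℕ) (m : P.TreeMod K l) :
    m ∈ (Ring.jacobson (P.Al K) ^ n) • (⊤ : Submodule (P.Al K) (P.TreeMod K l)) ↔
      ∃ c : P.Node l →₀ K, (∀ i ∈ c.support, n ≤ nodeLayer i) ∧
        m = c.sum fun i k => algebraMap K (P.Al K) k • nodeVec i := by
  obtain ⟨p, rfl⟩ := Submodule.Quotient.mk_surjective _ m
  match n with
  | 0 =>
    rw [Submodule.pow_zero, Submodule.one_smul]
    exact ⟨fun _ => ⟨_, fun _ _ => Nat.zero_le _, mk_eq_sum_nodeVec hl p⟩, fun _ => trivial⟩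
  | 1 =>
    rw [Submodule.pow_one]
    constructor
    · intro h
      refine ⟨_, fun i hi => ?_, mk_eq_sum_nodeVec hl p⟩
      rcases i with b | ⟨b, α, hα⟩
      · rw [Finsupp.mem_support_iff] at hi
        exact absurd (nodeDual_top_eq_zero hl h b) hi
      · exact le_rfl
    · rintro ⟨c, hc, h⟩
      rw [h]
      refine sum_mem fun i hi => Submodule.smul_mem _ _ ?_
      have h1 := hc i hi
      rcases i with b | ⟨b, α, hα⟩
      · exact absurd h1 (by simp [nodeLayer])
      · exact nodeVec_low_mem_rad b hα
  | n + 2 =>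
    rw [jacobson_pow_smul_top hl, Submodule.mem_bot]
    constructor
    · intro h
      exact ⟨0, by simp, by rw [h, Finsupp.sum_zero_index]⟩
    · rintro ⟨c, hc, h⟩
      have h0 : c = 0 := Finsupp.support_eq_empty.mp
          (Finset.eq_empty_of_forall_notMem fun i hi => by
        have h1 := hc i hi
        rcases i with b | ⟨b, α, hα⟩ <;> simp [nodeLayer] at h1)
      rw [h, h0, Finsupp.sum_zero_index]

/-- The edges of the graph of the module: the arrow `γ` leads from the basis element `n` to the
basis element `n'`. -/
inductive NodeEdge : P.Node l → P.Arr → P.Node l → Prop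
  | low (b γ h) : NodeEdge (.top b) γ (.low b γ h)
  | rho (i : Fin (P.N (l + 1))) (h) :
      NodeEdge (.top .eta) (rho l i) (.low (.y i) (sig l (P.cl l i)) h)

lemma rho_smul_gen (i : Fin (P.N (l + 1))) (h : P.IsLow l (.y i) (sig l (P.cl l i))) :
    arw (P := P) K (rho l i) • nodeVec (K := K) (.top .eta : P.Node l) =
      nodeVec (.low (.y i) _ h) := by
  have h1 : diff l (P.N (l + 1)) ((1 : P.Al K) • gen _ (Gen.y i)) =
      arw (P := P) K (rho l i) • nodeElt (K := K) (.top .eta) -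
        nodeElt (K := K) (.low (.y i) _ h) := by
    refine crd_ext fun b => ?_
    cases b with
    | eta =>
      rw [crd_eta_diff_smul_y, map_sub, map_smul, one_mul, crd_nodeElt_low_of_ne h Gen.eta_ne_y,
        sub_zero]
      exact (ar_mul_ev_src (Q := P.table) (rho l i)).symm.trans
        (congrArg _ (crd_nodeElt_top_self (K := K) (l := l) .eta).symm)
    | y j =>
      rw [crd_y_diff_smul_y, map_sub, map_smul, one_mul, crd_nodeElt_top_of_ne Gen.y_ne_eta,
        smul_zero, zero_sub]
      by_cases hj : j = i
      · subst hj
        rw [if_pos rfl]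
        exact congrArg _ (crd_nodeElt_low_self (K := K) (.y j) h).symm
      · rw [if_neg fun h => hj (Fin.ext h), crd_nodeElt_low_of_ne h, neg_zero]
        simpa [Gen.up] using hj
  refine (Submodule.Quotient.eq _).mpr ?_
  exact ⟨_, h1⟩

lemma rhoA_smul_gen : arw (P := P) K (rhoA l) • nodeVec (K := K) (.top .eta : P.Node l) = 0 := by
  have h1 : diff l (P.N (l + 1)) ((1 : P.Al K) • gen _ Gen.eta) =
      arw (P := P) K (rhoA l) • nodeElt (K := K) (.top .eta) := by
    refine crd_ext fun b => ?_
    cases b with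
    | eta =>
      rw [crd_eta_diff_smul_eta, map_smul, one_mul]
      exact (ar_mul_ev_src (Q := P.table) (rhoA l)).symm.trans
        (congrArg _ (crd_nodeElt_top_self (K := K) (l := l) .eta).symm)
    | y j =>
      rw [crd_y_diff_smul_eta, map_smul, dif_pos j.2, crd_nodeElt_top_of_ne Gen.y_ne_eta, smul_zero]
  exact (Submodule.Quotient.mk_eq_zero _).mpr ⟨_, h1⟩

lemma NodeEdge.smul_eq {n n' : P.Node l} {γ : P.Arr} (h : NodeEdge n γ n') :
    arw K γ • nodeVec (K := K) n = nodeVec n' := by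
  cases h with
  | low => rfl
  | rho i h => exact rho_smul_gen i h

lemma smul_nodeVec (hl : l + 1 ≤ P.top) (n : P.Node l) {γ : P.Arr}
    (hγ : γ ∈ P.table.arrows P.verts) (hs : src γ = nodeVtx n) :
    arw K γ • nodeVec (K := K) n = 0 ∨ ∃ n', NodeEdge n γ n' := by
  rcases n with b | ⟨b, α, h⟩
  · by_cases h : P.IsLow l b γ
    · exact Or.inr ⟨_, .low b γ h⟩
    · cases γ with
      | rhoA L =>
        cases b with
        | eta =>
          obtain rfl : L = l := by simpa [src, nodeVtx, genVtx] using hs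
          exact Or.inl rhoA_smul_gen
        | y i => simp [src, nodeVtx, genVtx] at hs
      | rho L i =>
        cases b with
        | eta =>
          obtain rfl : L = l := by simpa [src, nodeVtx, genVtx] using hs
          exact Or.inr ⟨_, .rho ⟨i, (rho_mem hl).mp hγ⟩ (isLow_y hl)⟩
        | y i => simp [src, nodeVtx, genVtx] at hs
      | _ => exact absurd ⟨hγ, hs, nofun, nofun⟩ h
  · exact Or.inl (smul_eq_zero_of_mem_rad hl (ar_mem_arrowIdeal (Q := P.table) γ)
      (nodeVec_low_mem_rad b h))

lemma NodeEdge.unique {n n' : P.Node l} {γ γ' : P.Arr} (h : NodeEdge n γ n')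
    (h' : NodeEdge n γ' n') : γ = γ' := by
  cases h <;> cases h' <;> rfl

lemma NodeEdge.mem (hl : l + 1 ≤ P.top) {n n' : P.Node l} {γ : P.Arr} (h : NodeEdge n γ n') :
    γ ∈ P.table.arrows P.verts ∧ src γ = nodeVtx n := by
  cases h with
  | low b γ h => exact ⟨h.mem, h.src_eq⟩
  | rho i h => exact ⟨(rho_mem hl).mpr i.2, rfl⟩

lemma eq_of_nodeVec_eq (hl : l + 1 ≤ P.top) {n n' : P.Node l} {k : K}
    (h : nodeVec (K := K) n = algebraMap K (P.Al K) k • nodeVec n') : n = n' := by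
  classical
  by_contra hne
  have h1 := eq_zero_of_sum_nodeVec (K := K) hl (Finsupp.single n 1 - Finsupp.single n' k) (by
    rw [Finsupp.sum_sub_index fun _ _ _ => by rw [map_sub, sub_smul], Finsupp.sum_single_index,
      Finsupp.sum_single_index, map_one, one_smul, h, sub_self] <;> simp)
  have h2 := DFunLike.congr_fun h1 n
  simp [Ne.symm hne] at h2

lemma nodeVec_ne_zero (hl : l + 1 ≤ P.top) (n : P.Node l) : nodeVec (K := K) n ≠ 0 := by
  intro h
  have h1 := eq_zero_of_sum_nodeVec (K := K) hl (Finsupp.single n 1) (by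
    rw [Finsupp.sum_single_index, h, smul_zero]; simp)
  simp at h1

/-- The edges are determined by the action of the arrows. -/
lemma nodeEdge_iff (hl : l + 1 ≤ P.top) {n n' : P.Node l} {γ : P.Arr}
    (hγ : γ ∈ P.table.arrows P.verts) (hs : src γ = nodeVtx n) :
    NodeEdge n γ n' ↔
      ∃ k : K, k ≠ 0 ∧ arw K γ • nodeVec (K := K) n = algebraMap K (P.Al K) k • nodeVec n' := by
  constructor
  · intro h
    exact ⟨1, one_ne_zero, by rw [h.smul_eq, map_one, one_smul]⟩
  · rintro ⟨k, hk, h⟩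
    rcases smul_nodeVec (K := K) hl n hγ hs with h1 | ⟨m, hm⟩
    · rw [h1] at h
      have h2 := congrArg (fun m : P.TreeMod K l => algebraMap K (P.Al K) k⁻¹ • m) h
      simp only [smul_zero, ← mul_smul, ← map_mul, inv_mul_cancel₀ hk, map_one, one_smul] at h2
      exact absurd h2.symm (nodeVec_ne_zero hl n')
    · rw [hm.smul_eq] at h
      rw [← eq_of_nodeVec_eq hl h]
      exact hm

open Classical in
/-- The parent of a basis element in the tree with root the generator of type `a (l + 1)`. -/
def parent (hl : l + 1 ≤ P.top) : P.Node l → P.Node l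
  | .top .eta => .top .eta
  | .top (.y i) => .low (.y i) (sig l (P.cl l i)) (isLow_y hl)
  | .low .eta _ _ => .top .eta
  | .low (.y i) α _ => if α = sig l (P.cl l i) then .top .eta else .top (.y i)

open Classical in
/-- The distance of a basis element from the root. -/
def depth : P.Node l → ℕ
  | .top .eta => 0
  | .top (.y _) => 2
  | .low .eta _ _ => 1
  | .low (.y i) α _ => if α = sig l (P.cl l i) then 1 else 3

lemma depth_parent_lt (hl : l + 1 ≤ P.top) (n : P.Node l) (hn : n ≠ .top .eta) :
    depth (parent hl n) < depth n := by
  rcases n with (_ | i) | ⟨_ | i, α, h⟩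
  · exact absurd rfl hn
  · simp [parent, depth]
  · simp [parent, depth]
  · by_cases hα : α = sig l (P.cl l i) <;> simp [parent, depth, hα]

lemma exists_nodeEdge_iff (hl : l + 1 ≤ P.top) (n n' : P.Node l) :
    ((∃ γ, NodeEdge n γ n') ∨ ∃ γ, NodeEdge n' γ n) ↔
      (n ≠ .top .eta ∧ parent hl n = n') ∨ (n' ≠ .top .eta ∧ parent hl n' = n) := by
  have h1 : ∀ {n n' : P.Node l}, (∃ γ, NodeEdge n γ n') →
      (n ≠ .top .eta ∧ parent hl n = n') ∨ (n' ≠ .top .eta ∧ parent hl n' = n) := by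
    rintro n n' ⟨γ, ⟨b, γ, h⟩ | ⟨i, h⟩⟩
    · cases b with
      | eta => exact Or.inr ⟨nofun, rfl⟩
      | y i =>
        by_cases hγ : γ = sig l (P.cl l i)
        · subst hγ
          exact Or.inl ⟨by simp, rfl⟩
        · exact Or.inr ⟨nofun, if_neg hγ⟩
    · exact Or.inr ⟨nofun, if_pos rfl⟩
  have h2 : ∀ n : P.Node l, n ≠ .top .eta →
      (∃ γ, NodeEdge n γ (parent hl n)) ∨ ∃ γ, NodeEdge (parent hl n) γ n := by
    rintro ((_ | i) | ⟨_ | i, α, h⟩) hn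
    · exact absurd rfl hn
    · exact Or.inl ⟨_, .low _ _ _⟩
    · exact Or.inr ⟨_, .low _ _ _⟩
    · by_cases hα : α = sig l (P.cl l i)
      · subst hα
        have : parent hl (.low (.y i) _ h) = .top .eta := if_pos rfl
        rw [this]
        exact Or.inr ⟨_, .rho _ _⟩
      · have : parent hl (.low (.y i) _ h) = .top (.y i) := if_neg hα
        rw [this]
        exact Or.inr ⟨_, .low _ _ _⟩
  constructor
  · rintro (h | h)
    · exact h1 h
    · exact (h1 h).symm
  · rintro (⟨h, rfl⟩ | ⟨h, rfl⟩)
    · exact h2 n h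
    · exact (h2 n' h).symm

end

end Profile

namespace QuadraticTable

variable {Q : QuadraticTable} {S : Finset Q.V} {K : Type u} [Field K]

/-! ### Numbers of generators, and the tree graph -/

variable {M : Type u} [AddCommGroup M] [Module (Q.Alg S K) M]

lemma smul_topQuotient_eq_zero {x : Q.Alg S K} (hx : x ∈ arrowIdeal Q S K)
    (t : TopQuotient (Q.Alg S K) M) : x • t = 0 := by
  obtain ⟨m, rfl⟩ := Submodule.Quotient.mk_surjective _ t
  rw [← Submodule.Quotient.mk_smul]
  exact (Submodule.Quotient.mk_eq_zero _).mpr (smul_mem_rad hx m)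

variable [Module K M] [IsScalarTower K (Q.Alg S K) M]

lemma ev_smul_smul_topQuotient (v : Q.V) (x : Q.Alg S K) (t : TopQuotient (Q.Alg S K) M) :
    ev S K v • x • t = eps v x • ev S K v • t := by
  classical
  rw [← mul_smul, ← smul_assoc, ← sub_eq_zero, ← sub_smul]
  refine smul_topQuotient_eq_zero (fun w => ?_) t
  rw [map_sub, map_smul, eps_mul]
  by_cases hv : v ∈ S
  · rw [eps_ev _ _ hv]
    by_cases hw : v = w
    · subst hw; simp
    · simp [hw]
  · rw [ev_of_notMem K hv]; simp

/-- Each simple module has multiplicity at most `n` in the top of a module with `n` generators. -/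
lemma topMultiplicitiesLE_of_isNGenerated {n : ℕ} (h : IsNGenerated (Q.Alg S K) M n) :
    TopMultiplicitiesLE (Q.Alg S K) M n := by
  classical
  intro T _ _ _ k φ hφ
  obtain ⟨g, hg⟩ := h
  have := IsSimpleModule.nontrivial (Q.Alg S K) T
  obtain ⟨s₀, hs₀⟩ := exists_ne (0 : T)
  obtain ⟨v, -, hv⟩ : ∃ v ∈ S, ev S K v • s₀ ≠ 0 := by
    by_contra! h0
    exact hs₀ ((eq_sum_ev_smul s₀).trans (Finset.sum_eq_zero h0))
  set s := ev S K v • s₀ with hs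
  have hvs : ev S K v • s = s := by rw [hs, ← mul_smul, ev_mul_ev_self]
  let t : Fin k → TopQuotient (Q.Alg S K) M := fun i => φ (Pi.single i s)
  let w : Fin n → TopQuotient (Q.Alg S K) M := fun j => ev S K v • Submodule.Quotient.mk (g j)
  have hlin : LinearIndependent K t := by
    rw [Fintype.linearIndependent_iff]
    intro c hc i
    have h1 : φ (fun i => algebraMap K (Q.Alg S K) (c i) • s) = 0 := by
      rw [← hc, ← Finset.univ_sum_single (fun i => algebraMap K (Q.Alg S K) (c i) • s), map_sum]
      refine Finset.sum_congr rfl fun j _ => ?_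
      rw [← algebraMap_smul (Q.Alg S K) (c j) (t j), ← map_smul, ← Pi.single_smul]
    have h2 : algebraMap K (Q.Alg S K) (c i) • s = 0 :=
      congrFun (hφ (h1.trans (map_zero φ).symm)) i
    by_contra hci
    refine hv ?_
    have h3 := congrArg (fun s : T => algebraMap K (Q.Alg S K) (c i)⁻¹ • s) h2
    simpa only [← mul_smul, ← map_mul, inv_mul_cancel₀ hci, map_one, one_smul, smul_zero] using h3
  have hspan : Set.range t ≤ Submodule.span K (Set.range w) := by
    rintro _ ⟨i, rfl⟩
    have h1 : ev S K v • t i = t i := by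
      rw [← map_smul, ← Pi.single_smul, hvs]
    obtain ⟨m, hm⟩ := Submodule.Quotient.mk_surjective _ (t i)
    have h2 : m ∈ Submodule.span (Q.Alg S K) (Set.range g) := hg ▸ Submodule.mem_top
    obtain ⟨c, rfl⟩ := (Submodule.mem_span_range_iff_exists_fun _).mp h2
    rw [← h1, ← hm, ← Submodule.mkQ_apply, map_sum, Finset.smul_sum]
    refine sum_mem fun j _ => ?_
    rw [map_smul, ev_smul_smul_topQuotient]
    exact Submodule.smul_mem _ _ (Submodule.subset_span ⟨j, rfl⟩)
  have h1 := linearIndependent_le_span' t hlin (Set.range w) hspan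
  rw [Cardinal.mk_fin, Nat.cast_le] at h1
  exact h1.trans ((Fintype.card_range_le w).trans_eq (Fintype.card_fin n))

end QuadraticTable

namespace Profile

open Vtx Arr Deg CategoryTheory QuadraticTable

variable {P : Profile} {K : Type u} [Field K]

section

variable {l : ℕ}

/-- The first generator, of type `a (l + 1)`, and one of the others, of type `x (l + 1) 0`, can be
combined into a single one, since the idempotents separate them. -/
lemma isNGenerated_treeMod (hl : l + 1 ≤ P.top) {m : ℕ} (hm : 0 < m) (h : P.N (l + 1) ≤ m) :
    IsNGenerated (P.Al K) (P.TreeMod K l) m := by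
  let u : Fin m → P.TreeMod K l := fun i =>
    if hi : i < P.N (l + 1) then nodeVec (.top (.y ⟨i, hi⟩)) else 0
  let g : Fin m → P.TreeMod K l := fun i =>
    u i + if (i : ℕ) = 0 then nodeVec (.top .eta) else 0
  refine ⟨g, eq_top_iff.mpr fun t _ => ?_⟩
  have hgm : ∀ i, g i ∈ Submodule.span (P.Al K) (Set.range g) := fun i =>
    Submodule.subset_span ⟨i, rfl⟩
  have hu0 : ∀ i, P.ide K (a (l + 1)) • u i = 0 := by
    intro i
    by_cases hi : i < P.N (l + 1)
    · have h1 : P.ide K (a (l + 1)) * P.ide K (nodeVtx (.top (.y ⟨i, hi⟩) : P.Node l)) = 0 :=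
        ev_mul_ev_of_ne (Q := P.table) nofun
      simp only [u, dif_pos hi]
      rw [← ev_smul_nodeVec, ← mul_smul, h1, zero_smul]
    · simp only [u, dif_neg hi, smul_zero]
  have heta : nodeVec (.top .eta) ∈ Submodule.span (P.Al K) (Set.range g) := by
    have h1 := Submodule.smul_mem _ (P.ide K (a (l + 1))) (hgm ⟨0, hm⟩)
    simp only [g, smul_add, hu0, zero_add, if_pos] at h1
    exact (ev_smul_nodeVec (K := K) (.top .eta : P.Node l)) ▸ h1
  have htop : ∀ b, nodeVec (.top b) ∈ Submodule.span (P.Al K) (Set.range g) := by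
    rintro (_ | i)
    · exact heta
    · have h1 : nodeVec (K := K) (.top (.y i) : P.Node l) =
          g ⟨i, i.2.trans_le h⟩ - if (i : ℕ) = 0 then nodeVec (.top .eta) else 0 := by
        simp only [g, u, dif_pos i.2, add_sub_cancel_right]
      rw [h1]
      refine sub_mem (hgm _) ?_
      split_ifs
      · exact heta
      · exact zero_mem _
  obtain ⟨p, rfl⟩ := Submodule.Quotient.mk_surjective _ t
  rw [mk_eq_sum_nodeVec hl]
  refine sum_mem fun n _ => Submodule.smul_mem _ _ ?_
  rcases n with b | ⟨b, α, hα⟩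
  · exact htop b
  · exact Submodule.smul_mem _ (arw K α) (htop b)

lemma mem_arrows_of_hom {b b' : (P.table.bound P.verts K).V} (α : b ⟶ b') :
    α.1 ∈ P.table.arrows P.verts := by
  obtain ⟨α, h1, h2⟩ := α
  refine mem_arrows_verts.mpr ⟨?_, ?_⟩
  · exact (congrArg (· ∈ P.verts) h1).mpr b.2
  · exact (congrArg (· ∈ P.verts) h2).mpr b'.2

instance (l : ℕ) : Module (P.table.bound P.verts K).Alg (P.TreeMod K l) :=
  inferInstanceAs (Module (P.Al K) (P.TreeMod K l))

variable (K) in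
/-- The graph of the module in level `l + 1`. -/
def treeGraph (hl : l + 1 ≤ P.top) : (P.table.bound P.verts K).LayeredGraph (P.TreeMod K l) where
  ι := P.Node l
  x := nodeVec
  type n := ⟨nodeVtx n, nodeVtx_mem hl n⟩
  layer := nodeLayer
  e_smul n := (congrArg (· • nodeVec (K := K) n) (e_eq_ev (Q := P.table) K
    ⟨nodeVtx n, nodeVtx_mem hl n⟩)).trans (ev_smul_nodeVec n)
  independent := eq_zero_of_sum_nodeVec hl
  layer_span := mem_jacobson_pow_smul_top_iff hl
  arrow_smul n b α := by
    have hα : α.1 ∈ P.table.arrows P.verts :=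
      mem_arrows_of_hom α
    have h := congrArg (· • nodeVec (K := K) n) (arr_eq_ar (Q := P.table) K α)
    rcases smul_nodeVec (K := K) hl n hα α.2.1 with h1 | ⟨n', h1⟩
    · exact Or.inl (h.trans h1)
    · exact Or.inr ⟨n', 1, one_ne_zero, h.trans (h1.smul_eq.trans
        (by rw [map_one]; exact (one_smul (P.Al K) _).symm))⟩

lemma edge_treeGraph_iff (hl : l + 1 ≤ P.top) {n n' : P.Node l} {b : (P.table.bound P.verts K).V}
    (α : (treeGraph K hl).type n ⟶ b) : (treeGraph K hl).Edge α n' ↔ NodeEdge n α.1 n' := by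
  have hα : α.1 ∈ P.table.arrows P.verts :=
    mem_arrows_of_hom α
  rw [nodeEdge_iff (K := K) hl hα α.2.1]
  have h := congrArg (· • nodeVec (K := K) n) (arr_eq_ar (Q := P.table) K α)
  exact ⟨fun ⟨k, hk, h1⟩ => ⟨k, hk, h.symm.trans h1⟩, fun ⟨k, hk, h1⟩ => ⟨k, hk, h.trans h1⟩⟩

lemma isTree_treeGraph (hl : l + 1 ≤ P.top) : (treeGraph K hl).IsTree := by
  have hE : ∀ n n' : P.Node l, (∃ (b : (P.table.bound P.verts K).V)
      (α : (treeGraph K hl).type n ⟶ b), (treeGraph K hl).Edge α n') ↔ ∃ γ, NodeEdge n γ n' := by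
    intro n n'
    constructor
    · rintro ⟨b, α, h⟩
      exact ⟨_, (edge_treeGraph_iff hl α).mp h⟩
    · rintro ⟨γ, h⟩
      obtain ⟨h1, h2⟩ := h.mem hl
      exact ⟨⟨tgt γ, (mem_arrows_verts.mp h1).2⟩, ⟨γ, h2, rfl⟩,
        (edge_treeGraph_iff (K := K) (b := ⟨tgt γ, (mem_arrows_verts.mp h1).2⟩) hl
          ⟨γ, h2, rfl⟩).mpr h⟩
  constructor
  · have : Finite (treeGraph K hl).ι := inferInstanceAs (Finite (P.Node l))
    refine SimpleGraph.isTree_of_parent _ (Node.top .eta) (parent hl) depth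
      (depth_parent_lt hl) fun (n n' : P.Node l) => ?_
    have h1 : (treeGraph K hl).toSimpleGraph.Adj n n' ↔ n ≠ n' ∧
        ((∃ γ, NodeEdge n γ n') ∨ ∃ γ, NodeEdge n' γ n) := by
      rw [← hE n n', ← hE n' n]
      exact SimpleGraph.fromRel_adj _ _ _
    refine h1.trans ((and_iff_right_of_imp ?_).trans (exists_nodeEdge_iff hl n n'))
    intro h
    rcases (exists_nodeEdge_iff hl n n').mp h with ⟨hr, h'⟩ | ⟨hr, h'⟩ <;> rintro rfl <;>
      · have h2 := depth_parent_lt hl _ hr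
        rw [h'] at h2
        exact absurd h2 (lt_irrefl _)
  · rintro n n' b b' α β hα hβ
    have h1 : α.1 = β.1 :=
      ((edge_treeGraph_iff hl _).mp hα).unique ((edge_treeGraph_iff hl _).mp hβ)
    have h2 : b.1 = b'.1 := α.2.2.symm.trans ((congrArg tgt h1).trans β.2.2)
    obtain rfl : b = b' := by cases b; cases b'; cases h2; rfl
    obtain rfl : α = β := Subtype.ext h1
    rfl

end

end Profile

namespace Profile

open CategoryTheory QuadraticTable

/-! ### The profile of a function -/

section Values

variable (f : ℕ+ → ℕ)

/-- The least `n` with `L ≤ f n`, or `0` if `L` is at most the minimum of `f`. Beyond the maximum of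
`f`, it is the value at the maximum, so that it is monotone in `L`. -/
def threshold (L : ℕ) : ℕ :=
  sInf {n : ℕ | min L (sSup (Set.range f)) ≤ sInf (Set.range f) ∨
    ∃ h : 0 < n, min L (sSup (Set.range f)) ≤ f ⟨n, h⟩}

variable {f}

lemma sInf_range_le (n : ℕ+) : sInf (Set.range f) ≤ f n := Nat.sInf_le ⟨n, rfl⟩

lemma le_sSup_range (hfin : (Set.range f).Finite) (n : ℕ+) : f n ≤ sSup (Set.range f) :=
  le_csSup hfin.bddAbove ⟨n, rfl⟩

lemma threshold_mem (hfin : (Set.range f).Finite) (L : ℕ) :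
    min L (sSup (Set.range f)) ≤ sInf (Set.range f) ∨
    ∃ h : 0 < threshold f L, min L (sSup (Set.range f)) ≤ f ⟨threshold f L, h⟩ := by
  obtain ⟨m, hm⟩ := Nat.sSup_mem (Set.range_nonempty f) hfin.bddAbove
  exact Nat.sInf_mem (s := {n : ℕ | min L (sSup (Set.range f)) ≤ sInf (Set.range f) ∨
    ∃ h : 0 < n, min L (sSup (Set.range f)) ≤ f ⟨n, h⟩})
    ⟨m, Or.inr ⟨m.2, (min_le_right _ _).trans hm.ge⟩⟩

lemma threshold_le_iff (hmono : Monotone f) (hfin : (Set.range f).Finite) {L : ℕ}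
    (hL : L ≤ sSup (Set.range f)) (n : ℕ+) : threshold f L ≤ n ↔ L ≤ f n := by
  have h := threshold_mem hfin L
  rw [min_eq_left hL] at h
  constructor
  · intro hn
    rcases h with h | ⟨h0, h⟩
    · exact h.trans (sInf_range_le n)
    · exact h.trans (hmono hn)
  · intro hn
    exact Nat.sInf_le (Or.inr ⟨n.2, (min_le_left _ _).trans hn⟩)

/-- The profile of an increasing function with finitely many values. -/
def ofFun (htwo : ∀ n, 2 ≤ f n) (hfin : (Set.range f).Finite) : Profile where
  bot := sInf (Set.range f)
  top := sSup (Set.range f)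
  N := threshold f
  one_le_bot := by
    obtain ⟨m, hm⟩ := Nat.sInf_mem (Set.range_nonempty f)
    exact hm ▸ one_le_two.trans (htwo m)
  bot_le_top := (sInf_range_le 1).trans (le_sSup_range hfin 1)
  mono L L' h := by
    have h1 := min_le_min_right (sSup (Set.range f)) h
    exact Nat.sInf_le ((threshold_mem hfin L').imp h1.trans fun ⟨h0, h2⟩ => ⟨h0, h1.trans h2⟩)
  N_eq_zero L hL := Nat.eq_zero_of_le_zero (Nat.sInf_le (Or.inl ((min_le_left _ _).trans hL)))

end Values

section Bounds

variable {P : Profile} {K : Type u} [Field K]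

/-- A bound for the finite projective dimensions of modules with small tops. -/
lemma projectiveDimension_le {M : ModuleCat.{u} (P.Al K)} {n F : ℕ}
    (hn : TopMultiplicitiesLE (P.Al K) M n) (hM : projectiveDimension M ≠ ⊤) (hF : P.bot ≤ F)
    (hFn : ∀ L, F < L → L ≤ P.top → n < P.N L) : projectiveDimension M ≤ (F : WithBot ℕ∞) := by
  let : Module K M := Module.compHom M (algebraMap K (P.Al K))
  have : IsScalarTower K (P.Al K) M := ⟨fun k x m => by
    rw [Algebra.smul_def, mul_smul]; rfl⟩
  obtain ⟨d, hd⟩ := (projectiveDimension_ne_top_iff M).mp hM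
  exact (projectiveDimension_le_iff M F).mpr
    (hasProjectiveDimensionLT_of_topMultiplicitiesLE (M := M) ⟨d + 1, hd⟩ hn hF hFn)

end Bounds

end Profile

end Stacks

open Stacks Stacks.Profile CategoryTheory in
theorem theorem10 (K : Type u) [Field K] (f : ℕ+ → ℕ) (hmono : Monotone f)
    (htwo : ∀ n, 2 ≤ f n) (hfin : (Set.range f).Finite) :
    ∃ B : Stacks.BoundQuiver K,
      Stacks.IsConnectedRing B.Alg ∧
      FiniteDimensional K B.Alg ∧
      Ring.jacobson B.Alg ^ 3 = ⊥ ∧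
      (∀ n : ℕ+, Stacks.finDim B.Alg n = (f n : WithBot ℕ∞)) ∧
      (∃ Δ : Fin (⌈((sSup (Set.range f) - sInf (Set.range f) : ℕ) : ℚ) / 2⌉₊ + 1) →
          Stacks.BoundQuiver K,
        (∀ i, (Δ i).IsMonomial) ∧ B.IsStack _ Δ) ∧
      ∀ n : ℕ+, ∃ M : ModuleCat.{u} B.Alg,
        Stacks.IsNGenerated B.Alg M n ∧
        CategoryTheory.projectiveDimension M = (f n : WithBot ℕ∞) ∧
        (Ring.jacobson B.Alg ^ 2) • (⊤ : Submodule B.Alg M) = ⊥ ∧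
        ∃ G : B.LayeredGraph M, G.IsTree := by
  let P := ofFun htwo hfin
  have hattain : ∀ n : ℕ+, ∃ l, f n = l + 2 ∧ l + 2 ≤ P.top ∧ P.N (l + 2) ≤ n := by
    intro n
    obtain ⟨l, hl⟩ := Nat.exists_eq_add_of_le' (htwo n)
    have h := hl ▸ le_sSup_range hfin n
    exact ⟨l, hl, h, (threshold_le_iff hmono hfin h n).mpr hl.ge⟩
  refine ⟨P.table.bound P.verts K, isConnectedRing_verts K, QuadraticTable.finiteDimensional,
    QuadraticTable.jacobson_pow_three, fun n => le_antisymm (sSup_le ?_) ?_, ?_, fun n => ?_⟩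
  · rintro _ ⟨hp, M, hM, rfl⟩
    refine projectiveDimension_le (P := P) (M := M) hM hp (sInf_range_le n) fun L hL hLP => ?_
    by_contra! h
    exact hL.not_ge ((threshold_le_iff hmono hfin hLP n).mp h)
  · obtain ⟨l, hl, hlP, hN⟩ := hattain n
    have h := projectiveDimension_treeMod (K := K) hlP
    rw [hl]
    refine le_sSup ⟨?_, _, ?_, h⟩
    · exact fun h => ENat.natCast_ne_top _ (WithBot.coe_injective h)
    · exact QuadraticTable.topMultiplicitiesLE_of_isNGenerated
        (isNGenerated_treeMod hlP n.2 hN)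
  · refine isStack_verts K _ ?_ ?_
    · have h := Nat.le_ceil (((P.top - P.bot : ℕ) : ℚ) / 2)
      have h' : P.top - P.bot ≤ 2 * ⌈((P.top - P.bot : ℕ) : ℚ) / 2⌉₊ := by
        rw [← Nat.cast_le (α := ℚ)]
        rw [Nat.cast_mul, Nat.cast_ofNat]
        linarith
      exact Nat.sub_le_iff_le_add'.mp h'
    · have h := Nat.ceil_lt_add_one (a := ((P.top - P.bot : ℕ) : ℚ) / 2) (by positivity)
      have h' : 2 * ⌈((P.top - P.bot : ℕ) : ℚ) / 2⌉₊ < P.top - P.bot + 2 := by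
        rw [← Nat.cast_lt (α := ℚ), Nat.cast_add, Nat.cast_mul, Nat.cast_ofNat]
        linarith
      have h1 := P.bot_le_top
      change P.bot + 2 * ⌈((P.top - P.bot : ℕ) : ℚ) / 2⌉₊ ≤ P.top + 1
      omega
  · obtain ⟨l, hl, hlP, hN⟩ := hattain n
    exact ⟨ModuleCat.of (P.Al K) (P.TreeMod K (l + 1)), isNGenerated_treeMod hlP n.2 hN,
      (projectiveDimension_treeMod hlP).trans (by rw [hl]), jacobson_sq_smul_top hlP,
      treeGraph K hlP, isTree_treeGraph hlP⟩

end
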